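/- Let $M^2$ be a connected smooth $2$-manifold and $H^3=\{x\in\mathbb R^4_1:\langle x,x\rangle=-1,\ x_0>0\}$ hyperbolic space in Lorentz–Minkowski space of signature $(-,+,+,+)$. A front is a smooth map $f:M^2\to H^3$ such that each point has an open neighborhood $U$ carrying a smooth unit normal field $\nu$ ($\langle\nu,\nu\rangle=1$, $\langle f,\nu\rangle=0$, $\langle df,\nu\rangle=0$) for which $(f,\nu)$ is an immersion; its parallel fronts on $U$ are $f_\delta=(\cosh\delta)f+(\sinh\delta)\nu$, with unit normal $\nu_\delta=(\cosh\delta)\nu+(\sinh\delta)f$, $\delta\in\mathbb R$. Put $I=\langle df,df\rangle$, $I\!I=-\langle df,d\nu\rangle$; at regular points of $f$ (where $df$ is injective) let $H=\frac12\operatorname{tr}(I^{-1}I\!I)$ and $K=\det I\!I/\det I-1$ be the mean and Gaussian curvature. For $\varepsilon\in\mathbb R$ let $W_\varepsilon(M^2)$ be the set of fronts $f:M^2\to H^3$ that have a regular point and for which each point has a neighborhood $U$ with a unit normal field $\nu$ such that (i) for some $\delta_0\in\mathbb R$ the parallel front $f_{\delta_0}$ is an immersion on $U$ satisfying $a(H-1)+bK=0$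 for some real constants $(a,b)\neq(0,0)$, and (ii) $2\varepsilon(H-1)+(1-\varepsilon)K=0$ at the regular points of $f$ in $U$. Let $\varepsilon>0$ and let $f\in W_\varepsilon(M^2)$, where $f(M^2)$ is not contained in a geodesic sphere. Then $f$ has a global unit normal field $\nu$, making $(f,\nu)$ an immersion, with $2\varepsilon(H-1)+(1-\varepsilon)K=0$ at all regular points, and this $\nu$ is unique. There is a real number $\delta$ such that $f_\delta:M^2\to H^3$ (with unit normal $\nu_\delta$) is a CMC-1 front, i.e. a front with regular points, at all of which its mean curvature is $1$. If $f(M^2)$ is not contained in a horosphere, then $\delta$ is the only real number with this property. Moreover: 1. The singular points of $f_\delta$ are isolated in $M^2$. 2. Call a smooth local complex coordinate $z$ of $M^2$ conformal if $I_{f_\delta}=\lambda|dz|^2$ with a function $\lambda\ge0$. Around each singular point of $f_\delta$ there is a conformal coordinate. In every conformal coordinate $z$, the Hopf differential $Q=q\,dz^2$ of $f_\delta$, that is, the $(2,0)$-part of $-I\!I_{f_\delta}$ ($q=\langle\partial_z f_\delta,\partial_z\nu_\delta\rangle$), is holomorphic, and a point of the domain of $z$ is a singular point of $f_\delta$ if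 and only if $Q$ vanishes and $d(f+\nu)\ne0$ there. In particular all singular points of $f_\delta$ are zeros of $Q$. -/

import Mathlib

open scoped Manifold ContDiff Topology

noncomputable section

namespace LWFront

/-- The vector space underlying Lorentz-Minkowski 4-space. -/
abbrev R41 : Type := Fin 4 → ℝ

/-- The Lorentz metric of signature `(-,+,+,+)`. -/
def lor (x y : R41) : ℝ := -(x 0 * y 0) + x 1 * y 1 + x 2 * y 2 + x 3 * y 3

/-- Hyperbolic 3-space as the upper sheet of the two-sheeted hyperboloid. -/
def H3 : Set R41 := {x | lor x x = -1 ∧ 0 < x 0}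

section Surface

variable {M : Type*} [TopologicalSpace M] [ChartedSpace (EuclideanSpace ℝ (Fin 2)) M]

/-- The differential at `p` of a map from a surface to `R41`. -/
def dmap (f : M → R41) (p : M) : EuclideanSpace ℝ (Fin 2) →L[ℝ] R41 :=
  mfderiv (𝓡 2) 𝓘(ℝ, R41) f p

/-- `p` is a regular point of `f`: the differential of `f` at `p` is injective. -/
def IsRegularAt (f : M → R41) (p : M) : Prop :=
  Function.Injective (dmap f p)

/-- The set of singular points of `f`. -/
def singularSet (f : M → R41) : Set M := {p | ¬ IsRegularAt f p}

/-- A basis of the tangent space of the surface. -/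
def tvec (i : Fin 2) : EuclideanSpace ℝ (Fin 2) := EuclideanSpace.single i 1

/-- The matrix of the first fundamental form `I = ⟨df, df⟩` at `p`. -/
def firstFF (f : M → R41) (p : M) : Matrix (Fin 2) (Fin 2) ℝ :=
  Matrix.of fun i j => lor (dmap f p (tvec i)) (dmap f p (tvec j))

/-- The matrix of the second fundamental form `II = -⟨df, dν⟩` at `p`. -/
def secondFF (f ν : M → R41) (p : M) : Matrix (Fin 2) (Fin 2) ℝ :=
  Matrix.of fun i j => - lor (dmap f p (tvec i)) (dmap ν p (tvec j))

/-- Mean curvature, half the trace of the shape operator `A` (where `dν = -df ∘ A`).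
It is only used at regular points of `f`. -/
def meanCurv (f ν : M → R41) (p : M) : ℝ :=
  ((firstFF f p)⁻¹ * secondFF f ν p).trace / 2

/-- Gaussian curvature of a surface in hyperbolic 3-space: by the Gauss equation it is the
product `det II / det I` of the principal curvatures plus the ambient curvature `-1`.
It is only used at regular points of `f`. -/
def gaussCurv (f ν : M → R41) (p : M) : ℝ :=
  (secondFF f ν p).det / (firstFF f p).det - 1

/-- On the open set `U` the map `f` is a front in `H3` with unit normal field `ν`:
`f` and `ν` are smooth, `ν` is de Sitter valued, `⟨f, ν⟩ = 0`, `⟨df, ν⟩ = 0`, and the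
Legendrian lift `(f, ν)` is an immersion. -/
structure IsFrontOn (f ν : M → R41) (U : Set M) : Prop where
  smooth : ContMDiffOn (𝓡 2) 𝓘(ℝ, R41) ∞ f U
  smooth_normal : ContMDiffOn (𝓡 2) 𝓘(ℝ, R41) ∞ ν U
  mem_H3 : ∀ p ∈ U, f p ∈ H3
  unit : ∀ p ∈ U, lor (ν p) (ν p) = 1
  orth : ∀ p ∈ U, lor (f p) (ν p) = 0
  normal : ∀ p ∈ U, ∀ v, lor (dmap f p v) (ν p) = 0
  immersion : ∀ p ∈ U, ∀ v, dmap f p v = 0 → dmap ν p v = 0 → v = 0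

/-- The parallel front `f_δ = (cosh δ) f + (sinh δ) ν`. -/
def parallel (f ν : M → R41) (δ : ℝ) : M → R41 :=
  fun p => Real.cosh δ • f p + Real.sinh δ • ν p

/-- The unit normal field `ν_δ = (cosh δ) ν + (sinh δ) f` of the parallel front. -/
def parallelNormal (f ν : M → R41) (δ : ℝ) : M → R41 :=
  fun p => Real.cosh δ • ν p + Real.sinh δ • f p

/-- On `U`, the map `f` with unit normal field `ν` is a horospherical linear Weingarten
immersion. -/
def IsHLWImmersionOn (f ν : M → R41) (U : Set M) : Prop :=
  (∀ p ∈ U, IsRegularAt f p) ∧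
    ∃ a b : ℝ, a ^ 2 + b ^ 2 ≠ 0 ∧
      ∀ p ∈ U, a * (meanCurv f ν p - 1) + b * gaussCurv f ν p = 0

/-- The relation `2ε(H - 1) + (1 - ε)K = 0` at the regular points of `f` in `U`. -/
def WeingartenRel (ε : ℝ) (f ν : M → R41) (U : Set M) : Prop :=
  ∀ p ∈ U, IsRegularAt f p →
    2 * ε * (meanCurv f ν p - 1) + (1 - ε) * gaussCurv f ν p = 0

/-- The class `W_ε(M)` for real `ε`: horospherical linear Weingarten fronts `f : M → H3`
(not assumed co-orientable, having regular points) with `2ε(H - 1) + (1 - ε)K = 0`. Near each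
point, with respect to a local unit normal field, some parallel front is a horospherical linear
Weingarten immersion and the relation holds at the regular points of `f`. -/
def W (ε : ℝ) : Set (M → R41) :=
  {f | (∃ p, IsRegularAt f p) ∧
    ∀ p : M, ∃ U : Set M, IsOpen U ∧ p ∈ U ∧ ∃ ν : M → R41,
      IsFrontOn f ν U ∧
      (∃ δ₀ : ℝ, IsHLWImmersionOn (parallel f ν δ₀) (parallelNormal f ν δ₀) U) ∧
      WeingartenRel ε f ν U}

/-- `ν` is a global unit normal field of `f` for which the relation of `W ε` holds. -/
def IsWeingartenNormal (ε : ℝ) (f ν : M → R41) : Prop :=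
  IsFrontOn f ν Set.univ ∧ WeingartenRel ε f ν Set.univ

/-- `f` with unit normal field `ν` is a CMC-1 front in `H3`: a front with regular points,
whose mean curvature is `1` at all of them. -/
def IsCMC1Front (f ν : M → R41) : Prop :=
  IsFrontOn f ν Set.univ ∧ (∃ p, IsRegularAt f p) ∧
    ∀ p, IsRegularAt f p → meanCurv f ν p = 1

/-- The image of `f` lies in a geodesic sphere of `H3`: the points `x` of `H3` at a fixed distance
`r` from `c` are those with `⟨x, c⟩ = -cosh r`. -/
def InGeodesicSphere (f : M → R41) : Prop :=
  ∃ c ∈ H3, ∃ r : ℝ, ∀ p, lor (f p) c = -Real.cosh r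

/-- The image of `f` lies in a horosphere of `H3`. -/
def InHorosphere (f : M → R41) : Prop :=
  ∃ c : R41, c ≠ 0 ∧ lor c c = 0 ∧ ∀ p, lor (f p) c = -1

/-- Partial derivative of `f` with respect to `x` in the coordinate `z = x + i y`. -/
def dx (z : OpenPartialHomeomorph M ℂ) (f : M → R41) (w : ℂ) : R41 :=
  fderiv ℝ (f ∘ z.symm) w 1

/-- Partial derivative of `f` with respect to `y` in the coordinate `z = x + i y`. -/
def dy (z : OpenPartialHomeomorph M ℂ) (f : M → R41) (w : ℂ) : R41 :=
  fderiv ℝ (f ∘ z.symm) w Complex.I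

/-- `z` is a smooth complex-valued local coordinate of `M` with respect to which the first
fundamental form of `f` is Hermitian, that is, a (possibly vanishing) multiple of `|dz|^2`. -/
structure IsConformalCoord (z : OpenPartialHomeomorph M ℂ) (f : M → R41) : Prop where
  smooth : ContMDiffOn (𝓡 2) 𝓘(ℝ, ℂ) ∞ z z.source
  smooth_symm : ContMDiffOn 𝓘(ℝ, ℂ) (𝓡 2) ∞ z.symm z.target
  norm_eq : ∀ w ∈ z.target, lor (dx z f w) (dx z f w) = lor (dy z f w) (dy z f w)
  orth : ∀ w ∈ z.target, lor (dx z f w) (dy z f w) = 0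

/-- The coefficient `q` of the Hopf differential `Q = q dz^2`, the `(2,0)`-part of
`-II = ⟨df, dν⟩`, in the coordinate `z`: here `q = ⟨f_z, ν_z⟩` with `∂_z = (∂_x - i ∂_y) / 2` and
the complex bilinear extension of the (symmetric) form `⟨df, dν⟩`. -/
def hopf (z : OpenPartialHomeomorph M ℂ) (f ν : M → R41) (w : ℂ) : ℂ :=
  (((lor (dx z f w) (dx z ν w) - lor (dy z f w) (dy z ν w) : ℝ) : ℂ)
    - 2 * Complex.I * ((lor (dx z f w) (dy z ν w) : ℝ) : ℂ)) / 4

end Surface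

end LWFront

end

/-!
At a regular point, `2ε(H - 1) + (1 - ε)K = 0` is equivalent to an equation between the area forms
of `df` and `d(f + ν)` which makes sense at singular points too. Passing to the parallel front
multiplies `f + ν` by `exp δ`, and `δ = log ε / 2` turns the relation into that for `H = 1`.

Local facts give density of the regular points, and hence a global relation: two independent
relations force `d(f + ν) = 0`, where `f` is regular, and for `ε > 0` the relation cannot hold
on an open set for both `ν` and `-ν`, since the principal curvatures would be constant there,
contradicting Cartan's formula. Therefore local unit normal fields agree and glue together.

A front with `H = 1` is conformal to its Gauss map `f + ν`, which takes values in the light cone.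
In the coordinates given by the Gauss map, or by the front itself where the Gauss map is singular,
the Hopf differential is holomorphic, and it vanishes exactly where `df = 0` or `d(f + ν) = 0`.
These two closed sets are disjoint, so by connectedness either one of them is all of `M`, in which
case `f` lies in a geodesic sphere or a horosphere, or both consist of isolated points.
-/

noncomputable section

namespace LWFront

/-! ### Lorentzian linear algebra -/

section Algebra

@[simp] theorem lor_add_left (x y z : R41) : lor (x + y) z = lor x z + lor y z := by
  simp only [lor, Pi.add_apply]; ring

@[simp] theorem lor_add_right (x y z : R41) : lor x (y + z) = lor x y + lor x z := by
  simp only [lor, Pi.add_apply]; ring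

@[simp] theorem lor_smul_left (r : ℝ) (x y : R41) : lor (r • x) y = r * lor x y := by
  simp only [lor, Pi.smul_apply, smul_eq_mul]; ring

@[simp] theorem lor_smul_right (r : ℝ) (x y : R41) : lor x (r • y) = r * lor x y := by
  simp only [lor, Pi.smul_apply, smul_eq_mul]; ring

theorem lor_comm (x y : R41) : lor x y = lor y x := by
  simp only [lor]; ring

/-- The Lorentz metric as a continuous bilinear map. -/
def lorL : R41 →L[ℝ] R41 →L[ℝ] ℝ :=
  (LinearMap.mk₂ ℝ lor lor_add_left lor_smul_left lor_add_right
    lor_smul_right).toContinuousBilinearMap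

theorem lorL_apply (x y : R41) : lorL x y = lor x y := rfl

@[simp] theorem lor_zero_left (x : R41) : lor 0 x = 0 := by simp [lor]

@[simp] theorem lor_zero_right (x : R41) : lor x 0 = 0 := by simp [lor]

@[simp] theorem lor_neg_left (x y : R41) : lor (-x) y = -lor x y := by
  simp only [lor, Pi.neg_apply]; ring

@[simp] theorem lor_neg_right (x y : R41) : lor x (-y) = -lor x y := by
  simp only [lor, Pi.neg_apply]; ring

/-- The volume form of `R41`. When `F`, `N` are orthonormal, `vol F N` is an area form on their
orthogonal complement. -/
def vol (F N x y : R41) : ℝ := (Matrix.of ![F, N, x, y]).det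

theorem vol_eq (F N x y : R41) : vol F N x y =
    (F 0 * N 1 - F 1 * N 0) * (x 2 * y 3 - x 3 * y 2)
    - (F 0 * N 2 - F 2 * N 0) * (x 1 * y 3 - x 3 * y 1)
    + (F 0 * N 3 - F 3 * N 0) * (x 1 * y 2 - x 2 * y 1)
    + (F 1 * N 2 - F 2 * N 1) * (x 0 * y 3 - x 3 * y 0)
    - (F 1 * N 3 - F 3 * N 1) * (x 0 * y 2 - x 2 * y 0)
    + (F 2 * N 3 - F 3 * N 2) * (x 0 * y 1 - x 1 * y 0) := by
  rw [vol, Matrix.det_succ_row_zero]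
  simp [Matrix.det_succ_row_zero, Fin.sum_univ_succ, Fin.succAbove]
  ring

variable {F N x y z : R41}

@[simp] theorem vol_add_left (F N x y z : R41) :
    vol F N (x + y) z = vol F N x z + vol F N y z := by
  simp only [vol_eq, Pi.add_apply]; ring

@[simp] theorem vol_add_right (F N x y z : R41) :
    vol F N x (y + z) = vol F N x y + vol F N x z := by
  simp only [vol_eq, Pi.add_apply]; ring

@[simp] theorem vol_smul_left (F N : R41) (r : ℝ) (x y : R41) :
    vol F N (r • x) y = r * vol F N x y := by
  simp only [vol_eq, Pi.smul_apply, smul_eq_mul]; ring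

@[simp] theorem vol_smul_right (F N : R41) (r : ℝ) (x y : R41) :
    vol F N x (r • y) = r * vol F N x y := by
  simp only [vol_eq, Pi.smul_apply, smul_eq_mul]; ring

theorem vol_swap (F N x y : R41) : vol F N x y = -vol F N y x := by
  simp only [vol_eq]; ring

@[simp] theorem vol_self (F N x : R41) : vol F N x x = 0 := by
  simp only [vol_eq]; ring

@[simp] theorem vol_zero_left (F N x : R41) : vol F N 0 x = 0 := by simp [vol_eq]

@[simp] theorem vol_neg_right (F N x y : R41) : vol F N x (-y) = -vol F N x y := by
  simp only [vol_eq, Pi.neg_apply]; ring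

@[simp] theorem vol_neg_normal (F N x y : R41) : vol F (-N) x y = -vol F N x y := by
  simp only [vol_eq, Pi.neg_apply]; ring

theorem vol_parallel {c s : ℝ} (h : c ^ 2 - s ^ 2 = 1) (F N x y : R41) :
    vol (c • F + s • N) (c • N + s • F) x y = vol F N x y := by
  have : vol (c • F + s • N) (c • N + s • F) x y = (c ^ 2 - s ^ 2) * vol F N x y := by
    simp only [vol_eq, Pi.add_apply, Pi.smul_apply, smul_eq_mul]; ring
  rw [this, h, one_mul]

/-- The metric has determinant `-1`, whence the sign. -/
theorem vol_mul_vol (a b : Fin 4 → R41) :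
    vol (a 0) (a 1) (a 2) (a 3) * vol (b 0) (b 1) (b 2) (b 3)
      = -(Matrix.of fun i j => lor (a i) (b j)).det := by
  have hgram : (Matrix.of fun i j => lor (a i) (b j))
      = Matrix.of a * Matrix.diagonal ![-1, 1, 1, 1] * (Matrix.of b).transpose := by
    ext i j
    simp [lor, Matrix.mul_apply, Fin.sum_univ_succ, Matrix.diagonal_apply]
    ring
  have hvol : ∀ a : Fin 4 → R41, vol (a 0) (a 1) (a 2) (a 3) = (Matrix.of a).det := fun a => by
    rw [vol]
    congr 1
    ext i : 1
    fin_cases i <;> rfl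
  rw [hgram, Matrix.det_mul, Matrix.det_mul, Matrix.det_transpose, Matrix.det_diagonal, hvol, hvol]
  simp [Fin.prod_univ_succ]

/-- `F`, `N` is an orthonormal pair with `F` timelike and `N` spacelike. -/
structure OrthoPair (F N : R41) : Prop where
  timelike : lor F F = -1
  spacelike : lor N N = 1
  orth : lor F N = 0

/-- `x` is orthogonal to `F` and to `N`; for a front at a point, this is the tangent plane. -/
def Perp (F N x : R41) : Prop := lor F x = 0 ∧ lor N x = 0

theorem Perp.add (hx : Perp F N x) (hy : Perp F N y) : Perp F N (x + y) := by
  simp [Perp, hx.1, hx.2, hy.1, hy.2]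

theorem Perp.smul (hx : Perp F N x) (r : ℝ) : Perp F N (r • x) := by
  simp [Perp, hx.1, hx.2]

theorem lor_self_nonneg_of_timelike (hF : lor F F = -1) (hx : lor F x = 0) : 0 ≤ lor x x ∧
    (lor x x = 0 → x = 0) := by
  simp only [lor] at hF hx ⊢
  have hF0 : 0 < F 0 ^ 2 := by nlinarith [sq_nonneg (F 1), sq_nonneg (F 2), sq_nonneg (F 3)]
  -- Lagrange's identity for the spatial parts of `F` and `x`
  have key : F 0 ^ 2 * (-(x 0 * x 0) + x 1 * x 1 + x 2 * x 2 + x 3 * x 3) =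
      x 1 ^ 2 + x 2 ^ 2 + x 3 ^ 2 + ((F 1 * x 2 - F 2 * x 1) ^ 2
        + (F 1 * x 3 - F 3 * x 1) ^ 2 + (F 2 * x 3 - F 3 * x 2) ^ 2) := by
    linear_combination (-(x 1 ^ 2 + x 2 ^ 2 + x 3 ^ 2)) * hF
      + (F 0 * x 0 + F 1 * x 1 + F 2 * x 2 + F 3 * x 3) * hx
  refine ⟨nonneg_of_mul_nonneg_right (key ▸ by positivity) hF0, fun h => ?_⟩
  rw [h, mul_zero] at key
  have hspatial : x 1 ^ 2 + x 2 ^ 2 + x 3 ^ 2 = 0 :=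
    le_antisymm (by rw [key]; exact le_add_of_nonneg_right (by positivity)) (by positivity)
  have h1 : x 1 = 0 := by nlinarith [hspatial, sq_nonneg (x 1), sq_nonneg (x 2), sq_nonneg (x 3)]
  have h2 : x 2 = 0 := by nlinarith [hspatial, sq_nonneg (x 1), sq_nonneg (x 2), sq_nonneg (x 3)]
  have h3 : x 3 = 0 := by nlinarith [hspatial, sq_nonneg (x 1), sq_nonneg (x 2), sq_nonneg (x 3)]
  have h0 : x 0 = 0 := by simpa [h1, h2, h3, pow_pos_iff] using h
  ext i
  fin_cases i <;> assumption

namespace OrthoPair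

theorem vol_mul_vol (h : OrthoPair F N) {e x y z : R41} (he : Perp F N e) (hx : Perp F N x)
    (hy : Perp F N y) (hz : Perp F N z) :
    vol F N e x * vol F N y z = lor e y * lor x z - lor e z * lor x y := by
  have := LWFront.vol_mul_vol ![F, N, e, x] ![F, N, y, z]
  simp only [Matrix.det_succ_row_zero, Fin.sum_univ_succ] at this
  simp [lor_comm N F, lor_comm e F, lor_comm e N, lor_comm x F, lor_comm x N, h.timelike,
    h.spacelike, h.orth, he.1, he.2, hx.1, hx.2, hy.1, hy.2, hz.1, hz.2] at this
  linarith

theorem eq_zero_of_lor_self (h : OrthoPair F N) (hx : Perp F N x) (h0 : lor x x = 0) : x = 0 :=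
  (lor_self_nonneg_of_timelike h.timelike hx.1).2 h0

theorem lor_self_pos (h : OrthoPair F N) (hx : Perp F N x) (h0 : x ≠ 0) : 0 < lor x x :=
  (lor_self_nonneg_of_timelike h.timelike hx.1).1.lt_of_ne'
    fun h' => h0 (h.eq_zero_of_lor_self hx h')

theorem exists_unit_perp (h : OrthoPair F N) (e : R41) :
    ∃ x, Perp F N x ∧ lor e x = 0 ∧ lor x x = 1 := by
  let L : R41 →ₗ[ℝ] ℝ × ℝ × ℝ :=
    ((lorL F).toLinearMap.prod ((lorL N).toLinearMap.prod (lorL e).toLinearMap))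
  obtain ⟨x, hx, hx0⟩ := L.ker.exists_mem_ne_zero_of_ne_bot
    (LinearMap.ker_ne_bot_of_finrank_lt (by simp))
  obtain ⟨hF, hN, he⟩ : lor F x = 0 ∧ lor N x = 0 ∧ lor e x = 0 := by
    simpa [L, lorL_apply] using hx
  have hpos := h.lor_self_pos ⟨hF, hN⟩ hx0
  refine ⟨(√(lor x x))⁻¹ • x, Perp.smul ⟨hF, hN⟩ _, by simp [he], ?_⟩
  have hsq := Real.mul_self_sqrt hpos.le
  have hne := (Real.sqrt_pos.2 hpos).ne'
  rw [lor_smul_left, lor_smul_right]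
  field_simp
  linarith

theorem exists_frame (h : OrthoPair F N) :
    ∃ e₁ e₂, Perp F N e₁ ∧ Perp F N e₂ ∧ lor e₁ e₁ = 1 ∧ lor e₂ e₂ = 1 ∧ lor e₁ e₂ = 0 ∧
      vol F N e₁ e₂ = 1 := by
  obtain ⟨e₁, h₁, -, hu₁⟩ := h.exists_unit_perp 0
  obtain ⟨e₂, h₂, h₁₂, hu₂⟩ := h.exists_unit_perp e₁
  have hsq := h.vol_mul_vol h₁ h₂ h₁ h₂
  rw [hu₁, hu₂, h₁₂, zero_mul, sub_zero, mul_one, mul_self_eq_one_iff] at hsq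
  rcases hsq with hv | hv
  · exact ⟨e₁, e₂, h₁, h₂, hu₁, hu₂, h₁₂, hv⟩
  · exact ⟨e₁, -e₂, h₁, by simpa using h₂.smul (-1), hu₁, by simpa, by simpa, by simp [hv]⟩

end OrthoPair

/-- `κ` identifies the orthogonal complement of `F` and `N` with the complex plane, the hermitian
product of which encodes both the metric and the area form. -/
structure IsTangentChart (F N : R41) (κ : R41 →ₗ[ℝ] ℂ) : Prop where
  conj_mul : ∀ {x y}, Perp F N x → Perp F N y →
    starRingEnd ℂ (κ x) * κ y = lor x y + vol F N x y * Complex.I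
  surjective : ∀ ζ, ∃ x, Perp F N x ∧ κ x = ζ

theorem OrthoPair.exists_tangentChart (h : OrthoPair F N) : ∃ κ, IsTangentChart F N κ := by
  obtain ⟨e₁, e₂, h₁, h₂, hu₁, hu₂, h₁₂, hv⟩ := h.exists_frame
  let κ : R41 →ₗ[ℝ] ℂ := Complex.ofRealCLM.toLinearMap ∘ₗ (lorL e₁).toLinearMap
    + Complex.I • (Complex.ofRealCLM.toLinearMap ∘ₗ (lorL e₂).toLinearMap)
  have hκ : ∀ x, κ x = lor e₁ x + Complex.I * lor e₂ x := fun x => rfl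
  refine ⟨κ, ⟨fun {x y} hx hy => ?_, fun ζ => ⟨ζ.re • e₁ + ζ.im • e₂,
    (h₁.smul _).add (h₂.smul _), ?_⟩⟩⟩
  · have e11 := h.vol_mul_vol h₁ hx h₁ hy
    have e12 := h.vol_mul_vol h₁ h₂ h₁ hx
    have e12y := h.vol_mul_vol h₁ h₂ h₁ hy
    have exy := h.vol_mul_vol h₁ h₂ hx hy
    rw [hv, hu₁, lor_comm e₂ e₁, h₁₂] at e12 e12y
    rw [hu₁, lor_comm x e₁] at e11
    rw [hv] at exy
    apply Complex.ext
    · simp [hκ]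
      linear_combination e11 - lor e₂ y * e12 - vol F N e₁ x * e12y
    · simp [hκ]
      linear_combination -exy
  · apply Complex.ext <;> simp [hκ, hu₁, hu₂, h₁₂, lor_comm e₂ e₁]

namespace IsTangentChart

variable {κ : R41 →ₗ[ℝ] ℂ}

theorem eq_zero (hκ : IsTangentChart F N κ) (h : OrthoPair F N) (hx : Perp F N x)
    (h0 : κ x = 0) : x = 0 :=
  h.eq_zero_of_lor_self hx <| by simpa [h0] using (congrArg Complex.re (hκ.conj_mul hx hx)).symm

theorem vol_eq_im (hκ : IsTangentChart F N κ) (hx : Perp F N x) (hy : Perp F N y) :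
    vol F N x y = (starRingEnd ℂ (κ x) * κ y).im := by
  rw [hκ.conj_mul hx hy]; simp

theorem lor_eq_re (hκ : IsTangentChart F N κ) (hx : Perp F N x) (hy : Perp F N y) :
    lor x y = (starRingEnd ℂ (κ x) * κ y).re := by
  rw [hκ.conj_mul hx hy]; simp

end IsTangentChart

namespace OrthoPair

theorem exists_alternating_eq_vol_smul (h : OrthoPair F N) {G : Type*} [AddCommGroup G]
    [Module ℝ G] (β : R41 →ₗ[ℝ] R41 →ₗ[ℝ] G) (hβ : ∀ x, β x x = 0) :
    ∃ g : G, ∀ x y, Perp F N x → Perp F N y → β x y = vol F N x y • g := by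
  obtain ⟨κ, hκ⟩ := h.exists_tangentChart
  obtain ⟨e₁, h₁, hκ₁⟩ := hκ.surjective 1
  obtain ⟨e₂, h₂, hκ₂⟩ := hκ.surjective Complex.I
  have hexp : ∀ x, Perp F N x → x = (κ x).re • e₁ + (κ x).im • e₂ := fun x hx => by
    rw [← sub_eq_zero]
    refine hκ.eq_zero h ?_ ?_
    · simpa [sub_eq_add_neg] using hx.add (((h₂.smul (κ x).im).add (h₁.smul (κ x).re)).smul (-1))
    · simp [hκ₁, hκ₂, Complex.re_add_im]
  have hswap : β e₂ e₁ = -β e₁ e₂ := by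
    have := hβ (e₁ + e₂)
    simp only [map_add, LinearMap.add_apply, hβ, zero_add, add_zero] at this
    exact eq_neg_of_add_eq_zero_left this
  refine ⟨β e₁ e₂, fun x y hx hy => ?_⟩
  rw [hκ.vol_eq_im hx hy]
  conv_lhs => rw [hexp x hx, hexp y hy]
  simp only [map_add, map_smul, LinearMap.add_apply, LinearMap.smul_apply, hβ, hswap,
    Complex.mul_im, Complex.conj_re, Complex.conj_im]
  module

theorem eq_zero_or_eq_zero (h : OrthoPair F N) (hx : Perp F N x) (hy : Perp F N y)
    (hlor : lor x y = 0) (hvol : vol F N x y = 0) : x = 0 ∨ y = 0 := by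
  obtain ⟨κ, hκ⟩ := h.exists_tangentChart
  have : starRingEnd ℂ (κ x) * κ y = 0 := by rw [hκ.conj_mul hx hy]; simp [hlor, hvol]
  rcases mul_eq_zero.1 this with h' | h'
  · exact .inl (hκ.eq_zero h hx ((map_eq_zero _).1 h'))
  · exact .inr (hκ.eq_zero h hy h')

theorem exists_linear_relation (h : OrthoPair F N) (hx : Perp F N x) (hy : Perp F N y)
    (hvol : vol F N x y = 0) : ∃ r s : ℝ, (r ≠ 0 ∨ s ≠ 0) ∧ r • x + s • y = 0 := by
  by_cases hx0 : x = 0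
  · exact ⟨1, 0, .inl one_ne_zero, by simp [hx0]⟩
  · refine ⟨-lor x y, lor x x, .inr (h.lor_self_pos hx hx0).ne', ?_⟩
    refine h.eq_zero_of_lor_self ((hx.smul _).add (hy.smul _)) ?_
    have := h.vol_mul_vol hx hy hx hy
    simp only [hvol, lor_comm y x] at this
    simp only [lor_add_left, lor_add_right, lor_smul_left, lor_smul_right, lor_comm y x]
    linear_combination -lor x x * this

end OrthoPair

end Algebra

/-! ### First order data of a front at a point -/

section Jet

variable {E : Type*} [NormedAddCommGroup E] [NormedSpace ℝ E] {F N : R41} {A B L : E →L[ℝ] R41}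

theorem vol_map (F N : R41) (b : Module.Basis (Fin 2) ℝ E) (L : E →L[ℝ] R41) (u v : E) :
    vol F N (L u) (L v)
      = (b.repr u 0 * b.repr v 1 - b.repr u 1 * b.repr v 0) * vol F N (L (b 0)) (L (b 1)) := by
  have hexp : ∀ u, L u = b.repr u 0 • L (b 0) + b.repr u 1 • L (b 1) := fun u => by
    conv_lhs => rw [← b.sum_repr u, Fin.sum_univ_two, map_add, map_smul, map_smul]
  rw [hexp u, hexp v]
  simp only [vol_add_left, vol_add_right, vol_smul_left, vol_smul_right, vol_self]
  rw [vol_swap F N (L (b 1)) (L (b 0))]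
  ring

theorem OrthoPair.injective_iff (h : OrthoPair F N) (b : Module.Basis (Fin 2) ℝ E)
    (hL : ∀ u, Perp F N (L u)) : Function.Injective L ↔ vol F N (L (b 0)) (L (b 1)) ≠ 0 := by
  refine ⟨fun hinj h0 => ?_, fun h0 => (injective_iff_map_eq_zero L).2 fun u hu => ?_⟩
  · obtain ⟨r, s, hrs, hsum⟩ := h.exists_linear_relation (hL (b 0)) (hL (b 1)) h0
    have hli : LinearIndependent ℝ ![b 0, b 1] := by
      convert b.linearIndependent using 1
      ext i; fin_cases i <;> rfl
    have := LinearIndependent.pair_iff.1 hli r s (hinj (by simpa using hsum))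
    tauto
  · have h₀ := vol_map F N b L u (b 0)
    have h₁ := vol_map F N b L u (b 1)
    have hr₁ : b.repr u 1 = 0 := by simpa [hu, h0] using h₀
    have hr₀ : b.repr u 0 = 0 := by simpa [hu, h0] using h₁
    exact b.ext_elem fun i => by fin_cases i <;> simp [hr₀, hr₁]

theorem OrthoPair.vol_eq_zero_of_not_injective (h : OrthoPair F N)
    (b : Module.Basis (Fin 2) ℝ E) (hL : ∀ u, Perp F N (L u)) (hinj : ¬ Function.Injective L)
    (u v : E) : vol F N (L u) (L v) = 0 := by
  rw [vol_map F N b, not_not.1 (mt (h.injective_iff b hL).2 hinj), mul_zero]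

/-- The first order data at a point of a front: `A` and `B` are the differentials of the front and
of its unit normal field, whose values at the point are `F` and `N`. -/
structure FrontJet (F N : R41) (A B : E →L[ℝ] R41) : Prop where
  pair : OrthoPair F N
  perp : ∀ u, Perp F N (A u)
  perp_normal : ∀ u, Perp F N (B u)
  symm : ∀ u v, lor (A u) (B v) = lor (A v) (B u)
  imm : ∀ u, A u = 0 → B u = 0 → u = 0

/-- The linear Weingarten relation, in a form that makes sense at singular points as well: where
`A` is injective, `a (H - 1) + b K = 0` is the case `α = a / 2 + b`, `β = -b`. Mean curvature one
is the case `α = 1`, `β = 0`. -/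
def IsLW (α β : ℝ) (F N : R41) (A B : E →L[ℝ] R41) : Prop :=
  ∀ u v, α * (vol F N (A u) (A v + B v) - vol F N (A v) (A u + B u))
    + β * vol F N (A u + B u) (A v + B v) = 0

namespace FrontJet

theorem perp_add (h : FrontJet F N A B) (u : E) : Perp F N (A u + B u) :=
  (h.perp u).add (h.perp_normal u)

theorem symm_add (h : FrontJet F N A B) (u v : E) :
    lor (A u) (A v + B v) = lor (A v) (A u + B u) := by
  rw [lor_add_right, lor_add_right, h.symm u v, lor_comm (A u) (A v)]

theorem imm_add (h : FrontJet F N A B) {u : E} (hA : A u = 0) (hC : A u + B u = 0) : u = 0 :=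
  h.imm u hA (by rwa [hA, zero_add] at hC)

theorem parallel (h : FrontJet F N A B) {c s : ℝ} (hcs : c ^ 2 - s ^ 2 = 1) :
    FrontJet (c • F + s • N) (c • N + s • F) (c • A + s • B) (c • B + s • A) where
  pair := by
    constructor <;> simp [h.pair.timelike, h.pair.spacelike, h.pair.orth, lor_comm N F] <;>
      linarith
  perp u := by simp [Perp, (h.perp u).1, (h.perp u).2, (h.perp_normal u).1, (h.perp_normal u).2]
  perp_normal u := by
    simp [Perp, (h.perp u).1, (h.perp u).2, (h.perp_normal u).1, (h.perp_normal u).2]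
  symm u v := by
    simp only [add_apply, smul_apply, lor_add_left, lor_add_right, lor_smul_left, lor_smul_right]
    rw [h.symm u v, lor_comm (B u) (A v), lor_comm (B v) (A u), h.symm u v,
      lor_comm (B u) (B v), lor_comm (A u) (A v)]
  imm u hA hB := by
    simp only [add_apply, smul_apply] at hA hB
    have hA' : (c ^ 2 - s ^ 2) • A u = c • (c • A u + s • B u) - s • (c • B u + s • A u) := by
      module
    have hB' : (c ^ 2 - s ^ 2) • B u = c • (c • B u + s • A u) - s • (c • A u + s • B u) := by
      module
    exact h.imm u (by simpa [hA, hB, hcs] using hA') (by simpa [hA, hB, hcs] using hB')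

theorem comp (h : FrontJet F N A B) {E' : Type*} [NormedAddCommGroup E'] [NormedSpace ℝ E']
    (T : E' ≃L[ℝ] E) :
    FrontJet F N (A.comp (T : E' →L[ℝ] E)) (B.comp (T : E' →L[ℝ] E)) where
  pair := h.pair
  perp _ := h.perp _
  perp_normal _ := h.perp_normal _
  symm _ _ := h.symm _ _
  imm u hA hB := by simpa using h.imm (T u) hA hB

/-- In a tangent chart, the symmetry of the second fundamental form and the relation for mean
curvature one are the real and the imaginary part of a single equation. -/
theorem conj_mul_swap (h : FrontJet F N A B) (hr : IsLW 1 0 F N A B) {κ : R41 →ₗ[ℝ] ℂ}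
    (hκ : IsTangentChart F N κ) (u v : E) :
    starRingEnd ℂ (κ (A u)) * κ (A v + B v) = starRingEnd ℂ (κ (A v)) * κ (A u + B u) := by
  rw [hκ.conj_mul (h.perp u) (h.perp_add v), hκ.conj_mul (h.perp v) (h.perp_add u),
    h.symm_add u v, show vol F N (A u) (A v + B v) = vol F N (A v) (A u + B u) by
      linarith [hr u v]]

theorem eq_zero_of_apply_eq_zero (h : FrontJet F N A B) (hr : IsLW 1 0 F N A B) {u : E}
    (hu : u ≠ 0) (hA : A u = 0) : A = 0 := by
  obtain ⟨κ, hκ⟩ := h.pair.exists_tangentChart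
  ext1 v
  have hmul := h.conj_mul_swap hr hκ v u
  rw [hA, map_zero, map_zero, zero_mul, mul_eq_zero, map_eq_zero] at hmul
  refine hκ.eq_zero h.pair (h.perp v) (hmul.resolve_right fun hC => hu (h.imm_add hA ?_))
  exact hκ.eq_zero h.pair (h.perp_add u) (by rwa [hA])

theorem add_eq_zero_of_apply_eq_zero (h : FrontJet F N A B) (hr : IsLW 1 0 F N A B) {u : E}
    (hu : u ≠ 0) (hC : A u + B u = 0) : A + B = 0 := by
  obtain ⟨κ, hκ⟩ := h.pair.exists_tangentChart
  ext1 v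
  have hmul := h.conj_mul_swap hr hκ u v
  rw [hC, map_zero, mul_zero, mul_eq_zero, map_eq_zero] at hmul
  exact hκ.eq_zero h.pair (h.perp_add v)
    (hmul.resolve_left fun hA => hu (h.imm_add (hκ.eq_zero h.pair (h.perp u) hA) hC))

theorem not_injective_iff [Nontrivial E] (h : FrontJet F N A B) (hr : IsLW 1 0 F N A B) :
    ¬ Function.Injective A ↔ A = 0 := by
  refine ⟨fun hA => ?_, fun hA hinj => ?_⟩
  · rw [injective_iff_map_eq_zero] at hA
    push Not at hA
    obtain ⟨u, hAu, hu⟩ := hA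
    exact h.eq_zero_of_apply_eq_zero hr hu hAu
  · obtain ⟨u, hu⟩ := exists_ne (0 : E)
    exact hu (hinj (by simp [hA]))

/-- Two independent linear Weingarten relations are those of mean curvature one and of a degenerate
Gauss map. -/
theorem add_eq_zero_of_isLW (h : FrontJet F N A B) (b : Module.Basis (Fin 2) ℝ E)
    {α β α' β' : ℝ} (hdet : α * β' - β * α' ≠ 0) (h₁ : IsLW α β F N A B)
    (h₂ : IsLW α' β' F N A B) : A + B = 0 := by
  have hr : IsLW 1 0 F N A B := fun u v => by
    refine (mul_eq_zero.1 (?_ : (α * β' - β * α') * _ = 0)).resolve_left hdet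
    linear_combination β' * h₁ u v - β * h₂ u v
  have hvol : vol F N ((A + B) (b 0)) ((A + B) (b 1)) = 0 := by
    refine (mul_eq_zero.1 (?_ : (α * β' - β * α') * _ = 0)).resolve_left hdet
    rw [add_apply, add_apply]
    linear_combination α * h₂ (b 0) (b 1) - α' * h₁ (b 0) (b 1)
  have hinj := mt (h.pair.injective_iff b (L := A + B) h.perp_add).1 (not_not.2 hvol)
  rw [injective_iff_map_eq_zero] at hinj
  push Not at hinj
  obtain ⟨u, hC, hu⟩ := hinj
  exact h.add_eq_zero_of_apply_eq_zero hr hu hC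

theorem exists_conformal_factor (h : FrontJet F N A B) (hr : IsLW 1 0 F N A B) (hC : A + B ≠ 0) :
    ∃ μ : ℝ, ∀ u v, lor (A u) (A v) = μ * lor (A u + B u) (A v + B v) := by
  obtain ⟨κ, hκ⟩ := h.pair.exists_tangentChart
  obtain ⟨u₀, hu₀⟩ := DFunLike.ne_iff.1 hC
  have hc₀ : κ (A u₀ + B u₀) ≠ 0 := fun h0 => hu₀ (hκ.eq_zero h.pair (h.perp_add u₀) h0)
  set m := starRingEnd ℂ (κ (A u₀)) / κ (A u₀ + B u₀)
  have hm : ∀ v, starRingEnd ℂ (κ (A v)) = m * κ (A v + B v) := fun v => by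
    rw [div_mul_eq_mul_div, eq_div_iff hc₀, h.conj_mul_swap hr hκ]
  refine ⟨Complex.normSq m, fun u v => ?_⟩
  rw [hκ.lor_eq_re (h.perp u) (h.perp v), hκ.lor_eq_re (h.perp_add u) (h.perp_add v), hm u,
    show κ (A v) = starRingEnd ℂ (m * κ (A v + B v)) by rw [← hm, Complex.conj_conj]]
  simp only [map_mul, Complex.mul_re, Complex.mul_im, Complex.conj_re, Complex.conj_im,
    Complex.normSq_apply]
  ring

theorem trace_eq_zero (h : FrontJet F N A B) (hr : IsLW 1 0 F N A B) {u v : E}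
    (hnorm : lor (A u) (A u) = lor (A v) (A v)) (horth : lor (A u) (A v) = 0) :
    lor (A u) (A u + B u) + lor (A v) (A v + B v) = 0 := by
  obtain ⟨κ, hκ⟩ := h.pair.exists_tangentChart
  by_cases hAu : A u = 0
  · rw [hAu, lor_zero_left] at hnorm
    simp [hAu, h.pair.eq_zero_of_lor_self (h.perp v) hnorm.symm]
  have ha : starRingEnd ℂ (κ (A u)) ≠ 0 :=
    (map_ne_zero _).2 fun h0 => hAu (hκ.eq_zero h.pair (h.perp u) h0)
  have hsq : starRingEnd ℂ (κ (A u)) ^ 2 + starRingEnd ℂ (κ (A v)) ^ 2 = 0 := by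
    have huu := hκ.conj_mul (h.perp u) (h.perp u)
    have hvv := hκ.conj_mul (h.perp v) (h.perp v)
    have huv := hκ.conj_mul (h.perp u) (h.perp v)
    have hvu := hκ.conj_mul (h.perp v) (h.perp u)
    rw [vol_self, hnorm] at huu
    rw [vol_self] at hvv
    rw [horth, Complex.ofReal_zero] at huv
    rw [lor_comm, horth, vol_swap, Complex.ofReal_zero, Complex.ofReal_neg] at hvu
    refine (mul_eq_zero.1 (?_ : κ (A u) * _ = 0)).resolve_left ((map_ne_zero _).1 ha)
    linear_combination starRingEnd ℂ (κ (A u)) * (huu - hvv)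
      + starRingEnd ℂ (κ (A v)) * (huv + hvu)
  have htr : starRingEnd ℂ (κ (A u)) * κ (A u + B u) + starRingEnd ℂ (κ (A v)) * κ (A v + B v)
      = 0 := by
    refine (mul_eq_zero.1 (?_ : starRingEnd ℂ (κ (A u)) * _ = 0)).resolve_left ha
    linear_combination κ (A u + B u) * hsq
      + starRingEnd ℂ (κ (A v)) * h.conj_mul_swap hr hκ u v
  rw [hκ.lor_eq_re (h.perp u) (h.perp_add u), hκ.lor_eq_re (h.perp v) (h.perp_add v),
    ← Complex.add_re, htr, Complex.zero_re]

end FrontJet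

theorem isLW_parallel_iff {c s : ℝ} (hcs : c ^ 2 - s ^ 2 = 1) (α β : ℝ) :
    IsLW α β (c • F + s • N) (c • N + s • F) (c • A + s • B) (c • B + s • A) ↔
      IsLW α (α * ((c + s) ^ 2 - 1) + β * (c + s) ^ 2) F N A B := by
  refine forall₂_congr fun u v => Eq.congr ?_ rfl
  simp only [vol_parallel hcs, add_apply, smul_apply, vol_add_left, vol_add_right, vol_smul_left,
    vol_smul_right]
  rw [vol_swap F N (A v) (A u), vol_swap F N (A v) (B u), vol_swap F N (B v) (A u),
    vol_swap F N (B v) (B u)]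
  linear_combination (α * (vol F N (A u) (A v) - vol F N (B u) (B v))) * hcs

theorem IsLW.comp {α β : ℝ} (h : IsLW α β F N A B) {E' : Type*} [NormedAddCommGroup E']
    [NormedSpace ℝ E'] (T : E' →L[ℝ] E) : IsLW α β F N (A.comp T) (B.comp T) :=
  fun u v => h (T u) (T v)

theorem isLW_mul_iff {r : ℝ} (hr : r ≠ 0) (α β : ℝ) :
    IsLW (r * α) (r * β) F N A B ↔ IsLW α β F N A B := by
  refine forall₂_congr fun u v => ?_
  rw [mul_assoc, mul_assoc, ← mul_add, mul_eq_zero_iff_left hr]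

theorem isLW_iff_basis (b : Module.Basis (Fin 2) ℝ E) {α β : ℝ} : IsLW α β F N A B ↔
    α * (vol F N (A (b 0)) (A (b 1) + B (b 1)) - vol F N (A (b 1)) (A (b 0) + B (b 0)))
      + β * vol F N (A (b 0) + B (b 0)) (A (b 1) + B (b 1)) = 0 := by
  -- polarization reduces the first term to terms of the form `vol F N (L u) (L v)`
  have hpol : ∀ u v, vol F N (A u) (A v + B v) - vol F N (A v) (A u + B u)
      = vol F N ((A + (A + B)) u) ((A + (A + B)) v) - vol F N (A u) (A v)
        - vol F N ((A + B) u) ((A + B) v) := fun u v => by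
    rw [vol_swap F N (A v)]
    simp only [add_apply, vol_add_left, vol_add_right]
    ring
  refine ⟨fun h => h _ _, fun h u v => ?_⟩
  rw [hpol, ← add_apply A B, ← add_apply A B] at h ⊢
  rw [vol_map F N b (A + (A + B)) u, vol_map F N b A u, vol_map F N b (A + B) u]
  linear_combination (b.repr u 0 * b.repr v 1 - b.repr u 1 * b.repr v 0) * h

namespace FrontJet

theorem det_first (h : FrontJet F N A B) (u : Fin 2 → E) :
    (Matrix.of fun i j => lor (A (u i)) (A (u j))).det = vol F N (A (u 0)) (A (u 1)) ^ 2 := by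
  rw [Matrix.det_fin_two, sq, h.pair.vol_mul_vol (h.perp _) (h.perp _) (h.perp _) (h.perp _)]
  rfl

theorem det_second (h : FrontJet F N A B) (u : Fin 2 → E) :
    (Matrix.of fun i j => -lor (A (u i)) (B (u j))).det
      = vol F N (A (u 0)) (A (u 1)) * vol F N (B (u 0)) (B (u 1)) := by
  rw [Matrix.det_fin_two, h.pair.vol_mul_vol (h.perp _) (h.perp _) (h.perp_normal _)
    (h.perp_normal _)]
  simp only [Matrix.of_apply]
  ring

theorem trace_inv_mul (h : FrontJet F N A B) (u : Fin 2 → E)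
    (hd : vol F N (A (u 0)) (A (u 1)) ≠ 0) :
    ((Matrix.of fun i j => lor (A (u i)) (A (u j)))⁻¹
        * Matrix.of fun i j => -lor (A (u i)) (B (u j))).trace
      = -(vol F N (A (u 0)) (B (u 1)) + vol F N (B (u 0)) (A (u 1)))
        / vol F N (A (u 0)) (A (u 1)) := by
  have h₁ := h.pair.vol_mul_vol (h.perp (u 0)) (h.perp (u 1)) (h.perp_normal (u 0)) (h.perp (u 1))
  have h₀ := h.pair.vol_mul_vol (h.perp (u 0)) (h.perp (u 1)) (h.perp (u 0)) (h.perp_normal (u 1))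
  rw [Matrix.inv_def, h.det_first, Matrix.adjugate_fin_two, Matrix.trace_fin_two,
    Ring.inverse_eq_inv']
  simp only [Matrix.mul_apply, Fin.sum_univ_two, Matrix.smul_apply, Matrix.of_apply,
    Matrix.cons_val', Matrix.cons_val_zero, Matrix.cons_val_one, Matrix.cons_val_fin_one,
    smul_eq_mul]
  field_simp
  linear_combination h₀ + h₁

theorem curvature_relation_iff (h : FrontJet F N A B) (b : Module.Basis (Fin 2) ℝ E)
    (hA : Function.Injective A) (a c : ℝ) :
    a * (((Matrix.of fun i j => lor (A (b i)) (A (b j)))⁻¹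
        * Matrix.of fun i j => -lor (A (b i)) (B (b j))).trace / 2 - 1)
      + c * ((Matrix.of fun i j => -lor (A (b i)) (B (b j))).det
        / (Matrix.of fun i j => lor (A (b i)) (A (b j))).det - 1) = 0
    ↔ IsLW (a / 2 + c) (-c) F N A B := by
  have hd := (h.pair.injective_iff b h.perp).1 hA
  rw [isLW_iff_basis b, h.trace_inv_mul b hd, h.det_first b, h.det_second b]
  simp only [vol_add_left, vol_add_right]
  rw [vol_swap F N (A (b 1)) (A (b 0)), vol_swap F N (A (b 1)) (B (b 0))]
  refine ⟨fun hrel => ?_, fun hrel => ?_⟩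
  · field_simp at hrel
    linear_combination -hrel / 2
  · field_simp
    linear_combination -2 * hrel

end FrontJet

end Jet

/-! ### Calculus of smooth maps -/

section Calculus

variable {E G : Type*} [NormedAddCommGroup E] [NormedSpace ℝ E] [NormedAddCommGroup G]
  [NormedSpace ℝ G] {V : Set E} {w : E}

/-- The derivative of `F` in the constant direction `e`. -/
def dirDeriv (e : E) (F : E → G) (w : E) : G := fderiv ℝ F w e

theorem differentiableAt_of_contDiffOn (hV : IsOpen V) {F : E → G} (hF : ContDiffOn ℝ ∞ F V)
    (hw : w ∈ V) : DifferentiableAt ℝ F w :=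
  (hF.contDiffAt (hV.mem_nhds hw)).differentiableAt (by simp)

theorem contDiffOn_dirDeriv (hV : IsOpen V) {F : E → G} (hF : ContDiffOn ℝ ∞ F V) (e : E) :
    ContDiffOn ℝ ∞ (dirDeriv e F) V :=
  (hF.fderiv_of_isOpen hV le_rfl).clm_apply contDiffOn_const

theorem dirDeriv_congr (hV : IsOpen V) {F F' : E → G} (h : ∀ w ∈ V, F w = F' w) (hw : w ∈ V)
    (e : E) : dirDeriv e F w = dirDeriv e F' w := by
  have : F =ᶠ[𝓝 w] F' := Filter.eventuallyEq_of_mem (hV.mem_nhds hw) h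
  rw [dirDeriv, dirDeriv, this.fderiv_eq]

theorem dirDeriv_comm (hV : IsOpen V) {F : E → G} (hF : ContDiffOn ℝ ∞ F V) (hw : w ∈ V)
    (e e' : E) : dirDeriv e (dirDeriv e' F) w = dirDeriv e' (dirDeriv e F) w := by
  have hsnd : ∀ e e', dirDeriv e (dirDeriv e' F) w = fderiv ℝ (fderiv ℝ F) w e e' := fun e e' => by
    have hd := differentiableAt_of_contDiffOn hV (hF.fderiv_of_isOpen hV le_rfl) hw
    change fderiv ℝ (fun w => fderiv ℝ F w e') w e = _
    rw [fderiv_clm_apply hd (differentiableAt_const _)]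
    simp
  rw [hsnd, hsnd]
  exact (hF.contDiffAt (hV.mem_nhds hw)).isSymmSndFDerivAt
    (by simpa using (WithTop.coe_le_coe.2 le_top : ((2 : ℕ∞) : ℕ∞ω) ≤ ∞)) e e'

theorem dirDeriv_clm {G' : Type*} [NormedAddCommGroup G'] [NormedSpace ℝ G'] (L : G →L[ℝ] G')
    {F : E → G} (hF : DifferentiableAt ℝ F w) (e : E) :
    dirDeriv e (fun w => L (F w)) w = L (dirDeriv e F w) := by
  exact congrArg (· e) (L.hasFDerivAt.comp w hF.hasFDerivAt).fderiv

theorem dirDeriv_bilin {G₁ G₂ : Type*} [NormedAddCommGroup G₁] [NormedSpace ℝ G₁]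
    [NormedAddCommGroup G₂] [NormedSpace ℝ G₂] (B : G →L[ℝ] G₁ →L[ℝ] G₂) {F : E → G} {F' : E → G₁}
    (hF : DifferentiableAt ℝ F w) (hF' : DifferentiableAt ℝ F' w) (e : E) :
    dirDeriv e (fun w => B (F w) (F' w)) w
      = B (dirDeriv e F w) (F' w) + B (F w) (dirDeriv e F' w) := by
  rw [dirDeriv, (B.hasFDerivAt_of_bilinear hF.hasFDerivAt hF'.hasFDerivAt).fderiv]
  simp [ContinuousLinearMap.precompR_apply, ContinuousLinearMap.precompL_apply, dirDeriv, add_comm]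

theorem dirDeriv_lor {F F' : E → R41} (hF : DifferentiableAt ℝ F w)
    (hF' : DifferentiableAt ℝ F' w) (e : E) :
    dirDeriv e (fun w => lor (F w) (F' w)) w
      = lor (dirDeriv e F w) (F' w) + lor (F w) (dirDeriv e F' w) :=
  dirDeriv_bilin lorL hF hF' e

theorem lor_dirDeriv_add_eq_zero (hV : IsOpen V) {F F' : E → R41} (hF : ContDiffOn ℝ ∞ F V)
    (hF' : ContDiffOn ℝ ∞ F' V) {c : ℝ} (hc : ∀ w ∈ V, lor (F w) (F' w) = c) (hw : w ∈ V) (e : E) :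
    lor (dirDeriv e F w) (F' w) + lor (F w) (dirDeriv e F' w) = 0 := by
  rw [← dirDeriv_lor (differentiableAt_of_contDiffOn hV hF hw)
    (differentiableAt_of_contDiffOn hV hF' hw), dirDeriv_congr hV hc hw]
  simp [dirDeriv]

theorem exists_equiv_of_injective [FiniteDimensional ℝ E] {L : E →L[ℝ] E}
    (hL : Function.Injective L) : ∃ T : E ≃L[ℝ] E, (T : E →L[ℝ] E) = L :=
  ⟨(LinearEquiv.ofInjectiveEndo L.toLinearMap hL).toContinuousLinearEquiv, by ext; simp⟩

theorem eventually_injective_fderiv [FiniteDimensional ℝ E] (hV : IsOpen V) {F : E → G}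
    (hF : ContDiffOn ℝ ∞ F V) (hw : w ∈ V) (hinj : Function.Injective (fderiv ℝ F w)) :
    ∀ᶠ x in 𝓝 w, Function.Injective (fderiv ℝ F x) :=
  ((hF.fderiv_of_isOpen hV (m := ∞) le_rfl).continuousOn.continuousAt
    (hV.mem_nhds hw)).eventually (ContinuousLinearMap.isOpen_injective.mem_nhds hinj)

theorem exists_local_inverse [FiniteDimensional ℝ E] (hV : IsOpen V) {W : E → E}
    (hW : ContDiffOn ℝ ∞ W V) (hw : w ∈ V) (hinj : Function.Injective (fderiv ℝ W w)) :
    ∃ e : OpenPartialHomeomorph E E, w ∈ e.source ∧ e.source ⊆ V ∧ ⇑e = W ∧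
      ContDiffOn ℝ ∞ e.symm e.target := by
  have := FiniteDimensional.complete ℝ E
  have hderiv : ∀ x ∈ V, Function.Injective (fderiv ℝ W x) →
      ∃ T : E ≃L[ℝ] E, HasFDerivAt W (T : E →L[ℝ] E) x := fun x hx hinj => by
    obtain ⟨T, hT⟩ := exists_equiv_of_injective hinj
    exact ⟨T, hT ▸ (differentiableAt_of_contDiffOn hV hW hx).hasFDerivAt⟩
  obtain ⟨T, hT⟩ := hderiv w hw hinj
  have hc := hW.contDiffAt (hV.mem_nhds hw)
  obtain ⟨S, hS, hSo, hwS⟩ := mem_nhds_iff.1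
    (Filter.inter_mem (hV.mem_nhds hw) (eventually_injective_fderiv hV hW hw hinj))
  let e := (hc.toOpenPartialHomeomorph W hT (by simp)).restrOpen S hSo
  have hsrc : ∀ x ∈ e.source, x ∈ S := fun x hx => by
    rw [OpenPartialHomeomorph.restrOpen_source] at hx
    exact hx.2
  refine ⟨e, ?_, fun x hx => (hS (hsrc x hx)).1, rfl, fun ζ hζ => ?_⟩
  · rw [OpenPartialHomeomorph.restrOpen_source]
    exact ⟨hc.mem_toOpenPartialHomeomorph_source hT (by simp), hwS⟩
  · obtain ⟨hm, hinj'⟩ := hS (hsrc _ (e.map_target hζ))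
    obtain ⟨T', hT'⟩ := hderiv _ hm hinj'
    exact (e.contDiffAt_symm hζ hT' (hW.contDiffAt (hV.mem_nhds hm))).contDiffWithinAt

section LocalInverse

variable {W : E → E} {e : OpenPartialHomeomorph E E} {ζ : E}

theorem fderiv_comp_symm (hV : IsOpen V) {F : E → G} (hF : ContDiffOn ℝ ∞ F V)
    (heV : e.source ⊆ V) (hes : ContDiffOn ℝ ∞ e.symm e.target) (hζ : ζ ∈ e.target) :
    fderiv ℝ (F ∘ e.symm) ζ = (fderiv ℝ F (e.symm ζ)).comp (fderiv ℝ e.symm ζ) :=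
  fderiv_comp ζ (differentiableAt_of_contDiffOn hV hF (heV (e.map_target hζ)))
    (differentiableAt_of_contDiffOn e.open_target hes hζ)

theorem dirDeriv_comp_symm (hV : IsOpen V) {F : E → G} (hF : ContDiffOn ℝ ∞ F V)
    (heV : e.source ⊆ V) (hes : ContDiffOn ℝ ∞ e.symm e.target) (hζ : ζ ∈ e.target) (u : E) :
    dirDeriv u (F ∘ e.symm) ζ = dirDeriv (fderiv ℝ e.symm ζ u) F (e.symm ζ) :=
  congrArg (· u) (fderiv_comp_symm hV hF heV hes hζ)

theorem fderiv_fderiv_symm (hV : IsOpen V) (hW : ContDiffOn ℝ ∞ W V) (heV : e.source ⊆ V)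
    (heW : ⇑e = W) (hes : ContDiffOn ℝ ∞ e.symm e.target) (hζ : ζ ∈ e.target) (u : E) :
    fderiv ℝ W (e.symm ζ) (fderiv ℝ e.symm ζ u) = u := by
  have hid : (W ∘ e.symm) =ᶠ[𝓝 ζ] id := by
    filter_upwards [e.open_target.mem_nhds hζ] with x hx
    rw [Function.comp_apply, ← heW, e.right_inv hx, id]
  rw [← ContinuousLinearMap.comp_apply, ← fderiv_comp_symm hV hW heV hes hζ, hid.fderiv_eq,
    fderiv_id, ContinuousLinearMap.id_apply]

end LocalInverse

end Calculus

/-! ### Wirtinger derivatives -/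

section Wirtinger

/-- The complexification of `R41`. -/
abbrev C41 : Type := Fin 4 → ℂ

/-- The inclusion of `R41` in its complexification. -/
def toC41 : R41 →L[ℝ] C41 :=
  ContinuousLinearMap.pi fun i => Complex.ofRealCLM.comp (ContinuousLinearMap.proj i)

/-- The complex bilinear extension of the Lorentz metric. -/
def lorC : C41 →L[ℂ] C41 →L[ℂ] ℂ :=
  (LinearMap.mk₂ ℂ (fun x y => -(x 0 * y 0) + x 1 * y 1 + x 2 * y 2 + x 3 * y 3)
    (by intros; simp only [Pi.add_apply]; ring)
    (by intros; simp only [Pi.smul_apply, smul_eq_mul]; ring)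
    (by intros; simp only [Pi.add_apply]; ring)
    (by intros; simp only [Pi.smul_apply, smul_eq_mul]; ring)).toContinuousBilinearMap

theorem lorC_apply (x y : C41) :
    lorC x y = -(x 0 * y 0) + x 1 * y 1 + x 2 * y 2 + x 3 * y 3 := rfl

theorem lorC_comm (x y : C41) : lorC x y = lorC y x := by
  simp only [lorC_apply]; ring

@[simp] theorem lorC_toC41 (x y : R41) : lorC (toC41 x) (toC41 y) = lor x y := by
  simp [lorC_apply, toC41, lor]

variable {X : Type*} [NormedAddCommGroup X] [NormedSpace ℂ X] {V : Set ℂ} {w : ℂ}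

/-- The Wirtinger derivative `∂F/∂z`. -/
def dz (F : ℂ → X) (w : ℂ) : X :=
  (1 / 2 : ℂ) • (dirDeriv 1 F w - Complex.I • dirDeriv Complex.I F w)

/-- The Wirtinger derivative `∂F/∂z̄`. -/
def dzbar (F : ℂ → X) (w : ℂ) : X :=
  (1 / 2 : ℂ) • (dirDeriv 1 F w + Complex.I • dirDeriv Complex.I F w)

theorem contDiffOn_dz (hV : IsOpen V) {F : ℂ → X} (hF : ContDiffOn ℝ ∞ F V) :
    ContDiffOn ℝ ∞ (dz F) V :=
  ((contDiffOn_dirDeriv hV hF _).sub ((contDiffOn_dirDeriv hV hF _).const_smul _)).const_smul _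

theorem contDiffOn_dzbar (hV : IsOpen V) {F : ℂ → X} (hF : ContDiffOn ℝ ∞ F V) :
    ContDiffOn ℝ ∞ (dzbar F) V :=
  ((contDiffOn_dirDeriv hV hF _).add ((contDiffOn_dirDeriv hV hF _).const_smul _)).const_smul _

theorem dzbar_dz (hV : IsOpen V) {F : ℂ → X} (hF : ContDiffOn ℝ ∞ F V) (hw : w ∈ V) :
    dzbar (dz F) w = dz (dzbar F) w := by
  have hd : ∀ e, DifferentiableAt ℝ (dirDeriv e F) w := fun e =>
    differentiableAt_of_contDiffOn hV (contDiffOn_dirDeriv hV hF e) hw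
  have hsub : ∀ e, dirDeriv e (dz F) w = (1 / 2 : ℂ) • (dirDeriv e (dirDeriv 1 F) w
      - Complex.I • dirDeriv e (dirDeriv Complex.I F) w) := fun e => by
    rw [dirDeriv, show dz F = (1 / 2 : ℂ) • (dirDeriv 1 F - Complex.I • dirDeriv Complex.I F)
      from rfl, fderiv_const_smul ((hd 1).sub ((hd _).const_smul _)),
      fderiv_sub (hd 1) ((hd _).const_smul _), fderiv_const_smul (hd _)]
    rfl
  have hadd : ∀ e, dirDeriv e (dzbar F) w = (1 / 2 : ℂ) • (dirDeriv e (dirDeriv 1 F) w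
      + Complex.I • dirDeriv e (dirDeriv Complex.I F) w) := fun e => by
    rw [dirDeriv, show dzbar F = (1 / 2 : ℂ) • (dirDeriv 1 F + Complex.I • dirDeriv Complex.I F)
      from rfl, fderiv_const_smul ((hd 1).add ((hd _).const_smul _)),
      fderiv_add (hd 1) ((hd _).const_smul _), fderiv_const_smul (hd _)]
    rfl
  rw [dzbar, dz, hsub, hsub, hadd, hadd, dirDeriv_comm hV hF hw Complex.I 1]
  module

theorem dirDeriv_lorC {F F' : ℂ → C41} (hF : DifferentiableAt ℝ F w)
    (hF' : DifferentiableAt ℝ F' w) (e : ℂ) :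
    dirDeriv e (fun w => lorC (F w) (F' w)) w
      = lorC (dirDeriv e F w) (F' w) + lorC (F w) (dirDeriv e F' w) :=
  dirDeriv_bilin (lorC.bilinearRestrictScalars ℝ) hF hF' e

theorem dz_lorC {F F' : ℂ → C41} (hF : DifferentiableAt ℝ F w) (hF' : DifferentiableAt ℝ F' w) :
    dz (fun w => lorC (F w) (F' w)) w = lorC (dz F w) (F' w) + lorC (F w) (dz F' w) := by
  simp only [dz, dirDeriv_lorC hF hF', map_smul, map_sub, smul_apply, sub_apply, smul_eq_mul]
  ring

theorem dzbar_lorC {F F' : ℂ → C41} (hF : DifferentiableAt ℝ F w)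
    (hF' : DifferentiableAt ℝ F' w) :
    dzbar (fun w => lorC (F w) (F' w)) w = lorC (dzbar F w) (F' w) + lorC (F w) (dzbar F' w) := by
  simp only [dzbar, dirDeriv_lorC hF hF', map_smul, map_add, smul_apply, add_apply, smul_eq_mul]
  ring

theorem lorC_dz_add_eq_zero (hV : IsOpen V) {F F' : ℂ → C41} (hF : ContDiffOn ℝ ∞ F V)
    (hF' : ContDiffOn ℝ ∞ F' V) (h0 : ∀ w ∈ V, lorC (F w) (F' w) = 0) (hw : w ∈ V) :
    lorC (dz F w) (F' w) + lorC (F w) (dz F' w) = 0 := by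
  rw [← dz_lorC (differentiableAt_of_contDiffOn hV hF hw)
    (differentiableAt_of_contDiffOn hV hF' hw), dz, dirDeriv_congr hV h0 hw,
    dirDeriv_congr hV h0 hw]
  simp [dirDeriv]

theorem differentiableOn_complex_of_dzbar_eq_zero (hV : IsOpen V) {q : ℂ → ℂ}
    (hq : ContDiffOn ℝ ∞ q V) (h0 : ∀ w ∈ V, dzbar q w = 0) : DifferentiableOn ℂ q V :=
  fun w hw => by
    refine (differentiableAt_complex_iff_differentiableAt_real.2
      ⟨differentiableAt_of_contDiffOn hV hq hw, ?_⟩).differentiableWithinAt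
    have h := h0 w hw
    simp only [dzbar, dirDeriv, smul_eq_mul] at h ⊢
    linear_combination -2 * Complex.I * h + fderiv ℝ q w Complex.I * Complex.I_sq

/-- Let `G` be a conformal map with `⟨G_z̄, P_z⟩ = 0`. Where `G` is an immersion, `P_z` is a
multiple of the null vector `G_z̄`, so both terms of the `z̄`-derivative of `⟨G_z, P_z⟩` vanish. -/
theorem dzbar_lorC_dz_eq_zero (hV : IsOpen V) {G P : ℂ → C41} (hG : ContDiffOn ℝ ∞ G V)
    (hP : ContDiffOn ℝ ∞ P V) (hw : w ∈ V) (hz : ∀ w ∈ V, lorC (dz G w) (dz G w) = 0)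
    (hzbar : ∀ w ∈ V, lorC (dzbar G w) (dzbar G w) = 0)
    (hzP : ∀ w ∈ V, lorC (dz G w) (dzbar P w) = 0)
    (hzbarP : ∀ w ∈ V, lorC (dzbar G w) (dz P w) = 0)
    (hk : (dz G w = 0 ∧ dzbar G w = 0) ∨
      (∃ k : ℂ, dz P w = k • dzbar G w) ∧ ∃ k : ℂ, dzbar P w = k • dz G w) :
    dzbar (fun w => lorC (dz G w) (dz P w)) w = 0 := by
  have hGz := contDiffOn_dz hV hG
  have hPz := contDiffOn_dz hV hP
  rw [dzbar_lorC (differentiableAt_of_contDiffOn hV hGz hw)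
    (differentiableAt_of_contDiffOn hV hPz hw), dzbar_dz hV hG hw, dzbar_dz hV hP hw]
  have hP₁ := lorC_dz_add_eq_zero hV (contDiffOn_dzbar hV hG) hPz hzbarP hw
  rcases hk with ⟨h0, h0'⟩ | ⟨⟨k, hk⟩, ⟨k', hk'⟩⟩
  · simpa [h0, h0'] using hP₁
  · have hG₁ := lorC_dz_add_eq_zero hV (contDiffOn_dzbar hV hG) (contDiffOn_dzbar hV hG) hzbar hw
    have hG₂ := lorC_dz_add_eq_zero hV hGz hGz hz hw
    have hP₂ := lorC_dz_add_eq_zero hV hGz (contDiffOn_dzbar hV hP) hzP hw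
    rw [lorC_comm (dzbar G w)] at hG₁
    rw [lorC_comm (dz G w)] at hG₂
    rw [hk'] at hP₂
    rw [hk]
    simp only [map_smul, smul_eq_mul] at hP₂ ⊢
    linear_combination k / 2 * hG₁ + hP₂ - k' / 2 * hG₂

end Wirtinger

/-! ### Fronts in the plane and their Hopf differential -/

theorem OrthoPair.eq_zero_of_lor_eq_zero {F N x y z : R41} (h : OrthoPair F N) (hx : Perp F N x)
    (hy : Perp F N y) (hz : Perp F N z) (hx0 : x ≠ 0) (hnorm : lor x x = lor y y)
    (horth : lor x y = 0) (hxz : lor x z = 0) (hyz : lor y z = 0) : z = 0 := by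
  have hsq := h.vol_mul_vol hx hy hx hy
  have hprod := h.vol_mul_vol hx hy hx hz
  rw [lor_comm y x, horth, ← hnorm, zero_mul, sub_zero] at hsq
  rw [lor_comm y x, horth, hyz, mul_zero, mul_zero, sub_zero] at hprod
  have hne : vol F N x y ≠ 0 := fun h0 =>
    (h.lor_self_pos hx hx0).ne' (mul_self_eq_zero.1 (by rw [← hsq, h0, mul_zero]))
  exact (h.eq_zero_or_eq_zero hx hz hxz ((mul_eq_zero.1 hprod).resolve_left hne)).resolve_left hx0

theorem OrthoPair.eq_smul_add_smul {F N x y z : R41} (h : OrthoPair F N) (hx : Perp F N x)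
    (hy : Perp F N y) (hz : Perp F N z) (hx0 : x ≠ 0) (hnorm : lor x x = lor y y)
    (horth : lor x y = 0) : z = (lor x z / lor x x) • x + (lor y z / lor x x) • y := by
  have hr := (h.lor_self_pos hx hx0).ne'
  rw [← sub_eq_zero]
  refine h.eq_zero_of_lor_eq_zero hx hy ?_ hx0 hnorm horth ?_ ?_
  · simpa [sub_eq_add_neg] using hz.add (((hy.smul _).add (hx.smul _)).smul (-1))
  · simp [sub_eq_add_neg, horth, hr]
  · simp [sub_eq_add_neg, lor_comm y x, horth, ← hnorm, hr]

/-- For mean curvature one the linear map taking `A` to `A + B` is symmetric and trace free. -/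
theorem FrontJet.exists_coeff {E : Type*} [NormedAddCommGroup E] [NormedSpace ℝ E] {F N : R41}
    {A B : E →L[ℝ] R41} (h : FrontJet F N A B) (hr : IsLW 1 0 F N A B) {u v : E}
    (hu : A u ≠ 0) (hnorm : lor (A u) (A u) = lor (A v) (A v)) (horth : lor (A u) (A v) = 0) :
    ∃ p s : ℝ, A u + B u = p • A u + s • A v ∧ A v + B v = s • A u - p • A v := by
  refine ⟨lor (A u) (A u + B u) / lor (A u) (A u), lor (A u) (A v + B v) / lor (A u) (A u), ?_, ?_⟩
  · rw [h.symm_add u v]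
    exact h.pair.eq_smul_add_smul (h.perp u) (h.perp v) (h.perp_add u) hu hnorm horth
  · rw [sub_eq_add_neg, ← neg_smul, ← neg_div,
      ← eq_neg_of_add_eq_zero_right (h.trace_eq_zero hr hnorm horth)]
    exact h.pair.eq_smul_add_smul (h.perp u) (h.perp v) (h.perp_add v) hu hnorm horth

/-- A front `F` with unit normal field `N`, defined on an open set of the plane. -/
structure PlaneFront (F N : ℂ → R41) (V : Set ℂ) : Prop where
  isOpen : IsOpen V
  smooth : ContDiffOn ℝ ∞ F V
  smooth_normal : ContDiffOn ℝ ∞ N V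
  pair : ∀ w ∈ V, OrthoPair (F w) (N w)
  normal : ∀ w ∈ V, ∀ v, lor (fderiv ℝ F w v) (N w) = 0
  imm : ∀ w ∈ V, ∀ v, fderiv ℝ F w v = 0 → fderiv ℝ N w v = 0 → v = 0

/-- The first fundamental form of `F` is a (possibly vanishing) multiple of `|dz|²` on `V`. -/
def PlaneConformal (F : ℂ → R41) (V : Set ℂ) : Prop :=
  ∀ w ∈ V, lor (dirDeriv 1 F w) (dirDeriv 1 F w)
      = lor (dirDeriv Complex.I F w) (dirDeriv Complex.I F w) ∧
    lor (dirDeriv 1 F w) (dirDeriv Complex.I F w) = 0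

/-- The coefficient `⟨F_z, N_z⟩` of the Hopf differential of a front in the plane. -/
def planeHopf (F N : ℂ → R41) (w : ℂ) : ℂ :=
  lorC (dz (fun w => toC41 (F w)) w) (dz (fun w => toC41 (N w)) w)

section Complexify

variable {F G : ℂ → R41} {w : ℂ}

theorem dz_toC41 (hF : DifferentiableAt ℝ F w) : dz (fun w => toC41 (F w)) w
    = (1 / 2 : ℂ) • (toC41 (dirDeriv 1 F w) - Complex.I • toC41 (dirDeriv Complex.I F w)) := by
  rw [dz, dirDeriv_clm toC41 hF, dirDeriv_clm toC41 hF]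

theorem dzbar_toC41 (hF : DifferentiableAt ℝ F w) : dzbar (fun w => toC41 (F w)) w
    = (1 / 2 : ℂ) • (toC41 (dirDeriv 1 F w) + Complex.I • toC41 (dirDeriv Complex.I F w)) := by
  rw [dzbar, dirDeriv_clm toC41 hF, dirDeriv_clm toC41 hF]

theorem lorC_dz_dz (hF : DifferentiableAt ℝ F w) (hG : DifferentiableAt ℝ G w) :
    lorC (dz (fun w => toC41 (F w)) w) (dz (fun w => toC41 (G w)) w)
      = (((lor (dirDeriv 1 F w) (dirDeriv 1 G w)
          - lor (dirDeriv Complex.I F w) (dirDeriv Complex.I G w) : ℝ) : ℂ)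
        - Complex.I * ((lor (dirDeriv 1 F w) (dirDeriv Complex.I G w)
          + lor (dirDeriv Complex.I F w) (dirDeriv 1 G w) : ℝ) : ℂ)) / 4 := by
  simp only [dz_toC41 hF, dz_toC41 hG, map_smul, map_sub, smul_apply, sub_apply, lorC_toC41,
    smul_eq_mul, Complex.ofReal_sub, Complex.ofReal_add]
  linear_combination
    (lor (dirDeriv Complex.I F w) (dirDeriv Complex.I G w) : ℂ) / 4 * Complex.I_sq

theorem lorC_dzbar_dzbar (hF : DifferentiableAt ℝ F w) (hG : DifferentiableAt ℝ G w) :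
    lorC (dzbar (fun w => toC41 (F w)) w) (dzbar (fun w => toC41 (G w)) w)
      = (((lor (dirDeriv 1 F w) (dirDeriv 1 G w)
          - lor (dirDeriv Complex.I F w) (dirDeriv Complex.I G w) : ℝ) : ℂ)
        + Complex.I * ((lor (dirDeriv 1 F w) (dirDeriv Complex.I G w)
          + lor (dirDeriv Complex.I F w) (dirDeriv 1 G w) : ℝ) : ℂ)) / 4 := by
  simp only [dzbar_toC41 hF, dzbar_toC41 hG, map_smul, map_add, smul_apply, add_apply, lorC_toC41,
    smul_eq_mul, Complex.ofReal_sub, Complex.ofReal_add]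
  linear_combination
    (lor (dirDeriv Complex.I F w) (dirDeriv Complex.I G w) : ℂ) / 4 * Complex.I_sq

theorem lorC_dz_dzbar (hF : DifferentiableAt ℝ F w) (hG : DifferentiableAt ℝ G w) :
    lorC (dz (fun w => toC41 (F w)) w) (dzbar (fun w => toC41 (G w)) w)
      = (((lor (dirDeriv 1 F w) (dirDeriv 1 G w)
          + lor (dirDeriv Complex.I F w) (dirDeriv Complex.I G w) : ℝ) : ℂ)
        + Complex.I * ((lor (dirDeriv 1 F w) (dirDeriv Complex.I G w)
          - lor (dirDeriv Complex.I F w) (dirDeriv 1 G w) : ℝ) : ℂ)) / 4 := by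
  simp only [dz_toC41 hF, dzbar_toC41 hG, map_smul, map_add, map_sub, smul_apply, sub_apply,
    lorC_toC41, smul_eq_mul, Complex.ofReal_sub, Complex.ofReal_add]
  linear_combination
    -(lor (dirDeriv Complex.I F w) (dirDeriv Complex.I G w) : ℂ) / 4 * Complex.I_sq

theorem lorC_dzbar_dz (hF : DifferentiableAt ℝ F w) (hG : DifferentiableAt ℝ G w) :
    lorC (dzbar (fun w => toC41 (F w)) w) (dz (fun w => toC41 (G w)) w)
      = (((lor (dirDeriv 1 F w) (dirDeriv 1 G w)
          + lor (dirDeriv Complex.I F w) (dirDeriv Complex.I G w) : ℝ) : ℂ)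
        - Complex.I * ((lor (dirDeriv 1 F w) (dirDeriv Complex.I G w)
          - lor (dirDeriv Complex.I F w) (dirDeriv 1 G w) : ℝ) : ℂ)) / 4 := by
  rw [lorC_comm, lorC_dz_dzbar hG hF]
  simp only [lor_comm (dirDeriv _ G w)]
  push_cast
  ring

theorem eq_zero_of_apply_one_of_apply_I {G : Type*} [NormedAddCommGroup G] [NormedSpace ℝ G]
    {L : ℂ →L[ℝ] G} (h₁ : L 1 = 0) (hI : L Complex.I = 0) : L = 0 := by
  ext1 v
  rw [show v = v.re • (1 : ℂ) + v.im • Complex.I by simp, map_add, map_smul, map_smul, h₁, hI]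
  simp

end Complexify

namespace PlaneFront

variable {F N : ℂ → R41} {V : Set ℂ} {w : ℂ}

theorem mono (h : PlaneFront F N V) {V' : Set ℂ} (hV' : IsOpen V') (hs : V' ⊆ V) :
    PlaneFront F N V' :=
  ⟨hV', h.smooth.mono hs, h.smooth_normal.mono hs, fun w hw => h.pair w (hs hw),
    fun w hw => h.normal w (hs hw), fun w hw => h.imm w (hs hw)⟩

theorem differentiableAt (h : PlaneFront F N V) (hw : w ∈ V) : DifferentiableAt ℝ F w :=
  differentiableAt_of_contDiffOn h.isOpen h.smooth hw

theorem differentiableAt_normal (h : PlaneFront F N V) (hw : w ∈ V) : DifferentiableAt ℝ N w :=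
  differentiableAt_of_contDiffOn h.isOpen h.smooth_normal hw

theorem fderiv_add (h : PlaneFront F N V) (hw : w ∈ V) :
    fderiv ℝ (F + N) w = fderiv ℝ F w + fderiv ℝ N w :=
  _root_.fderiv_add (h.differentiableAt hw) (h.differentiableAt_normal hw)

theorem frontJet (h : PlaneFront F N V) (hw : w ∈ V) :
    FrontJet (F w) (N w) (fderiv ℝ F w) (fderiv ℝ N w) where
  pair := h.pair w hw
  perp u := by
    have hFF := lor_dirDeriv_add_eq_zero h.isOpen h.smooth h.smooth
      (fun w hw => (h.pair w hw).timelike) hw u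
    rw [lor_comm, ← two_mul] at hFF
    exact ⟨by simpa [dirDeriv] using hFF, by rw [lor_comm]; exact h.normal w hw u⟩
  perp_normal u := by
    have hNN := lor_dirDeriv_add_eq_zero h.isOpen h.smooth_normal h.smooth_normal
      (fun w hw => (h.pair w hw).spacelike) hw u
    have hFN := lor_dirDeriv_add_eq_zero h.isOpen h.smooth h.smooth_normal
      (fun w hw => (h.pair w hw).orth) hw u
    rw [lor_comm, ← two_mul] at hNN
    rw [show lor (dirDeriv u F w) (N w) = 0 from h.normal w hw u, zero_add] at hFN
    exact ⟨hFN, by simpa [dirDeriv] using hNN⟩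
  symm u v := by
    have hsnd : ∀ u v, lor (fderiv ℝ F w u) (fderiv ℝ N w v)
        = -lor (dirDeriv v (dirDeriv u F) w) (N w) := fun u v =>
      eq_neg_of_add_eq_zero_right <| lor_dirDeriv_add_eq_zero h.isOpen
        (contDiffOn_dirDeriv h.isOpen h.smooth u) h.smooth_normal (fun w hw => h.normal w hw u) hw v
    rw [hsnd, hsnd, dirDeriv_comm h.isOpen h.smooth hw]
  imm := h.imm w hw

theorem planeHopf_eq (h : PlaneFront F N V) (hF : PlaneConformal F V) (hw : w ∈ V) :
    planeHopf F N w
      = lorC (dz (fun w => toC41 (F w)) w) (dz (fun w => toC41 ((F + N) w)) w) := by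
  obtain ⟨hnorm, horth⟩ := hF w hw
  have hd := h.differentiableAt hw
  have hdN := h.differentiableAt_normal hw
  rw [planeHopf, lorC_dz_dz hd hdN, lorC_dz_dz hd (hd.add hdN)]
  have hsum : ∀ u, dirDeriv u (F + N) w = dirDeriv u F w + dirDeriv u N w := fun u =>
    congrArg (· u) (h.fderiv_add hw)
  simp only [hsum, lor_add_right, lor_comm (dirDeriv Complex.I F w) (dirDeriv 1 F w), hnorm, horth]
  push_cast
  ring

theorem planeHopf_eq_zero_iff (h : PlaneFront F N V) (hw : w ∈ V)
    (hr : IsLW 1 0 (F w) (N w) (fderiv ℝ F w) (fderiv ℝ N w)) (hF : PlaneConformal F V) :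
    planeHopf F N w = 0 ↔ fderiv ℝ F w = 0 ∨ fderiv ℝ F w + fderiv ℝ N w = 0 := by
  obtain ⟨hnorm, horth⟩ := hF w hw
  have hd := h.differentiableAt hw
  rw [h.planeHopf_eq hF hw, lorC_dz_dz hd (hd.add (h.differentiableAt_normal hw))]
  simp only [dirDeriv] at hnorm horth ⊢
  rw [h.fderiv_add hw]
  refine ⟨fun h0 => ?_, by rintro (h0 | h0) <;> simp [h0]⟩
  by_cases hA : fderiv ℝ F w 1 = 0
  · rw [hA, lor_zero_left] at hnorm
    exact .inl (eq_zero_of_apply_one_of_apply_I hA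
      ((h.pair w hw).eq_zero_of_lor_self ((h.frontJet hw).perp _) hnorm.symm))
  obtain ⟨p, s, h₁, hI⟩ := (h.frontJet hw).exists_coeff hr hA hnorm horth
  have hpos := ((h.pair w hw).lor_self_pos ((h.frontJet hw).perp 1) hA).ne'
  simp only [add_apply, h₁, hI, sub_eq_add_neg, ← neg_smul, lor_add_right, lor_smul_right,
    lor_comm (fderiv ℝ F w Complex.I) (fderiv ℝ F w 1), horth, ← hnorm] at h0
  have hp : p = 0 := by simpa [hpos, ← two_mul] using congrArg Complex.re h0
  have hs : s = 0 := by simpa [hpos, ← two_mul] using congrArg Complex.im h0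
  refine .inr (eq_zero_of_apply_one_of_apply_I ?_ ?_)
  · simpa [hp, hs] using h₁
  · simpa [hp, hs] using hI

theorem dz_eq_zero_or_exists_smul (h : PlaneFront F N V) (hw : w ∈ V)
    (hr : IsLW 1 0 (F w) (N w) (fderiv ℝ F w) (fderiv ℝ N w)) (hF : PlaneConformal F V) :
    (dz (fun w => toC41 (F w)) w = 0 ∧ dzbar (fun w => toC41 (F w)) w = 0) ∨
      (∃ k : ℂ, dz (fun w => toC41 ((F + N) w)) w = k • dzbar (fun w => toC41 (F w)) w) ∧
      ∃ k : ℂ, dzbar (fun w => toC41 ((F + N) w)) w = k • dz (fun w => toC41 (F w)) w := by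
  obtain ⟨hnorm, horth⟩ := hF w hw
  have hd := h.differentiableAt hw
  have hdP := hd.add (h.differentiableAt_normal hw)
  rw [dz_toC41 hd, dzbar_toC41 hd, dz_toC41 hdP, dzbar_toC41 hdP]
  simp only [dirDeriv] at hnorm horth ⊢
  by_cases hA : fderiv ℝ F w 1 = 0
  · rw [hA, lor_zero_left] at hnorm
    simp [hA, (h.pair w hw).eq_zero_of_lor_self ((h.frontJet hw).perp _) hnorm.symm]
  obtain ⟨p, s, h₁, hI⟩ := (h.frontJet hw).exists_coeff hr hA hnorm horth
  rw [h.fderiv_add hw, add_apply, add_apply, h₁, hI]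
  have hsmul : ∀ (t : ℝ) x, toC41 (t • x) = (t : ℂ) • toC41 x := fun t x => by
    rw [map_smul, Complex.coe_smul]
  simp only [map_add, map_sub, hsmul]
  refine .inr ⟨⟨p - Complex.I * s, ?_⟩, ⟨p + Complex.I * s, ?_⟩⟩ <;> match_scalars
  · ring
  · linear_combination (s / 2 : ℂ) * Complex.I_sq
  · ring
  · linear_combination (s / 2 : ℂ) * Complex.I_sq

theorem differentiableOn_planeHopf (h : PlaneFront F N V)
    (hr : ∀ w ∈ V, IsLW 1 0 (F w) (N w) (fderiv ℝ F w) (fderiv ℝ N w)) (hF : PlaneConformal F V) :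
    DifferentiableOn ℂ (planeHopf F N) V := by
  have hG : ContDiffOn ℝ ∞ (fun w => toC41 (F w)) V := toC41.contDiff.comp_contDiffOn h.smooth
  have hP : ContDiffOn ℝ ∞ (fun w => toC41 ((F + N) w)) V :=
    toC41.contDiff.comp_contDiffOn (h.smooth.add h.smooth_normal)
  have hd : ∀ w ∈ V, DifferentiableAt ℝ F w := fun w => h.differentiableAt
  have hdP : ∀ w ∈ V, DifferentiableAt ℝ (F + N) w := fun w hw =>
    (hd w hw).add (h.differentiableAt_normal hw)
  have htr : ∀ w ∈ V, lor (dirDeriv 1 F w) (dirDeriv 1 (F + N) w)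
      + lor (dirDeriv Complex.I F w) (dirDeriv Complex.I (F + N) w) = 0 := fun w hw => by
    simp only [dirDeriv, h.fderiv_add hw]
    exact (h.frontJet hw).trace_eq_zero (hr w hw) (hF w hw).1 (hF w hw).2
  have hsymm : ∀ w ∈ V, lor (dirDeriv 1 F w) (dirDeriv Complex.I (F + N) w)
      = lor (dirDeriv Complex.I F w) (dirDeriv 1 (F + N) w) := fun w hw => by
    simp only [dirDeriv, h.fderiv_add hw]
    exact (h.frontJet hw).symm_add _ _
  refine DifferentiableOn.congr ?_ fun w hw => h.planeHopf_eq hF hw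
  refine differentiableOn_complex_of_dzbar_eq_zero h.isOpen
    (((lorC.bilinearRestrictScalars ℝ).contDiff.comp_contDiffOn
      (contDiffOn_dz h.isOpen hG)).clm_apply (contDiffOn_dz h.isOpen hP)) fun w hw => ?_
  refine dzbar_lorC_dz_eq_zero h.isOpen hG hP hw
    (fun w hw => ?_) (fun w hw => ?_) (fun w hw => ?_) (fun w hw => ?_) ?_
  · rw [lorC_dz_dz (hd w hw) (hd w hw), lor_comm (dirDeriv Complex.I F w) (dirDeriv 1 F w)]
    simp [(hF w hw).1, (hF w hw).2]
  · rw [lorC_dzbar_dzbar (hd w hw) (hd w hw), lor_comm (dirDeriv Complex.I F w) (dirDeriv 1 F w)]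
    simp [(hF w hw).1, (hF w hw).2]
  · rw [lorC_dz_dzbar (hd w hw) (hdP w hw), htr w hw, hsymm w hw]; simp
  · rw [lorC_dzbar_dz (hd w hw) (hdP w hw), htr w hw, hsymm w hw]; simp
  exact h.dz_eq_zero_or_exists_smul hw (hr w hw) hF

end PlaneFront

/-! ### Conformal coordinates of fronts with mean curvature one -/

/-- `e` is a smooth chart inside `V` in whose coordinate `F` is conformal. -/
structure IsPlaneConformalChart (F : ℂ → R41) (V : Set ℂ) (e : OpenPartialHomeomorph ℂ ℂ) :
    Prop where
  source_subset : e.source ⊆ V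
  smooth : ContDiffOn ℝ ∞ e e.source
  smooth_symm : ContDiffOn ℝ ∞ e.symm e.target
  conformal : PlaneConformal (F ∘ e.symm) e.target

theorem IsPlaneConformalChart.mono {F : ℂ → R41} {V V' : Set ℂ} {e : OpenPartialHomeomorph ℂ ℂ}
    (h : IsPlaneConformalChart F V e) (hV : V ⊆ V') : IsPlaneConformalChart F V' e :=
  ⟨h.source_subset.trans hV, h.smooth, h.smooth_symm, h.conformal⟩

theorem exists_isPlaneConformalChart_of_inner {F : ℂ → R41} {V : Set ℂ} {W : ℂ → ℂ}
    (hV : IsOpen V) (hF : ContDiffOn ℝ ∞ F V) (hW : ContDiffOn ℝ ∞ W V) {w₀ : ℂ} (hw₀ : w₀ ∈ V)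
    (hinj : Function.Injective (fderiv ℝ W w₀))
    (hμ : ∀ w ∈ V, ∃ μ : ℝ, ∀ u v, lor (fderiv ℝ F w u) (fderiv ℝ F w v)
      = μ * inner ℝ (fderiv ℝ W w u) (fderiv ℝ W w v)) :
    ∃ e, w₀ ∈ e.source ∧ IsPlaneConformalChart F V e := by
  obtain ⟨e, hwe, heV, heW, hes⟩ := exists_local_inverse hV hW hw₀ hinj
  refine ⟨e, hwe, heV, heW ▸ hW.mono heV, hes, fun ζ hζ => ?_⟩
  obtain ⟨μ, hμ⟩ := hμ _ (heV (e.map_target hζ))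
  have hlor : ∀ u v, lor (dirDeriv u (F ∘ e.symm) ζ) (dirDeriv v (F ∘ e.symm) ζ)
      = μ * inner ℝ u v := fun u v => by
    rw [dirDeriv, dirDeriv, fderiv_comp_symm hV hF heV hes hζ, ContinuousLinearMap.comp_apply,
      ContinuousLinearMap.comp_apply, hμ, fderiv_fderiv_symm hV hW heV heW hes hζ,
      fderiv_fderiv_symm hV hW heV heW hes hζ]
  rw [hlor, hlor, hlor]
  simp [Complex.inner]

section Similarity

/-- For a null vector `P` and `σ = ±1` with `P₀ ≠ σ P₃`, the map `tau σ P` is a similarity from the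
orthogonal complement of `P`, modulo `P`, to the complex plane. It is the derivative of the
stereographic coordinate `(P₁ + i P₂) / (P₀ - σ P₃)` of the light cone, up to a real factor. -/
def tau (σ : ℝ) : R41 →L[ℝ] R41 →L[ℝ] ℂ :=
  (LinearMap.mk₂ ℝ
    (fun P X => (⟨(P 0 - σ * P 3) * X 1 - P 1 * (X 0 - σ * X 3),
      (P 0 - σ * P 3) * X 2 - P 2 * (X 0 - σ * X 3)⟩ : ℂ))
    (fun x y z => by apply Complex.ext <;> simp <;> ring)
    (fun c x y => by apply Complex.ext <;> simp <;> ring)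
    (fun x y z => by apply Complex.ext <;> simp <;> ring)
    (fun c x y => by apply Complex.ext <;> simp <;> ring)).toContinuousBilinearMap

theorem tau_apply (σ : ℝ) (P X : R41) : tau σ P X =
    ⟨(P 0 - σ * P 3) * X 1 - P 1 * (X 0 - σ * X 3),
      (P 0 - σ * P 3) * X 2 - P 2 * (X 0 - σ * X 3)⟩ := rfl

theorem tau_self (σ : ℝ) (P : R41) : tau σ P P = 0 := by
  rw [tau_apply]
  apply Complex.ext <;> simp <;> ring

theorem inner_tau {σ : ℝ} (hσ : σ ^ 2 = 1) {P X Y : R41} (hP : lor P P = 0) (hX : lor P X = 0)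
    (hY : lor P Y = 0) :
    inner ℝ (tau σ P X) (tau σ P Y) = (P 0 - σ * P 3) ^ 2 * lor X Y := by
  simp only [lor, tau_apply, Complex.inner, Complex.mul_re, Complex.conj_re, Complex.conj_im]
    at *
  linear_combination (X 0 - σ * X 3) * (Y 0 - σ * Y 3) * hP
    - (P 0 - σ * P 3) * (Y 0 - σ * Y 3) * hX - (P 0 - σ * P 3) * (X 0 - σ * X 3) * hY
    + (P 0 * P 0 * X 3 * Y 3 - P 0 * P 3 * X 0 * Y 3 - P 0 * P 3 * X 3 * Y 0
      + P 3 * P 3 * X 0 * Y 0) * hσ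

theorem exists_sign_sub_ne_zero {P : R41} (hP : lor P P = 0) (hP0 : P ≠ 0) :
    ∃ σ : ℝ, σ ^ 2 = 1 ∧ P 0 - σ * P 3 ≠ 0 := by
  by_contra! h
  have hplus := h 1 (by norm_num)
  have hminus := h (-1) (by norm_num)
  have h₀ : P 0 = 0 := by linarith
  have h₃ : P 3 = 0 := by linarith
  simp only [lor, h₀, h₃] at hP
  have hnonneg := fun i => mul_self_nonneg (P i)
  have h₁ : P 1 = 0 := mul_self_eq_zero.1 (by linarith [hnonneg 1, hnonneg 2])
  have h₂ : P 2 = 0 := mul_self_eq_zero.1 (by linarith [hnonneg 1, hnonneg 2])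
  refine hP0 (funext fun i => ?_)
  fin_cases i <;> assumption

variable {F N x y : R41}

theorem OrthoPair.lor_add_self (h : OrthoPair F N) : lor (F + N) (F + N) = 0 := by
  simp [h.timelike, h.spacelike, h.orth, lor_comm N F]

theorem OrthoPair.add_ne_zero (h : OrthoPair F N) : F + N ≠ 0 := fun h0 => by
  simpa [h.timelike, h.orth] using congrArg (lor F) h0

theorem Perp.lor_add (h : Perp F N x) : lor (F + N) x = 0 := by
  rw [lor_add_left, h.1, h.2, add_zero]

theorem OrthoPair.inner_tau (h : OrthoPair F N) {σ : ℝ} (hσ : σ ^ 2 = 1) (hx : Perp F N x)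
    (hy : Perp F N y) : inner ℝ (tau σ (F + N) x) (tau σ (F + N) y)
      = ((F + N) 0 - σ * (F + N) 3) ^ 2 * lor x y :=
  LWFront.inner_tau hσ h.lor_add_self hx.lor_add hy.lor_add

theorem OrthoPair.injective_tau_comp (h : OrthoPair F N) {σ : ℝ} (hσ : σ ^ 2 = 1)
    (hσ₀ : (F + N) 0 - σ * (F + N) 3 ≠ 0) {E : Type*} [NormedAddCommGroup E] [NormedSpace ℝ E]
    {L : E →L[ℝ] R41} (hL : ∀ u, Perp F N (L u)) (hinj : Function.Injective L) :
    Function.Injective ((tau σ (F + N)).comp L) := by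
  refine (injective_iff_map_eq_zero _).2 fun u hu => hinj ?_
  have hinner := h.inner_tau hσ (hL u) (hL u)
  rw [← ContinuousLinearMap.comp_apply, hu, inner_zero_left, eq_comm, mul_eq_zero] at hinner
  rw [map_zero, h.eq_zero_of_lor_self (hL u) (hinner.resolve_left (pow_ne_zero 2 hσ₀))]

theorem FrontJet.tau_symm {E : Type*} [NormedAddCommGroup E] [NormedSpace ℝ E]
    {A B : E →L[ℝ] R41} (h : FrontJet F N A B) (hr : IsLW 1 0 F N A B) (σ : ℝ) (u v : E) :
    tau σ (A u + B u) (A v) = tau σ (A v + B v) (A u) := by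
  obtain ⟨g, hg⟩ := h.pair.exists_alternating_eq_vol_smul (tau σ).toLinearMap₁₂ (tau_self σ)
  have hvol : vol F N (A u + B u) (A v) = vol F N (A v + B v) (A u) := by
    rw [vol_swap, vol_swap F N (A v + B v)]
    linarith [hr u v]
  exact (hg _ _ (h.perp_add u) (h.perp v)).trans
    ((congrArg (· • g) hvol).trans (hg _ _ (h.perp_add v) (h.perp u)).symm)

end Similarity

theorem exists_contDiffOn_fderiv_eq {E G : Type*} [NormedAddCommGroup E] [NormedSpace ℝ E]
    [NormedAddCommGroup G] [NormedSpace ℝ G] [CompleteSpace G] {V : Set E} (hV : IsOpen V)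
    (hconv : Convex ℝ V) {θ : E → E →L[ℝ] G} (hθ : ContDiffOn ℝ ∞ θ V)
    (hsymm : ∀ w ∈ V, ∀ u v, fderiv ℝ θ w u v = fderiv ℝ θ w v u) :
    ∃ W : E → G, ContDiffOn ℝ ∞ W V ∧ ∀ w ∈ V, fderiv ℝ W w = θ w := by
  obtain ⟨W, hW⟩ := hconv.exists_forall_hasFDerivAt_of_fderiv_symmetric hV
    (hθ.differentiableOn (by simp)) hsymm
  refine ⟨W, ?_, fun w hw => (hW w hw).fderiv⟩
  rw [contDiffOn_infty_iff_fderiv_of_isOpen hV]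
  exact ⟨fun w hw => (hW w hw).differentiableAt.differentiableWithinAt,
    hθ.congr fun w hw => (hW w hw).fderiv⟩

/-- The stereographic coordinate of the light cone. -/
def stereo (σ : ℝ) (P : R41) : ℂ := (P 0 - σ * P 3)⁻¹ • (⟨P 1, P 2⟩ : ℂ)

theorem contDiffAt_stereo {σ : ℝ} {P : R41} (hP : P 0 - σ * P 3 ≠ 0) :
    ContDiffAt ℝ ∞ (stereo σ) P := by
  have h : stereo σ = fun P => (P 0 - σ * P 3)⁻¹ • ((P 1 : ℂ) + P 2 * Complex.I) := by
    funext P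
    rw [stereo, Complex.mk_eq_add_mul_I]
  have happly : ∀ i : Fin 4, ContDiffAt ℝ ∞ (fun P : R41 => P i) P := fun i =>
    (contDiff_apply ℝ ℝ i).contDiffAt
  have hofReal : ∀ i : Fin 4, ContDiffAt ℝ ∞ (fun P : R41 => (P i : ℂ)) P := fun i =>
    Complex.ofRealCLM.contDiff.contDiffAt.comp P (happly i)
  rw [h]
  exact (((happly 0).sub (contDiffAt_const.mul (happly 3))).inv hP).smul
    ((hofReal 1).add ((hofReal 2).mul contDiffAt_const))

theorem fderiv_stereo {σ : ℝ} {P : R41} (hP : P 0 - σ * P 3 ≠ 0) :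
    fderiv ℝ (stereo σ) P = ((P 0 - σ * P 3) ^ 2)⁻¹ • tau σ P := by
  let κ : R41 →L[ℝ] ℝ := ContinuousLinearMap.proj 0 - σ • ContinuousLinearMap.proj 3
  let m : R41 →L[ℝ] ℂ := Complex.equivRealProdCLM.symm.toContinuousLinearMap.comp
    ((ContinuousLinearMap.proj 1).prod (ContinuousLinearMap.proj 2))
  have hm : ∀ x, m x = ⟨x 1, x 2⟩ := fun x => by simp [m, Complex.ext_iff]
  have hstereo : stereo σ = fun P => (κ P)⁻¹ • m P := funext fun P => by rw [hm]; rfl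
  have hderiv := ((hasDerivAt_inv hP).comp_hasFDerivAt P κ.hasFDerivAt).smul m.hasFDerivAt
  rw [hstereo]
  refine hderiv.fderiv.trans (ContinuousLinearMap.ext fun X => ?_)
  change (P 0 - σ * P 3)⁻¹ • m X + (-((P 0 - σ * P 3) ^ 2)⁻¹ • (X 0 - σ * X 3)) • m P = _
  rw [smul_apply, hm, hm, tau_apply]
  apply Complex.ext <;>
  · simp only [Complex.add_re, Complex.add_im, Complex.smul_re, Complex.smul_im, smul_eq_mul]
    field_simp
    ring

namespace PlaneFront

variable {F N : ℂ → R41} {V : Set ℂ} {w₀ : ℂ}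

theorem smooth_add (h : PlaneFront F N V) : ContDiffOn ℝ ∞ (F + N) V :=
  h.smooth.add h.smooth_normal

theorem exists_sign_mem_nhds (h : PlaneFront F N V) (hw₀ : w₀ ∈ V) : ∃ σ : ℝ, σ ^ 2 = 1 ∧
    ∀ᶠ w in 𝓝 w₀, w ∈ V ∧ (F + N) w 0 - σ * (F + N) w 3 ≠ 0 := by
  obtain ⟨σ, hσ, hσ₀⟩ :=
    exists_sign_sub_ne_zero (h.pair w₀ hw₀).lor_add_self (h.pair w₀ hw₀).add_ne_zero
  have hcont := continuousAt_pi.1 (h.smooth_add.continuousOn.continuousAt (h.isOpen.mem_nhds hw₀))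
  have hne := ((hcont 0).sub ((hcont 3).const_mul σ)).eventually_ne hσ₀
  exact ⟨σ, hσ, (h.isOpen.eventually_mem hw₀).and hne⟩

/-- The form `tau (F + N) ∘ dF` is closed, since `IsLW 1 0` says that `vol (d(F + N)) dF = 0`. -/
theorem exists_fderiv_eq_tau (h : PlaneFront F N V) (hconv : Convex ℝ V)
    (hr : ∀ w ∈ V, IsLW 1 0 (F w) (N w) (fderiv ℝ F w) (fderiv ℝ N w)) (σ : ℝ) :
    ∃ W : ℂ → ℂ, ContDiffOn ℝ ∞ W V ∧
      ∀ w ∈ V, fderiv ℝ W w = (tau σ ((F + N) w)).comp (fderiv ℝ F w) := by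
  have hθ : ContDiffOn ℝ ∞ (fun w => (tau σ ((F + N) w)).comp (fderiv ℝ F w)) V :=
    ((tau σ).contDiff.comp_contDiffOn h.smooth_add).clm_comp
      (h.smooth.fderiv_of_isOpen h.isOpen le_rfl)
  refine exists_contDiffOn_fderiv_eq h.isOpen hconv hθ fun w hw u v => ?_
  have hderiv : ∀ u v, fderiv ℝ (fun w => (tau σ ((F + N) w)).comp (fderiv ℝ F w)) w u v
      = tau σ (fderiv ℝ F w u + fderiv ℝ N w u) (fderiv ℝ F w v)
        + tau σ ((F + N) w) (dirDeriv u (dirDeriv v F) w) := fun u v => by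
    have happly := congrArg (· u) (fderiv_clm_apply (differentiableAt_of_contDiffOn h.isOpen hθ hw)
      (differentiableAt_const v))
    simp only [fderiv_fun_const, Pi.zero_apply, ContinuousLinearMap.comp_zero, zero_add,
      ContinuousLinearMap.flip_apply] at happly
    rw [← happly]
    refine (dirDeriv_bilin (tau σ) (differentiableAt_of_contDiffOn h.isOpen h.smooth_add hw)
      (differentiableAt_of_contDiffOn h.isOpen (contDiffOn_dirDeriv h.isOpen h.smooth v) hw)
      u).trans ?_
    rw [dirDeriv, h.fderiv_add hw]
    rfl
  rw [hderiv, hderiv, (h.frontJet hw).tau_symm (hr w hw), dirDeriv_comm h.isOpen h.smooth hw]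

theorem exists_isPlaneConformalChart_of_injective (h : PlaneFront F N V)
    (hr : ∀ w ∈ V, IsLW 1 0 (F w) (N w) (fderiv ℝ F w) (fderiv ℝ N w)) (hw₀ : w₀ ∈ V)
    (hinj : Function.Injective (fderiv ℝ F w₀)) :
    ∃ e, w₀ ∈ e.source ∧ IsPlaneConformalChart F V e := by
  obtain ⟨σ, hσ, hnear⟩ := h.exists_sign_mem_nhds hw₀
  obtain ⟨r, hr₀, hball⟩ := Metric.eventually_nhds_iff_ball.1 hnear
  have hB := h.mono Metric.isOpen_ball fun w hw => (hball w hw).1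
  have hw₀B := Metric.mem_ball_self (x := w₀) hr₀
  obtain ⟨W, hW, hdW⟩ := hB.exists_fderiv_eq_tau (convex_ball w₀ r)
    (fun w hw => hr w (hball w hw).1) σ
  obtain ⟨e, hwe, he⟩ := exists_isPlaneConformalChart_of_inner hB.isOpen hB.smooth hW hw₀B
    (hdW w₀ hw₀B ▸ (h.pair w₀ hw₀).injective_tau_comp hσ (hball w₀ hw₀B).2
      (h.frontJet hw₀).perp hinj) fun w hw =>
    ⟨(((F + N) w 0 - σ * (F + N) w 3) ^ 2)⁻¹, fun u v => by
      have hinner := (hB.pair w hw).inner_tau hσ ((hB.frontJet hw).perp u)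
        ((hB.frontJet hw).perp v)
      rw [← Pi.add_apply F N] at hinner
      rw [hdW w hw, ContinuousLinearMap.comp_apply, ContinuousLinearMap.comp_apply, hinner]
      exact (inv_mul_cancel_left₀ (pow_ne_zero 2 (hball w hw).2) _).symm⟩
  exact ⟨e, hwe, he.mono fun w hw => (hball w hw).1⟩

theorem fderiv_stereo_comp (h : PlaneFront F N V) (hw₀ : w₀ ∈ V) {σ : ℝ}
    (hσ₀ : (F + N) w₀ 0 - σ * (F + N) w₀ 3 ≠ 0) :
    fderiv ℝ (fun w => stereo σ ((F + N) w)) w₀ = (((F + N) w₀ 0 - σ * (F + N) w₀ 3) ^ 2)⁻¹ •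
      (tau σ ((F + N) w₀)).comp (fderiv ℝ F w₀ + fderiv ℝ N w₀) := by
  rw [← h.fderiv_add hw₀, ← ContinuousLinearMap.smul_comp, ← fderiv_stereo hσ₀]
  exact fderiv_comp w₀ ((contDiffAt_stereo hσ₀).differentiableAt (by simp))
    (differentiableAt_of_contDiffOn h.isOpen h.smooth_add hw₀)

theorem inner_fderiv_stereo (h : PlaneFront F N V) (hw₀ : w₀ ∈ V) {σ : ℝ} (hσ : σ ^ 2 = 1)
    (hσ₀ : (F + N) w₀ 0 - σ * (F + N) w₀ 3 ≠ 0) (u v : ℂ) :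
    inner ℝ (fderiv ℝ (fun w => stereo σ ((F + N) w)) w₀ u)
        (fderiv ℝ (fun w => stereo σ ((F + N) w)) w₀ v)
      = (((F + N) w₀ 0 - σ * (F + N) w₀ 3) ^ 2)⁻¹ *
        lor (fderiv ℝ F w₀ u + fderiv ℝ N w₀ u) (fderiv ℝ F w₀ v + fderiv ℝ N w₀ v) := by
  have hinner := (h.pair w₀ hw₀).inner_tau hσ ((h.frontJet hw₀).perp_add u)
    ((h.frontJet hw₀).perp_add v)
  rw [← Pi.add_apply F N] at hinner
  rw [h.fderiv_stereo_comp hw₀ hσ₀, smul_apply, smul_apply, real_inner_smul_left,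
    real_inner_smul_right, ContinuousLinearMap.comp_apply, ContinuousLinearMap.comp_apply,
    add_apply, add_apply, hinner]
  field_simp

/-- The Gauss map `F + N` into the light cone is conformal, as the hyperbolic Gauss map of a front
of mean curvature one is. -/
theorem exists_isPlaneConformalChart_of_gauss_injective (h : PlaneFront F N V)
    (hr : ∀ w ∈ V, IsLW 1 0 (F w) (N w) (fderiv ℝ F w) (fderiv ℝ N w)) (hw₀ : w₀ ∈ V)
    (hinj : Function.Injective (fderiv ℝ (F + N) w₀)) :
    ∃ e, w₀ ∈ e.source ∧ IsPlaneConformalChart F V e := by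
  obtain ⟨σ, hσ, hnear⟩ := h.exists_sign_mem_nhds hw₀
  have hcont := (contDiffOn_dirDeriv h.isOpen h.smooth_add 1).continuousOn.continuousAt
    (h.isOpen.mem_nhds hw₀)
  have hne := hcont.eventually_ne (y := 0) fun h0 => one_ne_zero (hinj (h0.trans (map_zero _).symm))
  obtain ⟨S, hS, hSo, hw₀S⟩ := mem_nhds_iff.1 (hnear.and hne)
  have hB := h.mono hSo fun w hw => (hS hw).1.1
  have hW : ContDiffOn ℝ ∞ (fun w => stereo σ ((F + N) w)) S := fun w hw =>
    (contDiffAt_stereo (hS hw).1.2).comp_contDiffWithinAt w (hB.smooth_add w hw)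
  have hinj' : Function.Injective (fderiv ℝ (fun w => stereo σ ((F + N) w)) w₀) := by
    rw [h.fderiv_add hw₀] at hinj
    rw [h.fderiv_stereo_comp hw₀ (hS hw₀S).1.2]
    exact (smul_right_injective ℂ (inv_ne_zero (pow_ne_zero 2 (hS hw₀S).1.2))).comp
      ((h.pair w₀ hw₀).injective_tau_comp hσ (hS hw₀S).1.2 (h.frontJet hw₀).perp_add hinj)
  obtain ⟨e, hwe, he⟩ := exists_isPlaneConformalChart_of_inner hSo hB.smooth hW hw₀S hinj'
    fun w hw => by
      have hC : fderiv ℝ F w + fderiv ℝ N w ≠ 0 := fun h0 => (hS hw).2 <| by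
        rw [dirDeriv, h.fderiv_add (hS hw).1.1, h0, zero_apply]
      obtain ⟨μ, hμ⟩ := (hB.frontJet hw).exists_conformal_factor (hr w (hS hw).1.1) hC
      refine ⟨μ * ((F + N) w 0 - σ * (F + N) w 3) ^ 2, fun u v => ?_⟩
      rw [hμ, hB.inner_fderiv_stereo hw hσ (hS hw).1.2, mul_assoc,
        mul_inv_cancel_left₀ (pow_ne_zero 2 (hS hw).1.2)]
  exact ⟨e, hwe, he.mono fun w hw => (hS hw).1.1⟩

theorem exists_isPlaneConformalChart (h : PlaneFront F N V)
    (hr : ∀ w ∈ V, IsLW 1 0 (F w) (N w) (fderiv ℝ F w) (fderiv ℝ N w)) (hw₀ : w₀ ∈ V) :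
    ∃ e, w₀ ∈ e.source ∧ IsPlaneConformalChart F V e := by
  by_cases hinj : Function.Injective (fderiv ℝ F w₀)
  · exact h.exists_isPlaneConformalChart_of_injective hr hw₀ hinj
  · refine h.exists_isPlaneConformalChart_of_gauss_injective hr hw₀ ?_
    have hA := ((h.frontJet hw₀).not_injective_iff (hr w₀ hw₀)).1 hinj
    rw [h.fderiv_add hw₀, hA, zero_add]
    exact (injective_iff_map_eq_zero _).2 fun u => h.imm w₀ hw₀ u (by rw [hA, zero_apply])

end PlaneFront

/-! ### Fronts with constant principal curvatures -/

section Separation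

theorem exists_eq_smul_of_ker {G : Type*} [NormedAddCommGroup G] [NormedSpace ℝ G] {L : ℂ →L[ℝ] G}
    {v u : ℂ} (hv : v ≠ 0) (hLv : L v = 0) (hu : L u ≠ 0) (u' : ℂ) : ∃ r : ℝ, L u' = r • L u := by
  have hli : LinearIndependent ℝ ![v, u] := by
    rw [LinearIndependent.pair_iff' hv]
    rintro r rfl
    exact hu (by rw [map_smul, hLv, smul_zero])
  have hspan := hli.span_eq_top_of_card_eq_finrank' (by simp [Complex.finrank_real_complex])
  have hu' : u' ∈ Submodule.span ℝ {v, u} := by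
    rw [← Matrix.range_cons_cons_empty v u ![], hspan]
    exact Submodule.mem_top
  obtain ⟨r, s, rfl⟩ := Submodule.mem_span_pair.1 hu'
  exact ⟨s, by rw [map_add, map_smul, map_smul, hLv, smul_zero, zero_add]⟩

theorem surjective_lor_prod {a a₁ a₂ : R41} (h₁ : lor a₁ a = 0) (h₂ : lor a₂ a ≠ 0)
    (h₁₁ : lor a₁ a₁ ≠ 0) : Function.Surjective ((lorL a₁).prod (lorL a₂)) := by
  rintro ⟨p, q⟩
  refine ⟨(p / lor a₁ a₁) • a₁ + ((q - p / lor a₁ a₁ * lor a₂ a₁) / lor a₂ a) • a, ?_⟩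
  rw [ContinuousLinearMap.prod_apply, lorL_apply, lorL_apply]
  ext
  · simp [h₁, h₁₁]
  · simp [h₂]

theorem linearIndependent_of_lor {b b₁ b₂ : R41} (h₁ : lor b₁ b = 0) (h₂ : lor b₂ b ≠ 0)
    (h₁₁ : lor b₁ b₁ ≠ 0) : LinearIndependent ℝ ![b₁, b₂] := by
  refine LinearIndependent.pair_iff.2 fun r s hrs => ?_
  have hs : s = 0 := by simpa [h₁, h₂] using congrArg (lor · b) hrs
  refine ⟨?_, hs⟩
  simpa [hs, h₁₁] using congrArg (lor · b₁) hrs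

theorem exists_eq_smul_add_smul_of_lor {a₁ a₂ b₁ b₂ x : R41}
    (hsurj : Function.Surjective ((lorL a₁).prod (lorL a₂)))
    (hli : LinearIndependent ℝ ![b₁, b₂]) (h₁₁ : lor a₁ b₁ = 0) (h₁₂ : lor a₁ b₂ = 0)
    (h₂₁ : lor a₂ b₁ = 0) (h₂₂ : lor a₂ b₂ = 0) (h₁ : lor a₁ x = 0) (h₂ : lor a₂ x = 0) :
    ∃ r s : ℝ, x = r • b₁ + s • b₂ := by
  set φ : R41 →ₗ[ℝ] ℝ × ℝ := ((lorL a₁).prod (lorL a₂)).toLinearMap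
  have hker : ∀ y, lor a₁ y = 0 → lor a₂ y = 0 → y ∈ φ.ker := fun y h₁ h₂ => Prod.ext h₁ h₂
  have hle : Submodule.span ℝ (Set.range ![b₁, b₂]) ≤ φ.ker := Submodule.span_le.2 <| by
    rintro _ ⟨i, rfl⟩
    fin_cases i
    exacts [hker _ h₁₁ h₂₁, hker _ h₁₂ h₂₂]
  have hdim := φ.finrank_range_add_finrank_ker
  rw [LinearMap.range_eq_top.2 hsurj, finrank_top, Module.finrank_prod, Module.finrank_self,
    Module.finrank_fintype_fun_eq_card, Fintype.card_fin] at hdim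
  have hspan := Submodule.eq_of_le_of_finrank_le hle <| by
    rw [finrank_span_eq_card hli, Fintype.card_fin]
    lia
  have hx := hker x h₁ h₂
  rw [← hspan, Matrix.range_cons_cons_empty] at hx
  obtain ⟨r, s, hrs⟩ := Submodule.mem_span_pair.1 hx
  exact ⟨r, s, hrs.symm⟩

section Ortho

variable {E : Type*} [NormedAddCommGroup E] [NormedSpace ℝ E] {a b : E → R41} {V : Set E} {w : E}
  {e e' : E}

/-- Two maps with all derivatives of either one orthogonal to both of them, such as two constant
combinations of a front and its unit normal field. -/
structure OrthoDeriv (a b : E → R41) (V : Set E) : Prop where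
  isOpen : IsOpen V
  smooth_left : ContDiffOn ℝ ∞ a V
  smooth_right : ContDiffOn ℝ ∞ b V
  left_left : ∀ w ∈ V, ∀ u, lor (dirDeriv u a w) (a w) = 0
  left_right : ∀ w ∈ V, ∀ u, lor (dirDeriv u a w) (b w) = 0
  right_left : ∀ w ∈ V, ∀ u, lor (dirDeriv u b w) (a w) = 0
  right_right : ∀ w ∈ V, ∀ u, lor (dirDeriv u b w) (b w) = 0

theorem dirDeriv_dirDeriv_eq_zero (hV : IsOpen V) (ha : ContDiffOn ℝ ∞ a V)
    (h : ∀ w ∈ V, dirDeriv e' a w = 0) (hw : w ∈ V) (e : E) :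
    dirDeriv e' (dirDeriv e a) w = 0 := by
  rw [dirDeriv_comm hV ha hw, dirDeriv_congr hV h hw]
  simp [dirDeriv]

namespace OrthoDeriv

theorem swap (h : OrthoDeriv a b V) : OrthoDeriv b a V where
  isOpen := h.isOpen
  smooth_left := h.smooth_right
  smooth_right := h.smooth_left
  left_left := h.right_right
  left_right := h.right_left
  right_left := h.left_right
  right_right := h.left_left

theorem lor_dirDeriv_dirDeriv_left (h : OrthoDeriv a b V) (hb : ∀ w ∈ V, dirDeriv e b w = 0)
    (hw : w ∈ V) : lor (dirDeriv e (dirDeriv e a) w) (b w) = 0 := by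
  have hdiff := lor_dirDeriv_add_eq_zero h.isOpen (contDiffOn_dirDeriv h.isOpen h.smooth_left e)
    h.smooth_right (fun w hw => h.left_right w hw e) hw e
  rwa [hb w hw, lor_zero_right, add_zero] at hdiff

theorem lor_dirDeriv_dirDeriv (h : OrthoDeriv a b V) (ha : ∀ w ∈ V, dirDeriv e' a w = 0)
    (hw : w ∈ V) : lor (dirDeriv e a w) (dirDeriv e' b w) = 0 := by
  have hdiff := lor_dirDeriv_add_eq_zero h.isOpen (contDiffOn_dirDeriv h.isOpen h.smooth_left e)
    h.smooth_right (fun w hw => h.left_right w hw e) hw e'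
  rwa [dirDeriv_dirDeriv_eq_zero h.isOpen h.smooth_left ha hw, lor_zero_left, zero_add] at hdiff

theorem lor_dirDeriv₂_dirDeriv (h : OrthoDeriv a b V) (ha : ∀ w ∈ V, dirDeriv e' a w = 0)
    (hb : ∀ w ∈ V, dirDeriv e b w = 0) (hw : w ∈ V) :
    lor (dirDeriv e (dirDeriv e a) w) (dirDeriv e' b w) = 0 := by
  have hdiff := lor_dirDeriv_add_eq_zero h.isOpen (contDiffOn_dirDeriv h.isOpen h.smooth_left e)
    (contDiffOn_dirDeriv h.isOpen h.smooth_right e')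
    (fun w hw => h.lor_dirDeriv_dirDeriv ha hw) hw e
  rwa [dirDeriv_dirDeriv_eq_zero h.isOpen h.smooth_right hb hw, lor_zero_right, add_zero] at hdiff

theorem lor_dirDeriv₂_dirDeriv₂ (h : OrthoDeriv a b V) (ha : ∀ w ∈ V, dirDeriv e' a w = 0)
    (hb : ∀ w ∈ V, dirDeriv e b w = 0) (hw : w ∈ V) :
    lor (dirDeriv e (dirDeriv e a) w) (dirDeriv e' (dirDeriv e' b) w) = 0 := by
  have ha₁ := contDiffOn_dirDeriv h.isOpen h.smooth_left e
  have hdiff := lor_dirDeriv_add_eq_zero h.isOpen (contDiffOn_dirDeriv h.isOpen ha₁ e)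
    (contDiffOn_dirDeriv h.isOpen h.smooth_right e')
    (fun w hw => h.lor_dirDeriv₂_dirDeriv ha hb hw) hw e'
  rwa [dirDeriv_dirDeriv_eq_zero h.isOpen ha₁ (fun w hw =>
    dirDeriv_dirDeriv_eq_zero h.isOpen h.smooth_left ha hw e) hw, lor_zero_left, zero_add] at hdiff

theorem lor_dirDeriv₂_self_ne_zero (h : OrthoDeriv a b V) (hw : w ∈ V)
    (hpos : lor (dirDeriv e a w) (dirDeriv e a w) ≠ 0) :
    lor (dirDeriv e (dirDeriv e a) w) (a w) ≠ 0 := fun h0 => hpos <| by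
  have hdiff := lor_dirDeriv_add_eq_zero h.isOpen (contDiffOn_dirDeriv h.isOpen h.smooth_left e)
    h.smooth_left (fun w hw => h.left_left w hw e) hw e
  rwa [h0, zero_add] at hdiff

/-- The osculating planes of the curves `a` and `b` are orthogonal complements of each other; since
`a` is orthogonal to the plane of `b`, it lies in its own plane, to which `b` is orthogonal. -/
theorem lor_eq_zero_of_separated (h : OrthoDeriv a b V) (ha : ∀ w ∈ V, dirDeriv e' a w = 0)
    (hb : ∀ w ∈ V, dirDeriv e b w = 0) (hw : w ∈ V)
    (hae : lor (dirDeriv e a w) (dirDeriv e a w) ≠ 0)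
    (hbe : lor (dirDeriv e' b w) (dirDeriv e' b w) ≠ 0) : lor (a w) (b w) = 0 := by
  have hsurj := surjective_lor_prod (h.right_right w hw e')
    (h.swap.lor_dirDeriv₂_self_ne_zero hw hbe) hbe
  have hli := linearIndependent_of_lor (h.left_left w hw e)
    (h.lor_dirDeriv₂_self_ne_zero hw hae) hae
  obtain ⟨r, s, hrs⟩ := exists_eq_smul_add_smul_of_lor hsurj hli
    (h.swap.lor_dirDeriv_dirDeriv hb hw) (by
      rw [lor_comm]
      exact h.lor_dirDeriv₂_dirDeriv ha hb hw) (h.swap.lor_dirDeriv₂_dirDeriv hb ha hw)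
    (h.swap.lor_dirDeriv₂_dirDeriv₂ hb ha hw) (h.right_left w hw e')
    (h.swap.lor_dirDeriv_dirDeriv_left ha hw)
  rw [hrs, lor_add_left, lor_smul_left, lor_smul_left, h.left_right w hw,
    h.lor_dirDeriv_dirDeriv_left hb hw, mul_zero, mul_zero, add_zero]

theorem comp_symm (h : OrthoDeriv a b V) {φ : OpenPartialHomeomorph E E} (hφV : φ.source ⊆ V)
    (hφ : ContDiffOn ℝ ∞ φ.symm φ.target) :
    OrthoDeriv (a ∘ φ.symm) (b ∘ φ.symm) φ.target := by
  have hmaps : ∀ ζ ∈ φ.target, φ.symm ζ ∈ V := fun ζ hζ => hφV (φ.map_target hζ)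
  refine ⟨φ.open_target, h.smooth_left.comp hφ hmaps, h.smooth_right.comp hφ hmaps, ?_, ?_, ?_, ?_⟩
    <;> intro ζ hζ u
  · exact dirDeriv_comp_symm h.isOpen h.smooth_left hφV hφ hζ u ▸ h.left_left _ (hmaps ζ hζ) _
  · exact dirDeriv_comp_symm h.isOpen h.smooth_left hφV hφ hζ u ▸ h.left_right _ (hmaps ζ hζ) _
  · exact dirDeriv_comp_symm h.isOpen h.smooth_right hφV hφ hζ u ▸ h.right_left _ (hmaps ζ hζ) _
  · exact dirDeriv_comp_symm h.isOpen h.smooth_right hφV hφ hζ u ▸ h.right_right _ (hmaps ζ hζ) _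

end OrthoDeriv

end Ortho

variable {a b : ℂ → R41} {V : Set ℂ} {w₀ : ℂ}

theorem eventually_dirDeriv_eq_zero_of_lor (hV : IsOpen V) (ha : ContDiffOn ℝ ∞ a V)
    (hker : ∀ w ∈ V, ∃ v, v ≠ 0 ∧ dirDeriv v a w = 0) (hw₀ : w₀ ∈ V) {x : R41} {u₀ : ℂ}
    (hx : lor x (dirDeriv u₀ a w₀) ≠ 0) :
    ∀ᶠ w in 𝓝 w₀, ∀ u, lor x (dirDeriv u a w) = 0 → dirDeriv u a w = 0 := by
  have hcont : ContinuousAt (fun w => lorL x (dirDeriv u₀ a w)) w₀ :=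
    (lorL x).continuous.continuousAt.comp
      ((contDiffOn_dirDeriv hV ha u₀).continuousOn.continuousAt (hV.mem_nhds hw₀))
  filter_upwards [hV.mem_nhds hw₀, hcont.eventually_ne (y := 0) hx] with w hw hne u hu
  obtain ⟨v, hv, hav⟩ := hker w hw
  obtain ⟨r, hr⟩ := exists_eq_smul_of_ker hv hav (u := u₀)
    (fun h0 => hne (by rw [dirDeriv, h0, map_zero])) u
  change dirDeriv u a w = r • dirDeriv u₀ a w at hr
  rw [hr, lor_smul_right] at hu
  rw [hr, (mul_eq_zero.1 hu).resolve_right hne, zero_smul]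

theorem exists_contDiffOn_re_im (hV : IsOpen V) (ha : ContDiffOn ℝ ∞ a V)
    (hb : ContDiffOn ℝ ∞ b V) (x y : R41) : ∃ W : ℂ → ℂ, ContDiffOn ℝ ∞ W V ∧
      (∀ w ∈ V, ∀ u, (fderiv ℝ W w u).re = lor x (dirDeriv u a w)) ∧
      ∀ w ∈ V, ∀ u, (fderiv ℝ W w u).im = lor y (dirDeriv u b w) := by
  let W : ℂ → ℂ := fun w => Complex.equivRealProdCLM.symm (lorL x (a w), lorL y (b w))
  have hW : ContDiffOn ℝ ∞ W V := Complex.equivRealProdCLM.symm.contDiff.comp_contDiffOn <|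
    ((lorL x).contDiff.comp_contDiffOn ha).prodMk ((lorL y).contDiff.comp_contDiffOn hb)
  exact ⟨W, hW, fun w hw u =>
      (dirDeriv_clm Complex.reCLM (differentiableAt_of_contDiffOn hV hW hw) u).symm.trans
        (dirDeriv_clm (lorL x) (differentiableAt_of_contDiffOn hV ha hw) u), fun w hw u =>
      (dirDeriv_clm Complex.imCLM (differentiableAt_of_contDiffOn hV hW hw) u).symm.trans
        (dirDeriv_clm (lorL y) (differentiableAt_of_contDiffOn hV hb hw) u)⟩

/-- Two maps whose differentials have rank one and complementary kernels, with non-null image; for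
a front these arise from two constant principal curvatures. -/
structure FocalPair (a b : ℂ → R41) (V : Set ℂ) : Prop extends OrthoDeriv a b V where
  ker_left : ∀ w ∈ V, ∃ u, u ≠ 0 ∧ dirDeriv u a w = 0
  ker_right : ∀ w ∈ V, ∃ u, u ≠ 0 ∧ dirDeriv u b w = 0
  imm : ∀ w ∈ V, ∀ u, dirDeriv u a w = 0 → dirDeriv u b w = 0 → u = 0
  non_null_left : ∀ w ∈ V, ∀ u, dirDeriv u a w ≠ 0 → lor (dirDeriv u a w) (dirDeriv u a w) ≠ 0
  non_null_right : ∀ w ∈ V, ∀ u, dirDeriv u b w ≠ 0 → lor (dirDeriv u b w) (dirDeriv u b w) ≠ 0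

namespace FocalPair

theorem exists_separating_vectors (h : FocalPair a b V) (hw₀ : w₀ ∈ V) :
    ∃ x y : R41, ∀ᶠ w in 𝓝 w₀, (∀ u, lor x (dirDeriv u a w) = 0 → dirDeriv u a w = 0) ∧
      ∀ u, lor y (dirDeriv u b w) = 0 → dirDeriv u b w = 0 := by
  obtain ⟨u, hu, hbu⟩ := h.ker_right w₀ hw₀
  obtain ⟨v, hv, hav⟩ := h.ker_left w₀ hw₀
  exact ⟨dirDeriv u a w₀, dirDeriv v b w₀,
    (eventually_dirDeriv_eq_zero_of_lor h.isOpen h.smooth_left h.ker_left hw₀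
      (h.non_null_left w₀ hw₀ u fun h0 => hu (h.imm w₀ hw₀ u h0 hbu))).and
    (eventually_dirDeriv_eq_zero_of_lor h.isOpen h.smooth_right h.ker_right hw₀
      (h.non_null_right w₀ hw₀ v fun h0 => hv (h.imm w₀ hw₀ v hav h0)))⟩

/-- The coordinate is `⟨x, a⟩ + i ⟨y, b⟩` for suitable constant vectors `x` and `y`. -/
theorem exists_separating_chart (h : FocalPair a b V) (hw₀ : w₀ ∈ V) :
    ∃ φ : OpenPartialHomeomorph ℂ ℂ, w₀ ∈ φ.source ∧ φ.source ⊆ V ∧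
      ContDiffOn ℝ ∞ φ.symm φ.target ∧
      (∀ ζ ∈ φ.target, dirDeriv Complex.I (a ∘ φ.symm) ζ = 0 ∧ dirDeriv 1 (b ∘ φ.symm) ζ = 0 ∧
        dirDeriv 1 (a ∘ φ.symm) ζ ≠ 0 ∧ dirDeriv Complex.I (b ∘ φ.symm) ζ ≠ 0) := by
  obtain ⟨x, y, hxy⟩ := h.exists_separating_vectors hw₀
  obtain ⟨S, hS, hSo, hw₀S⟩ := mem_nhds_iff.1 (hxy.and (h.isOpen.mem_nhds hw₀))
  have hSV : S ⊆ V := fun w hw => (hS hw).2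
  have ha := h.smooth_left.mono hSV
  have hb := h.smooth_right.mono hSV
  obtain ⟨W, hW, hre, him⟩ := exists_contDiffOn_re_im hSo ha hb x y
  have hinj : Function.Injective (fderiv ℝ W w₀) := (injective_iff_map_eq_zero _).2 fun u hu =>
    h.imm w₀ hw₀ u ((hS hw₀S).1.1 u (by rw [← hre w₀ hw₀S, hu, Complex.zero_re]))
      ((hS hw₀S).1.2 u (by rw [← him w₀ hw₀S, hu, Complex.zero_im]))
  obtain ⟨φ, hwφ, hφS, hφW, hφ⟩ := exists_local_inverse hSo hW hw₀S hinj
  refine ⟨φ, hwφ, hφS.trans hSV, hφ, fun ζ hζ => ?_⟩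
  have hmem := hφS (φ.map_target hζ)
  have hderiva := dirDeriv_comp_symm hSo ha hφS hφ hζ
  have hderivb := dirDeriv_comp_symm hSo hb hφS hφ hζ
  have hlora : ∀ u, lor x (dirDeriv u (a ∘ φ.symm) ζ) = u.re := fun u => by
    rw [hderiva, ← hre _ hmem, fderiv_fderiv_symm hSo hW hφS hφW hφ hζ]
  have hlorb : ∀ u, lor y (dirDeriv u (b ∘ φ.symm) ζ) = u.im := fun u => by
    rw [hderivb, ← him _ hmem, fderiv_fderiv_symm hSo hW hφS hφW hφ hζ]
  refine ⟨?_, ?_, fun h0 => ?_, fun h0 => ?_⟩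
  · rw [hderiva]
    exact (hS hmem).1.1 _ (by rw [← hderiva, hlora, Complex.I_re])
  · rw [hderivb]
    exact (hS hmem).1.2 _ (by rw [← hderivb, hlorb, Complex.one_im])
  · simpa [h0] using hlora 1
  · simpa [h0] using hlorb Complex.I

theorem lor_eq_zero (h : FocalPair a b V) (hw₀ : w₀ ∈ V) : lor (a w₀) (b w₀) = 0 := by
  obtain ⟨φ, hwφ, hφV, hφ, hsep⟩ := h.exists_separating_chart hw₀
  have hζ := φ.map_source hwφ
  have hmem := hφV (φ.map_target hζ)
  obtain ⟨-, -, ha, hb⟩ := hsep _ hζ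
  have hlor := (h.toOrthoDeriv.comp_symm hφV hφ).lor_eq_zero_of_separated
    (fun ζ hζ => (hsep ζ hζ).1) (fun ζ hζ => (hsep ζ hζ).2.1) hζ
    (by
      rw [dirDeriv_comp_symm h.isOpen h.smooth_left hφV hφ hζ] at ha ⊢
      exact h.non_null_left _ hmem _ ha)
    (by
      rw [dirDeriv_comp_symm h.isOpen h.smooth_right hφV hφ hζ] at hb ⊢
      exact h.non_null_right _ hmem _ hb)
  rwa [Function.comp_apply, Function.comp_apply, φ.left_inv hwφ] at hlor

end FocalPair

end Separation

namespace PlaneFront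

variable {F N : ℂ → R41} {V : Set ℂ} {w : ℂ}

theorem fderiv_smul_add_smul (h : PlaneFront F N V) (hw : w ∈ V) (p q : ℝ) :
    fderiv ℝ (p • F + q • N) w = p • fderiv ℝ F w + q • fderiv ℝ N w := by
  rw [_root_.fderiv_add ((h.differentiableAt hw).const_smul p)
    ((h.differentiableAt_normal hw).const_smul q), fderiv_const_smul (h.differentiableAt hw),
    fderiv_const_smul (h.differentiableAt_normal hw)]

theorem perp_dirDeriv (h : PlaneFront F N V) (hw : w ∈ V) (p q : ℝ) (u : ℂ) :
    Perp (F w) (N w) (dirDeriv u (p • F + q • N) w) := by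
  rw [dirDeriv, h.fderiv_smul_add_smul hw]
  exact (((h.frontJet hw).perp u).smul p).add (((h.frontJet hw).perp_normal u).smul q)

theorem lor_dirDeriv_eq_zero (h : PlaneFront F N V) (p q p' q' : ℝ) :
    ∀ w ∈ V, ∀ u, lor (dirDeriv u (p • F + q • N) w) ((p' • F + q' • N) w) = 0 := fun w hw u => by
  obtain ⟨hF, hN⟩ := h.perp_dirDeriv hw p q u
  rw [lor_comm, Pi.add_apply, Pi.smul_apply, Pi.smul_apply, lor_add_left, lor_smul_left,
    lor_smul_left, hF, hN, mul_zero, mul_zero, add_zero]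

theorem orthoDeriv (h : PlaneFront F N V) (p₁ q₁ p₂ q₂ : ℝ) :
    OrthoDeriv (p₁ • F + q₁ • N) (p₂ • F + q₂ • N) V where
  isOpen := h.isOpen
  smooth_left := (h.smooth.const_smul p₁).add (h.smooth_normal.const_smul q₁)
  smooth_right := (h.smooth.const_smul p₂).add (h.smooth_normal.const_smul q₂)
  left_left := h.lor_dirDeriv_eq_zero p₁ q₁ p₁ q₁
  left_right := h.lor_dirDeriv_eq_zero p₁ q₁ p₂ q₂
  right_left := h.lor_dirDeriv_eq_zero p₂ q₂ p₁ q₁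
  right_right := h.lor_dirDeriv_eq_zero p₂ q₂ p₂ q₂

theorem exists_ker_of_vol_eq_zero (h : PlaneFront F N V) {p q : ℝ}
    (hvol : ∀ w ∈ V, ∀ u v, vol (F w) (N w) ((p • fderiv ℝ F w + q • fderiv ℝ N w) u)
      ((p • fderiv ℝ F w + q • fderiv ℝ N w) v) = 0) :
    ∀ w ∈ V, ∃ u, u ≠ 0 ∧ dirDeriv u (p • F + q • N) w = 0 := fun w hw => by
  have hinj : ¬ Function.Injective (fderiv ℝ (p • F + q • N) w) := by
    rw [(h.pair w hw).injective_iff Complex.basisOneI fun u => h.perp_dirDeriv hw p q u,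
      h.fderiv_smul_add_smul hw]
    exact not_not.2 (hvol w hw _ _)
  obtain ⟨u, hu, hu0⟩ := not_forall₂.1 (mt (injective_iff_map_eq_zero _).2 hinj)
  exact ⟨u, hu0, hu⟩

theorem focalPair (h : PlaneFront F N V) {p₁ q₁ p₂ q₂ : ℝ} (hdet : p₁ * q₂ - p₂ * q₁ ≠ 0)
    (h₁ : ∀ w ∈ V, ∀ u v, vol (F w) (N w) ((p₁ • fderiv ℝ F w + q₁ • fderiv ℝ N w) u)
      ((p₁ • fderiv ℝ F w + q₁ • fderiv ℝ N w) v) = 0)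
    (h₂ : ∀ w ∈ V, ∀ u v, vol (F w) (N w) ((p₂ • fderiv ℝ F w + q₂ • fderiv ℝ N w) u)
      ((p₂ • fderiv ℝ F w + q₂ • fderiv ℝ N w) v) = 0) :
    FocalPair (p₁ • F + q₁ • N) (p₂ • F + q₂ • N) V where
  toOrthoDeriv := h.orthoDeriv p₁ q₁ p₂ q₂
  ker_left := h.exists_ker_of_vol_eq_zero h₁
  ker_right := h.exists_ker_of_vol_eq_zero h₂
  non_null_left w hw u h0 := ((h.pair w hw).lor_self_pos (h.perp_dirDeriv hw p₁ q₁ u) h0).ne'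
  non_null_right w hw u h0 := ((h.pair w hw).lor_self_pos (h.perp_dirDeriv hw p₂ q₂ u) h0).ne'
  imm w hw u e₁ e₂ := by
    rw [dirDeriv, h.fderiv_smul_add_smul hw, add_apply, smul_apply, smul_apply] at e₁ e₂
    have hF : (p₁ * q₂ - p₂ * q₁) • fderiv ℝ F w u = q₂ • (p₁ • fderiv ℝ F w u
      + q₁ • fderiv ℝ N w u) - q₁ • (p₂ • fderiv ℝ F w u + q₂ • fderiv ℝ N w u) := by module
    have hN : (p₁ * q₂ - p₂ * q₁) • fderiv ℝ N w u = p₁ • (p₂ • fderiv ℝ F w u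
      + q₂ • fderiv ℝ N w u) - p₂ • (p₁ • fderiv ℝ F w u + q₁ • fderiv ℝ N w u) := by module
    rw [e₁, e₂, smul_zero, smul_zero, sub_zero, smul_eq_zero] at hF hN
    exact h.imm w hw u (hF.resolve_left hdet) (hN.resolve_left hdet)

/-- Cartan's relation between two constant principal curvatures, in homogeneous form: the rank of
`p dF + q dN` drops where `p / q` is a principal curvature. -/
theorem cartan (h : PlaneFront F N V) (hne : V.Nonempty) {p₁ q₁ p₂ q₂ : ℝ}
    (hdet : p₁ * q₂ - p₂ * q₁ ≠ 0)
    (h₁ : ∀ w ∈ V, ∀ u v, vol (F w) (N w) ((p₁ • fderiv ℝ F w + q₁ • fderiv ℝ N w) u)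
      ((p₁ • fderiv ℝ F w + q₁ • fderiv ℝ N w) v) = 0)
    (h₂ : ∀ w ∈ V, ∀ u v, vol (F w) (N w) ((p₂ • fderiv ℝ F w + q₂ • fderiv ℝ N w) u)
      ((p₂ • fderiv ℝ F w + q₂ • fderiv ℝ N w) v) = 0) :
    q₁ * q₂ - p₁ * p₂ = 0 := by
  obtain ⟨w, hw⟩ := hne
  have hlor := (h.focalPair hdet h₁ h₂).lor_eq_zero hw
  have hp := h.pair w hw
  simp only [Pi.add_apply, Pi.smul_apply, lor_add_left, lor_add_right, lor_smul_left,
    lor_smul_right, hp.timelike, hp.spacelike, hp.orth, lor_comm (N w) (F w)] at hlor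
  linarith

end PlaneFront

/-! ### Fronts in smooth coordinates -/

section Manifold

variable {M : Type*} [TopologicalSpace M] [ChartedSpace (EuclideanSpace ℝ (Fin 2)) M]

/-- A smooth complex-valued local coordinate of a surface. -/
structure IsSmoothCoord (z : OpenPartialHomeomorph M ℂ) : Prop where
  smooth : ContMDiffOn (𝓡 2) 𝓘(ℝ, ℂ) ∞ z z.source
  smooth_symm : ContMDiffOn 𝓘(ℝ, ℂ) (𝓡 2) ∞ z.symm z.target

theorem IsConformalCoord.isSmoothCoord {z : OpenPartialHomeomorph M ℂ} {f : M → R41}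
    (hz : IsConformalCoord z f) : IsSmoothCoord z :=
  ⟨hz.smooth, hz.smooth_symm⟩

theorem exists_isSmoothCoord [IsManifold (𝓡 2) ∞ M] {p : M} {U : Set M} (hp : p ∈ U) :
    ∃ z : OpenPartialHomeomorph M ℂ, p ∈ z.source ∧ z p ∈ z.target ∩ z.symm ⁻¹' U ∧
      IsSmoothCoord z := by
  let Φ : EuclideanSpace ℝ (Fin 2) ≃L[ℝ] ℂ :=
    Complex.orthonormalBasisOneI.repr.symm.toContinuousLinearEquiv
  let c := chartAt (EuclideanSpace ℝ (Fin 2)) p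
  have hps : p ∈ (c.transHomeomorph Φ.toHomeomorph).source := mem_chart_source _ p
  refine ⟨_, hps, ⟨OpenPartialHomeomorph.map_source _ hps, ?_⟩, ?_, ?_⟩
  · rwa [Set.mem_preimage, OpenPartialHomeomorph.left_inv _ hps]
  · exact Φ.contDiff.contMDiff.comp_contMDiffOn (contMDiffOn_chart (I := 𝓡 2) (x := p))
  · exact (contMDiffOn_chart_symm (I := 𝓡 2) (x := p)).comp
      Φ.symm.contDiff.contMDiff.contMDiffOn (fun x hx => by simpa using hx)

namespace IsSmoothCoord

variable {z : OpenPartialHomeomorph M ℂ}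

theorem trans (hz : IsSmoothCoord z) {e : OpenPartialHomeomorph ℂ ℂ}
    (he : ContDiffOn ℝ ∞ e e.source) (he' : ContDiffOn ℝ ∞ e.symm e.target) :
    IsSmoothCoord (z.trans e) where
  smooth := by
    rw [OpenPartialHomeomorph.trans_source]
    exact he.contMDiffOn.comp (hz.smooth.mono Set.inter_subset_left) fun _ hx => hx.2
  smooth_symm := by
    rw [OpenPartialHomeomorph.trans_target]
    exact hz.smooth_symm.comp (he'.contMDiffOn.mono Set.inter_subset_left) fun _ hx => hx.2

theorem contDiffOn_comp_symm (hz : IsSmoothCoord z) {f : M → R41} {U : Set M}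
    (hf : ContMDiffOn (𝓡 2) 𝓘(ℝ, R41) ∞ f U) :
    ContDiffOn ℝ ∞ (f ∘ z.symm) (z.target ∩ z.symm ⁻¹' U) :=
  contMDiffOn_iff_contDiffOn.1 (hf.comp (hz.smooth_symm.mono Set.inter_subset_left)
    fun _ hx => hx.2)

theorem exists_dmap_eq_comp (hz : IsSmoothCoord z) {w : ℂ} (hw : w ∈ z.target) :
    ∃ T : EuclideanSpace ℝ (Fin 2) ≃L[ℝ] ℂ, ∀ f : M → R41,
      ContMDiffAt (𝓡 2) 𝓘(ℝ, R41) ∞ f (z.symm w) →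
      dmap f (z.symm w) = (fderiv ℝ (f ∘ z.symm) w).comp
        (T : EuclideanSpace ℝ (Fin 2) →L[ℝ] ℂ) := by
  have hm : z.MDifferentiable (𝓡 2) 𝓘(ℝ, ℂ) :=
    ⟨hz.smooth.mdifferentiableOn (by simp), hz.smooth_symm.mdifferentiableOn (by simp)⟩
  have hp := z.map_target hw
  refine ⟨hm.mfderiv hp, fun f hf => ?_⟩
  have hcongr : f =ᶠ[𝓝 (z.symm w)] (f ∘ z.symm) ∘ z := by
    filter_upwards [z.open_source.mem_nhds hp] with x hx
    rw [Function.comp_apply, Function.comp_apply, z.left_inv hx]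
  have hfz : MDifferentiableAt 𝓘(ℝ, ℂ) 𝓘(ℝ, R41) (f ∘ z.symm) w :=
    (hf.mdifferentiableAt (by simp)).comp _ (hm.mdifferentiableAt_symm hw)
  rw [← z.right_inv hw] at hfz
  rw [dmap, hcongr.mfderiv_eq, mfderiv_comp _ hfz (hm.mdifferentiableAt hp), mfderiv_eq_fderiv,
    z.right_inv hw]
  rfl

end IsSmoothCoord

theorem dmap_smul_add_smul {f ν : M → R41} {p : M} (hf : ContMDiffAt (𝓡 2) 𝓘(ℝ, R41) ∞ f p)
    (hν : ContMDiffAt (𝓡 2) 𝓘(ℝ, R41) ∞ ν p) (a b : ℝ) :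
    dmap (fun x => a • f x + b • ν x) p = a • dmap f p + b • dmap ν p := by
  have hdf := (hf.mdifferentiableAt (by simp)).hasMFDerivAt
  have hdν := (hν.mdifferentiableAt (by simp)).hasMFDerivAt
  exact ((hdf.const_smul a).add (hdν.const_smul b)).mfderiv

/-- The linear Weingarten relation `IsLW` at a point of a surface. -/
def IsLWAt (α β : ℝ) (f ν : M → R41) (p : M) : Prop :=
  IsLW α β (f p) (ν p) (dmap f p) (dmap ν p)

namespace IsFrontOn

variable {f ν : M → R41} {U : Set M}

theorem mono (h : IsFrontOn f ν U) {U' : Set M} (hs : U' ⊆ U) : IsFrontOn f ν U' :=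
  ⟨h.smooth.mono hs, h.smooth_normal.mono hs, fun p hp => h.mem_H3 p (hs hp),
    fun p hp => h.unit p (hs hp), fun p hp => h.orth p (hs hp), fun p hp => h.normal p (hs hp),
    fun p hp => h.immersion p (hs hp)⟩

theorem contMDiffAt (h : IsFrontOn f ν U) (hU : IsOpen U) {p : M} (hp : p ∈ U) :
    ContMDiffAt (𝓡 2) 𝓘(ℝ, R41) ∞ f p :=
  h.smooth.contMDiffAt (hU.mem_nhds hp)

theorem contMDiffAt_normal (h : IsFrontOn f ν U) (hU : IsOpen U) {p : M} (hp : p ∈ U) :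
    ContMDiffAt (𝓡 2) 𝓘(ℝ, R41) ∞ ν p :=
  h.smooth_normal.contMDiffAt (hU.mem_nhds hp)

theorem isRegularAt_of_dmap_add_eq_zero (h : IsFrontOn f ν U) {p : M} (hp : p ∈ U)
    (h0 : dmap f p + dmap ν p = 0) : IsRegularAt f p :=
  (injective_iff_map_eq_zero _).2 fun v hv => h.immersion p hp v hv <| by
    simpa [hv] using DFunLike.congr_fun h0 v

variable {z : OpenPartialHomeomorph M ℂ}

theorem planeFront (h : IsFrontOn f ν U) (hU : IsOpen U) (hz : IsSmoothCoord z) :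
    PlaneFront (f ∘ z.symm) (ν ∘ z.symm) (z.target ∩ z.symm ⁻¹' U) where
  isOpen := z.symm.isOpen_inter_preimage hU
  smooth := hz.contDiffOn_comp_symm h.smooth
  smooth_normal := hz.contDiffOn_comp_symm h.smooth_normal
  pair w hw := ⟨(h.mem_H3 _ hw.2).1, h.unit _ hw.2, h.orth _ hw.2⟩
  normal w hw v := by
    obtain ⟨T, hT⟩ := hz.exists_dmap_eq_comp hw.1
    simpa [hT f (h.contMDiffAt hU hw.2)] using h.normal _ hw.2 (T.symm v)
  imm w hw v hA hB := by
    obtain ⟨T, hT⟩ := hz.exists_dmap_eq_comp hw.1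
    simpa [hT f (h.contMDiffAt hU hw.2), hT ν (h.contMDiffAt_normal hU hw.2), hA, hB]
      using h.immersion _ hw.2 (T.symm v)

theorem isLWAt_symm_iff (h : IsFrontOn f ν U) (hU : IsOpen U) (hz : IsSmoothCoord z) {w : ℂ}
    (hw : w ∈ z.target ∩ z.symm ⁻¹' U) (α β : ℝ) :
    IsLWAt α β f ν (z.symm w) ↔ IsLW α β ((f ∘ z.symm) w) ((ν ∘ z.symm) w)
      (fderiv ℝ (f ∘ z.symm) w) (fderiv ℝ (ν ∘ z.symm) w) := by
  obtain ⟨T, hT⟩ := hz.exists_dmap_eq_comp hw.1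
  rw [IsLWAt, hT f (h.contMDiffAt hU hw.2), hT ν (h.contMDiffAt_normal hU hw.2)]
  exact ⟨fun h0 u v => by simpa using h0 (T.symm u) (T.symm v), fun h0 => h0.comp _⟩

theorem isRegularAt_symm_iff (h : IsFrontOn f ν U) (hU : IsOpen U) (hz : IsSmoothCoord z) {w : ℂ}
    (hw : w ∈ z.target ∩ z.symm ⁻¹' U) :
    IsRegularAt f (z.symm w) ↔ Function.Injective (fderiv ℝ (f ∘ z.symm) w) := by
  obtain ⟨T, hT⟩ := hz.exists_dmap_eq_comp hw.1
  rw [IsRegularAt, hT f (h.contMDiffAt hU hw.2)]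
  exact Function.Injective.of_comp_iff' _ T.bijective

theorem dmap_symm_smul_add_smul_eq_zero_iff (h : IsFrontOn f ν U) (hU : IsOpen U)
    (hz : IsSmoothCoord z) {w : ℂ} (hw : w ∈ z.target ∩ z.symm ⁻¹' U) (a b : ℝ) :
    a • dmap f (z.symm w) + b • dmap ν (z.symm w) = 0 ↔
      a • fderiv ℝ (f ∘ z.symm) w + b • fderiv ℝ (ν ∘ z.symm) w = 0 := by
  obtain ⟨T, hT⟩ := hz.exists_dmap_eq_comp hw.1
  rw [hT f (h.contMDiffAt hU hw.2), hT ν (h.contMDiffAt_normal hU hw.2)]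
  refine ⟨fun h0 => ContinuousLinearMap.ext fun v => ?_, fun h0 => ContinuousLinearMap.ext fun v =>
    DFunLike.congr_fun h0 (T v)⟩
  simpa using DFunLike.congr_fun h0 (T.symm v)

variable [IsManifold (𝓡 2) ∞ M]

theorem frontJet (h : IsFrontOn f ν U) (hU : IsOpen U) {p : M} (hp : p ∈ U) :
    FrontJet (f p) (ν p) (dmap f p) (dmap ν p) := by
  obtain ⟨z, hpz, hw, hz⟩ := exists_isSmoothCoord hp
  obtain ⟨T, hT⟩ := hz.exists_dmap_eq_comp hw.1
  have hjet := ((h.planeFront hU hz).frontJet hw).comp T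
  rwa [← hT f (h.contMDiffAt hU hw.2), ← hT ν (h.contMDiffAt_normal hU hw.2),
    Function.comp_apply, Function.comp_apply, z.left_inv hpz] at hjet

/-! ### Open conditions on a front -/

theorem eventually_isRegularAt (h : IsFrontOn f ν U) (hU : IsOpen U) {p : M} (hp : p ∈ U)
    (hreg : IsRegularAt f p) : ∀ᶠ x in 𝓝 p, IsRegularAt f x := by
  obtain ⟨z, hpz, hw, hz⟩ := exists_isSmoothCoord hp
  rw [← z.left_inv hpz, h.isRegularAt_symm_iff hU hz hw] at hreg
  have hV := (h.planeFront hU hz).isOpen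
  rw [← z.eventually_nhds' _ hpz]
  filter_upwards [hV.mem_nhds hw, eventually_injective_fderiv hV
    (h.planeFront hU hz).smooth hw hreg] with w hw hinj
    using (h.isRegularAt_symm_iff hU hz hw).2 hinj

theorem eventually_dmap_smul_add_smul_ne_zero (h : IsFrontOn f ν U) (hU : IsOpen U) {p : M}
    (hp : p ∈ U) {a b : ℝ} (h0 : a • dmap f p + b • dmap ν p ≠ 0) :
    ∀ᶠ x in 𝓝 p, a • dmap f x + b • dmap ν x ≠ 0 := by
  obtain ⟨z, hpz, hw, hz⟩ := exists_isSmoothCoord hp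
  rw [← z.left_inv hpz, Ne, h.dmap_symm_smul_add_smul_eq_zero_iff hU hz hw] at h0
  have hpl := h.planeFront hU hz
  have hV := hpl.isOpen.mem_nhds hw
  have hcont := (((hpl.smooth.fderiv_of_isOpen hpl.isOpen (m := ∞) le_rfl).continuousOn.continuousAt
    hV).const_smul a).add (((hpl.smooth_normal.fderiv_of_isOpen hpl.isOpen (m := ∞)
      le_rfl).continuousOn.continuousAt hV).const_smul b)
  rw [← z.eventually_nhds' _ hpz]
  filter_upwards [hV, hcont.eventually_ne h0] with w hw hne
  exact mt (h.dmap_symm_smul_add_smul_eq_zero_iff hU hz hw a b).1 hne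

end IsFrontOn

theorem continuousAt_vol {X : Type*} [TopologicalSpace X] {F N x y : X → R41} {w : X}
    (hF : ContinuousAt F w) (hN : ContinuousAt N w) (hx : ContinuousAt x w)
    (hy : ContinuousAt y w) : ContinuousAt (fun w => vol (F w) (N w) (x w) (y w)) w := by
  rw [continuousAt_pi] at hF hN hx hy
  simp only [vol_eq]
  fun_prop (disch := assumption)

theorem PlaneFront.eventually_not_isLW {F N : ℂ → R41} {V : Set ℂ} {w : ℂ}
    (h : PlaneFront F N V) (hw : w ∈ V) {α β : ℝ}
    (h0 : ¬ IsLW α β (F w) (N w) (fderiv ℝ F w) (fderiv ℝ N w)) :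
    ∀ᶠ x in 𝓝 w, ¬ IsLW α β (F x) (N x) (fderiv ℝ F x) (fderiv ℝ N x) := by
  unfold IsLW at h0
  push Not at h0
  obtain ⟨u, v, huv⟩ := h0
  have hV := h.isOpen.mem_nhds hw
  have hF := h.smooth.continuousOn.continuousAt hV
  have hN := h.smooth_normal.continuousOn.continuousAt hV
  have hA := fun e => (contDiffOn_dirDeriv h.isOpen h.smooth e).continuousOn.continuousAt hV
  have hC := fun e => (hA e).add
    ((contDiffOn_dirDeriv h.isOpen h.smooth_normal e).continuousOn.continuousAt hV)
  have hcont := ((((continuousAt_vol hF hN (hA u) (hC v)).sub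
    (continuousAt_vol hF hN (hA v) (hC u))).const_mul α)).add
      ((continuousAt_vol hF hN (hC u) (hC v)).const_mul β)
  filter_upwards [hcont.eventually_ne huv] with x hx hLW using hx (hLW u v)

theorem IsFrontOn.eventually_not_isLWAt [IsManifold (𝓡 2) ∞ M] {f ν : M → R41} {U : Set M}
    (h : IsFrontOn f ν U) (hU : IsOpen U) {p : M} (hp : p ∈ U) {α β : ℝ}
    (h0 : ¬ IsLWAt α β f ν p) : ∀ᶠ x in 𝓝 p, ¬ IsLWAt α β f ν x := by
  obtain ⟨z, hpz, hw, hz⟩ := exists_isSmoothCoord hp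
  rw [← z.left_inv hpz, h.isLWAt_symm_iff hU hz hw] at h0
  have hpl := h.planeFront hU hz
  rw [← z.eventually_nhds' _ hpz]
  filter_upwards [hpl.isOpen.mem_nhds hw, hpl.eventually_not_isLW hw h0] with w hw hne
  exact mt (h.isLWAt_symm_iff hU hz hw α β).1 hne

end Manifold

/-! ### Curvature relations and parallel fronts -/

theorem sq_zero_lt_sq_zero_of_orthoPair {F N : R41} (h : OrthoPair F N) : N 0 ^ 2 < F 0 ^ 2 := by
  have hF := h.timelike
  have hN := h.spacelike
  have hFN := h.orth
  simp only [lor] at hF hN hFN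
  have hlagrange : F 0 ^ 2 - N 0 ^ 2 = 1 + (F 1 * N 2 - F 2 * N 1) ^ 2
      + (F 1 * N 3 - F 3 * N 1) ^ 2 + (F 2 * N 3 - F 3 * N 2) ^ 2 := by
    linear_combination (-(N 1 ^ 2 + N 2 ^ 2 + N 3 ^ 2)) * hF + (1 - F 0 ^ 2) * hN
      + (F 1 * N 1 + F 2 * N 2 + F 3 * N 3 + F 0 * N 0) * hFN
  linarith [sq_nonneg (F 1 * N 2 - F 2 * N 1), sq_nonneg (F 1 * N 3 - F 3 * N 1),
    sq_nonneg (F 2 * N 3 - F 3 * N 2)]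

theorem cosh_smul_add_sinh_smul_mem_H3 {F N : R41} (hF : F ∈ H3) (h : OrthoPair F N) (δ : ℝ) :
    Real.cosh δ • F + Real.sinh δ • N ∈ H3 := by
  have hcs := Real.cosh_sq_sub_sinh_sq δ
  refine ⟨?_, ?_⟩
  · simp only [lor_add_left, lor_add_right, lor_smul_left, lor_smul_right, h.timelike, h.spacelike,
      h.orth, lor_comm N F]
    linarith
  · have hsq : (Real.sinh δ * N 0) ^ 2 < (Real.cosh δ * F 0) ^ 2 := by
      have hlt := sq_zero_lt_sq_zero_of_orthoPair h
      nlinarith [mul_le_mul_of_nonneg_left hlt.le (sq_nonneg (Real.sinh δ)), pow_pos hF.2 2]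
    have habs := abs_lt_of_sq_lt_sq hsq (mul_pos (Real.cosh_pos δ) hF.2).le
    simp only [Pi.add_apply, Pi.smul_apply, smul_eq_mul]
    linarith [(abs_lt.1 habs).1]

/-- The basis of `EuclideanSpace ℝ (Fin 2)` formed by the vectors `tvec i`. -/
def tvecBasis : Module.Basis (Fin 2) ℝ (EuclideanSpace ℝ (Fin 2)) :=
  (EuclideanSpace.basisFun (Fin 2) ℝ).toBasis

namespace IsFrontOn

variable {M : Type*} [TopologicalSpace M] [ChartedSpace (EuclideanSpace ℝ (Fin 2)) M]
  {f ν : M → R41} {U : Set M}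

theorem orthoPair (h : IsFrontOn f ν U) {p : M} (hp : p ∈ U) : OrthoPair (f p) (ν p) :=
  ⟨(h.mem_H3 p hp).1, h.unit p hp, h.orth p hp⟩

theorem dmap_parallel (h : IsFrontOn f ν U) (hU : IsOpen U) {p : M} (hp : p ∈ U) (δ : ℝ) :
    dmap (parallel f ν δ) p = Real.cosh δ • dmap f p + Real.sinh δ • dmap ν p :=
  dmap_smul_add_smul (h.contMDiffAt hU hp) (h.contMDiffAt_normal hU hp) _ _

theorem dmap_parallelNormal (h : IsFrontOn f ν U) (hU : IsOpen U) {p : M} (hp : p ∈ U) (δ : ℝ) :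
    dmap (parallelNormal f ν δ) p = Real.cosh δ • dmap ν p + Real.sinh δ • dmap f p :=
  dmap_smul_add_smul (h.contMDiffAt_normal hU hp) (h.contMDiffAt hU hp) _ _

theorem dmap_parallel_add (h : IsFrontOn f ν U) (hU : IsOpen U) {p : M} (hp : p ∈ U) (δ : ℝ) :
    dmap (parallel f ν δ) p + dmap (parallelNormal f ν δ) p
      = Real.exp δ • (dmap f p + dmap ν p) := by
  rw [h.dmap_parallel hU hp, h.dmap_parallelNormal hU hp, ← Real.cosh_add_sinh]
  module

theorem isLWAt_parallel_iff (h : IsFrontOn f ν U) (hU : IsOpen U) {p : M} (hp : p ∈ U)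
    (δ α β : ℝ) : IsLWAt α β (LWFront.parallel f ν δ) (parallelNormal f ν δ) p ↔
      IsLWAt α (α * (Real.exp (2 * δ) - 1) + β * Real.exp (2 * δ)) f ν p := by
  have hexp : Real.exp (2 * δ) = (Real.cosh δ + Real.sinh δ) ^ 2 := by
    rw [Real.cosh_add_sinh, ← Real.exp_nat_mul]; norm_num
  rw [IsLWAt, h.dmap_parallel hU hp, h.dmap_parallelNormal hU hp, hexp]
  exact isLW_parallel_iff (Real.cosh_sq_sub_sinh_sq δ) α β

section IsManifold

variable [IsManifold (𝓡 2) ∞ M]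

theorem parallel (h : IsFrontOn f ν U) (hU : IsOpen U) (δ : ℝ) :
    IsFrontOn (parallel f ν δ) (parallelNormal f ν δ) U := by
  have hjet : ∀ p ∈ U, FrontJet (LWFront.parallel f ν δ p) (parallelNormal f ν δ p)
      (dmap (LWFront.parallel f ν δ) p) (dmap (parallelNormal f ν δ) p) := fun p hp => by
    rw [h.dmap_parallel hU hp, h.dmap_parallelNormal hU hp]
    exact (h.frontJet hU hp).parallel (Real.cosh_sq_sub_sinh_sq δ)
  have hsmul : ∀ c : ℝ, ContMDiff 𝓘(ℝ, R41) 𝓘(ℝ, R41) ∞ fun x : R41 => c • x := fun c =>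
    (contDiff_id.const_smul c).contMDiff
  exact
    { smooth := ((hsmul _).comp_contMDiffOn h.smooth).add
        ((hsmul _).comp_contMDiffOn h.smooth_normal)
      smooth_normal := ((hsmul _).comp_contMDiffOn h.smooth_normal).add
        ((hsmul _).comp_contMDiffOn h.smooth)
      mem_H3 := fun p hp => cosh_smul_add_sinh_smul_mem_H3 (h.mem_H3 p hp) (h.orthoPair hp) δ
      unit := fun p hp => (hjet p hp).pair.spacelike
      orth := fun p hp => (hjet p hp).pair.orth
      normal := fun p hp v => by rw [lor_comm]; exact ((hjet p hp).perp v).2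
      immersion := fun p hp => (hjet p hp).imm }

theorem curvature_relation_iff (h : IsFrontOn f ν U) (hU : IsOpen U) {p : M} (hp : p ∈ U)
    (hreg : IsRegularAt f p) (a b : ℝ) :
    a * (meanCurv f ν p - 1) + b * gaussCurv f ν p = 0 ↔ IsLWAt (a / 2 + b) (-b) f ν p := by
  have hb : ∀ i, tvecBasis i = tvec i := fun i => by simp [tvecBasis, tvec]
  have hjet := (h.frontJet hU hp).curvature_relation_iff tvecBasis hreg a b
  simp only [hb] at hjet
  exact hjet

theorem weingartenRel_iff (h : IsFrontOn f ν U) (hU : IsOpen U) (ε : ℝ) :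
    WeingartenRel ε f ν U ↔ ∀ p ∈ U, IsRegularAt f p → IsLWAt 1 (ε - 1) f ν p := by
  refine forall₂_congr fun p hp => forall_congr' fun hreg => ?_
  rw [h.curvature_relation_iff hU hp hreg, show 2 * ε / 2 + (1 - ε) = 1 by ring, neg_sub]

theorem meanCurv_eq_one_iff (h : IsFrontOn f ν U) (hU : IsOpen U) {p : M} (hp : p ∈ U)
    (hreg : IsRegularAt f p) : meanCurv f ν p = 1 ↔ IsLWAt 1 0 f ν p := by
  simpa [sub_eq_zero] using h.curvature_relation_iff hU hp hreg 2 0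

theorem not_isRegularAt_iff (h : IsFrontOn f ν U) (hU : IsOpen U) {p : M} (hp : p ∈ U)
    (hr : IsLWAt 1 0 f ν p) : ¬ IsRegularAt f p ↔ dmap f p = 0 :=
  (h.frontJet hU hp).not_injective_iff hr

end IsManifold

/-! ### Conformal coordinates and the Hopf differential -/

variable {z : OpenPartialHomeomorph M ℂ}

theorem planeFront_target (h : IsFrontOn f ν U) (hU : IsOpen U) (hz : IsConformalCoord z f)
    (hzU : z.source ⊆ U) : PlaneFront (f ∘ z.symm) (ν ∘ z.symm) z.target :=
  (h.planeFront hU hz.isSmoothCoord).mono z.open_target fun _ hw => ⟨hw, hzU (z.map_target hw)⟩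

theorem hopf_eq_planeHopf (h : IsFrontOn f ν U) (hU : IsOpen U) (hz : IsConformalCoord z f)
    (hzU : z.source ⊆ U) {w : ℂ} (hw : w ∈ z.target) :
    hopf z f ν w = planeHopf (f ∘ z.symm) (ν ∘ z.symm) w := by
  have hpl := h.planeFront_target hU hz hzU
  have hsymm : lor (dy z f w) (dx z ν w) = lor (dx z f w) (dy z ν w) :=
    (hpl.frontJet hw).symm Complex.I 1
  rw [planeHopf, lorC_dz_dz (hpl.differentiableAt hw) (hpl.differentiableAt_normal hw), hopf]
  simp only [dirDeriv, dx, dy] at hsymm ⊢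
  rw [hsymm]
  push_cast
  ring

theorem isLW_of_mem_target (h : IsFrontOn f ν U) (hU : IsOpen U) (hr : ∀ p ∈ U, IsLWAt 1 0 f ν p)
    (hz : IsConformalCoord z f) (hzU : z.source ⊆ U) {w : ℂ} (hw : w ∈ z.target) :
    IsLW 1 0 ((f ∘ z.symm) w) ((ν ∘ z.symm) w) (fderiv ℝ (f ∘ z.symm) w)
      (fderiv ℝ (ν ∘ z.symm) w) :=
  (h.isLWAt_symm_iff hU hz.isSmoothCoord ⟨hw, hzU (z.map_target hw)⟩ 1 0).1
    (hr _ (hzU (z.map_target hw)))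

theorem differentiableOn_hopf (h : IsFrontOn f ν U) (hU : IsOpen U)
    (hr : ∀ p ∈ U, IsLWAt 1 0 f ν p) (hz : IsConformalCoord z f) (hzU : z.source ⊆ U) :
    DifferentiableOn ℂ (hopf z f ν) z.target :=
  ((h.planeFront_target hU hz hzU).differentiableOn_planeHopf
    (fun _ hw => h.isLW_of_mem_target hU hr hz hzU hw)
    fun w hw => ⟨hz.norm_eq w hw, hz.orth w hw⟩).congr
      fun _ hw => h.hopf_eq_planeHopf hU hz hzU hw

theorem hopf_eq_zero_iff (h : IsFrontOn f ν U) (hU : IsOpen U) (hr : ∀ p ∈ U, IsLWAt 1 0 f ν p)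
    (hz : IsConformalCoord z f) (hzU : z.source ⊆ U) {p : M} (hp : p ∈ z.source) :
    hopf z f ν (z p) = 0 ↔ dmap f p = 0 ∨ dmap f p + dmap ν p = 0 := by
  have hw := z.map_source hp
  have hpU : z p ∈ z.target ∩ z.symm ⁻¹' U := ⟨hw, hzU (z.map_target hw)⟩
  have hA := h.dmap_symm_smul_add_smul_eq_zero_iff hU hz.isSmoothCoord hpU 1 0
  have hC := h.dmap_symm_smul_add_smul_eq_zero_iff hU hz.isSmoothCoord hpU 1 1
  simp only [one_smul, zero_smul, add_zero, z.left_inv hp] at hA hC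
  rw [h.hopf_eq_planeHopf hU hz hzU hw, hA, hC]
  exact (h.planeFront_target hU hz hzU).planeHopf_eq_zero_iff hw
    (h.isLW_of_mem_target hU hr hz hzU hw) fun w hw => ⟨hz.norm_eq w hw, hz.orth w hw⟩

variable [IsManifold (𝓡 2) ∞ M]

theorem exists_isConformalCoord (h : IsFrontOn f ν U) (hU : IsOpen U)
    (hr : ∀ p ∈ U, IsLWAt 1 0 f ν p) {p : M} (hp : p ∈ U) :
    ∃ z : OpenPartialHomeomorph M ℂ, p ∈ z.source ∧ z.source ⊆ U ∧ IsConformalCoord z f := by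
  obtain ⟨z, hpz, hw, hz⟩ := exists_isSmoothCoord hp
  obtain ⟨e, hwe, he⟩ := (h.planeFront hU hz).exists_isPlaneConformalChart
    (fun w hw => (h.isLWAt_symm_iff hU hz hw 1 0).1 (hr _ hw.2)) hw
  have hze := hz.trans he.smooth he.smooth_symm
  have htarget : (z.trans e).target ⊆ e.target := by
    rw [OpenPartialHomeomorph.trans_target]
    exact Set.inter_subset_left
  refine ⟨z.trans e, ?_, fun x hx => ?_, hze.smooth, hze.smooth_symm,
    fun w hw => (he.conformal w (htarget hw)).1, fun w hw => (he.conformal w (htarget hw)).2⟩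
  · rw [OpenPartialHomeomorph.trans_source]
    exact ⟨hpz, hwe⟩
  · rw [OpenPartialHomeomorph.trans_source] at hx
    have hxU := (he.source_subset hx.2).2
    rwa [Set.mem_preimage, z.left_inv hx.1] at hxU

theorem eventually_or_eventually_not (h : IsFrontOn f ν U) (hU : IsOpen U)
    (hr : ∀ p ∈ U, IsLWAt 1 0 f ν p) {p : M} (hp : p ∈ U) :
    (∀ᶠ x in 𝓝 p, dmap f x = 0 ∨ dmap f x + dmap ν x = 0) ∨
      ∀ᶠ x in 𝓝[≠] p, ¬ (dmap f x = 0 ∨ dmap f x + dmap ν x = 0) := by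
  obtain ⟨z, hpz, hzU, hz⟩ := h.exists_isConformalCoord hU hr hp
  have hanalytic := (h.differentiableOn_hopf hU hr hz hzU).analyticAt
    (z.open_target.mem_nhds (z.map_source hpz))
  have hsource := z.open_source.mem_nhds hpz
  rcases hanalytic.eventually_eq_zero_or_eventually_ne_zero with h0 | h0
  · left
    filter_upwards [hsource, (z.continuousAt hpz).eventually h0] with x hx hq
    exact (h.hopf_eq_zero_iff hU hr hz hzU hx).1 hq
  · right
    rw [eventually_nhdsWithin_iff] at h0 ⊢
    filter_upwards [hsource, (z.continuousAt hpz).eventually h0] with x hx hq hxp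
    rw [← h.hopf_eq_zero_iff hU hr hz hzU hx]
    exact hq (mt (z.injOn hx hpz) hxp)

end IsFrontOn

/-! ### Regular points and the choice of the unit normal -/

section Pointwise

open ContinuousLinearMap

variable {E : Type*} [NormedAddCommGroup E] [NormedSpace ℝ E] {F N : R41} {A B : E →L[ℝ] R41}
  {ε : ℝ}

theorem IsLW.vol_eq_of_neg (hε : ε ≠ 0) (h : IsLW 1 (ε - 1) F N A B)
    (h' : IsLW 1 (ε - 1) F (-N) A (-B)) (u v : E) :
    vol F N (A u) (B v) = vol F N (A v) (B u) ∧
      (1 + ε) * vol F N (A u) (A v) + (ε - 1) * vol F N (B u) (B v) = 0 := by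
  have hpos := h u v
  have hneg := h' u v
  rw [neg_apply, neg_apply, ← neg_one_smul ℝ (B u), ← neg_one_smul ℝ (B v)] at hneg
  simp only [vol_add_left, vol_add_right, vol_smul_left, vol_smul_right, vol_neg_normal,
    vol_swap F N (A v) (A u), vol_swap F N (B u) (A v)] at hpos hneg
  exact ⟨mul_left_cancel₀ hε (by linarith), by linarith⟩

namespace FrontJet

theorem lor_mul_vol_add (h : FrontJet F N A B) {u v : E}
    (hvol : vol F N (A u) (B v) = vol F N (A v) (B u)) :
    lor (A u) (A u) * vol F N (B u) (B v) + lor (B u) (B u) * vol F N (A u) (A v) = 0 := by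
  obtain ⟨κ, hκ⟩ := h.pair.exists_tangentChart
  have hsymm := h.symm u v
  rw [hκ.vol_eq_im (h.perp u) (h.perp_normal v), hκ.vol_eq_im (h.perp v) (h.perp_normal u)] at hvol
  rw [hκ.lor_eq_re (h.perp u) (h.perp_normal v), hκ.lor_eq_re (h.perp v) (h.perp_normal u)]
    at hsymm
  rw [hκ.lor_eq_re (h.perp u) (h.perp u), hκ.vol_eq_im (h.perp_normal u) (h.perp_normal v),
    hκ.lor_eq_re (h.perp_normal u) (h.perp_normal u), hκ.vol_eq_im (h.perp u) (h.perp v)]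
  simp only [Complex.mul_re, Complex.mul_im, Complex.conj_re, Complex.conj_im] at hvol hsymm ⊢
  linear_combination
    ((κ (A u)).re * (κ (B u)).re + (κ (A u)).im * (κ (B u)).im) * hvol
    + ((κ (B u)).re * (κ (A u)).im - (κ (B u)).im * (κ (A u)).re) * hsymm

theorem one_lt_of_isLW_neg (h : FrontJet F N A B) (b : Module.Basis (Fin 2) ℝ E)
    (hA : Function.Injective A) (hε : 0 < ε) (hr : IsLW 1 (ε - 1) F N A B)
    (hr' : IsLW 1 (ε - 1) F (-N) A (-B)) : 1 < ε := by
  obtain ⟨hvol, hrel⟩ := hr.vol_eq_of_neg hε.ne' hr' (b 0) (b 1)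
  have hd := (h.pair.injective_iff b h.perp).1 hA
  have hA0 : A (b 0) ≠ 0 := fun h0 => hd (by rw [h0, vol_zero_left])
  have hquot :
      (1 + ε) * lor (A (b 0)) (A (b 0)) - (ε - 1) * lor (B (b 0)) (B (b 0)) = 0 := by
    refine (mul_eq_zero.1 (?_ : vol F N (A (b 0)) (A (b 1)) * _ = 0)).resolve_left hd
    linear_combination lor (A (b 0)) (A (b 0)) * hrel - (ε - 1) * h.lor_mul_vol_add hvol
  have hpos := mul_pos (by linarith : 0 < 1 + ε) (h.pair.lor_self_pos (h.perp (b 0)) hA0)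
  by_contra! hle
  linarith [mul_nonpos_of_nonpos_of_nonneg (sub_nonpos.2 hle)
    (lor_self_nonneg_of_timelike h.pair.timelike (h.perp_normal (b 0)).1).1]

end FrontJet

theorem OrthoPair.eq_or_eq_neg {N' x y : R41} (h : OrthoPair F N) (h' : OrthoPair F N')
    (hx : Perp F N x) (hy : Perp F N y) (hx' : Perp F N' x) (hy' : Perp F N' y)
    (hxy : vol F N x y ≠ 0) : N' = N ∨ N' = -N := by
  let t := lor N N'
  let r := N' + -t • N
  have hr : Perp F N r := by
    constructor <;> simp [r, t, h.orth, h'.orth, h.spacelike]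
  have hxr : lor x r = 0 := by simp [r, lor_comm x, hx.2, hx'.2]
  have hyr : lor y r = 0 := by simp [r, lor_comm y, hy.2, hy'.2]
  have hvol : vol F N x r = 0 := by
    have hmul := h.vol_mul_vol hx hy hx hr
    rw [hxr, hyr, mul_zero, zero_mul, sub_zero] at hmul
    exact (mul_eq_zero.1 hmul).resolve_left hxy
  have hr0 : r = 0 := (h.eq_zero_or_eq_zero hx hr hxr hvol).resolve_left
    fun h0 => hxy (by rw [h0, vol_zero_left])
  have hN' : N' = t • N := by
    rw [← sub_eq_zero, sub_eq_add_neg, ← neg_smul]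
    exact hr0
  have ht : t * t = 1 := by
    simpa [hN', h.spacelike] using h'.spacelike
  rcases mul_self_eq_one_iff.1 ht with ht | ht
  · left; rw [hN', ht, one_smul]
  · right; rw [hN', ht, neg_one_smul]

end Pointwise

section Regular

variable {M : Type*} [TopologicalSpace M] [ChartedSpace (EuclideanSpace ℝ (Fin 2)) M]
  {f ν : M → R41}

theorem dmap_neg (p : M) : dmap (fun x => -ν x) p = -dmap ν p :=
  mfderiv_neg

variable [IsManifold (𝓡 2) ∞ M] {U : Set M} {ε : ℝ}

namespace IsFrontOn

theorem cartan (h : IsFrontOn f ν U) (hU : IsOpen U) (hne : U.Nonempty) {p₁ q₁ p₂ q₂ : ℝ}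
    (hdet : p₁ * q₂ - p₂ * q₁ ≠ 0)
    (h₁ : ∀ x ∈ U, ∀ u v, vol (f x) (ν x) ((p₁ • dmap f x + q₁ • dmap ν x) u)
      ((p₁ • dmap f x + q₁ • dmap ν x) v) = 0)
    (h₂ : ∀ x ∈ U, ∀ u v, vol (f x) (ν x) ((p₂ • dmap f x + q₂ • dmap ν x) u)
      ((p₂ • dmap f x + q₂ • dmap ν x) v) = 0) :
    q₁ * q₂ - p₁ * p₂ = 0 := by
  obtain ⟨p, hp⟩ := hne
  obtain ⟨z, -, hw, hz⟩ := exists_isSmoothCoord hp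
  have htransfer : ∀ a b : ℝ, (∀ x ∈ U, ∀ u v, vol (f x) (ν x)
      ((a • dmap f x + b • dmap ν x) u) ((a • dmap f x + b • dmap ν x) v) = 0) →
      ∀ w ∈ z.target ∩ z.symm ⁻¹' U, ∀ u v, vol ((f ∘ z.symm) w) ((ν ∘ z.symm) w)
        ((a • fderiv ℝ (f ∘ z.symm) w + b • fderiv ℝ (ν ∘ z.symm) w) u)
        ((a • fderiv ℝ (f ∘ z.symm) w + b • fderiv ℝ (ν ∘ z.symm) w) v) = 0 := by
    intro a b hab w hw u v
    obtain ⟨T, hT⟩ := hz.exists_dmap_eq_comp hw.1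
    have hvol := hab _ hw.2 (T.symm u) (T.symm v)
    rw [hT f (h.contMDiffAt hU hw.2), hT ν (h.contMDiffAt_normal hU hw.2)] at hvol
    simpa using hvol
  exact (h.planeFront hU hz).cartan ⟨_, hw⟩ hdet (htransfer _ _ h₁) (htransfer _ _ h₂)

theorem exists_isRegularAt_of_isLWAt (h : IsFrontOn f ν U) (hU : IsOpen U) (hne : U.Nonempty)
    (hε : ε ≠ 0) (hε1 : ε ≠ 1) (hr : ∀ p ∈ U, IsLWAt 1 (ε - 1) f ν p) :
    ∃ p ∈ U, IsRegularAt f p := by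
  by_contra! hsing
  have hA : ∀ p ∈ U, ∀ u v, vol (f p) (ν p) (dmap f p u) (dmap f p v) = 0 := fun p hp =>
    (h.orthoPair hp).vol_eq_zero_of_not_injective tvecBasis (h.frontJet hU hp).perp (hsing p hp)
  have hcartan := h.cartan hU hne (p₁ := 1) (q₁ := 0) (p₂ := -ε) (q₂ := 1 - ε)
    (by simpa [sub_eq_zero] using hε1.symm) (fun p hp u v => by simpa using hA p hp u v)
    fun p hp u v => by
      have hrel := hr p hp u v
      simp only [vol_add_left, vol_add_right] at hrel
      simp only [add_apply, smul_apply, vol_add_left,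
        vol_add_right, vol_smul_left, vol_smul_right]
      rw [vol_swap _ _ (dmap f p v) (dmap f p u), vol_swap _ _ (dmap f p v) (dmap ν p u)] at hrel
      linear_combination (ε - 1) * hrel + hA p hp u v
  exact hε (by linarith)

theorem not_forall_isLWAt_neg (h : IsFrontOn f ν U) (hU : IsOpen U) (hne : U.Nonempty)
    (hε : 0 < ε) (hreg : ∀ p ∈ U, IsRegularAt f p) (hr : ∀ p ∈ U, IsLWAt 1 (ε - 1) f ν p) :
    ¬ ∀ p ∈ U, IsLWAt 1 (ε - 1) f (fun x => -ν x) p := by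
  intro hr'
  have hvol : ∀ p ∈ U, _ := fun p hp =>
    (hr p hp).vol_eq_of_neg hε.ne' (by rw [← dmap_neg]; exact hr' p hp)
  have hε1 : 1 < ε := by
    obtain ⟨p, hp⟩ := hne
    exact (h.frontJet hU hp).one_lt_of_isLW_neg tvecBasis (hreg p hp) hε (hr p hp)
      (by rw [← dmap_neg]; exact hr' p hp)
  -- `c² A ∧ A + B ∧ B = 0` makes both one-forms `B ± c A` degenerate
  let c := √((ε + 1) / (ε - 1))
  have hc : 0 < c := Real.sqrt_pos.2 (div_pos (by linarith) (by linarith))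
  have hc2 : c ^ 2 * (ε - 1) = ε + 1 := by
    rw [Real.sq_sqrt (div_nonneg (by linarith) (by linarith)), div_mul_cancel₀]
    linarith
  have hdegenerate : ∀ d : ℝ, d ^ 2 = c ^ 2 → ∀ p ∈ U, ∀ u v, vol (f p) (ν p)
      ((d • dmap f p + (1 : ℝ) • dmap ν p) u) ((d • dmap f p + (1 : ℝ) • dmap ν p) v) = 0 := by
    intro d hd p hp u v
    obtain ⟨hAB, hAA⟩ := hvol p hp u v
    refine (mul_eq_zero.1 (?_ : (ε - 1) * _ = 0)).resolve_left (by linarith)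
    simp only [add_apply, smul_apply, vol_add_left,
      vol_add_right, vol_smul_left, vol_smul_right]
    rw [vol_swap _ _ (dmap ν p u) (dmap f p v)]
    linear_combination hAA + (ε - 1) * d * hAB
      + vol (f p) (ν p) (dmap f p u) (dmap f p v) * ((ε - 1) * hd + hc2)
  have hcartan := h.cartan hU hne (p₁ := c) (q₁ := 1) (p₂ := -c) (q₂ := 1) (by linarith)
    (hdegenerate c rfl) (hdegenerate (-c) (by ring))
  linarith [sq_nonneg c]

variable {ν' : M → R41} {U' : Set M}

theorem normal_eq_of_isRegularAt (hε : 0 < ε) (h : IsFrontOn f ν U) (hU : IsOpen U)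
    (hw : WeingartenRel ε f ν U) (h' : IsFrontOn f ν' U') (hU' : IsOpen U')
    (hw' : WeingartenRel ε f ν' U') {p : M} (hp : p ∈ U) (hp' : p ∈ U')
    (hreg : IsRegularAt f p) : ν' p = ν p := by
  have hcases : ∀ x ∈ U, x ∈ U' → IsRegularAt f x → ν' x = ν x ∨ ν' x = -ν x :=
    fun x hx hx' hreg =>
      have hjet := h.frontJet hU hx
      have hjet' := h'.frontJet hU' hx'
      hjet.pair.eq_or_eq_neg hjet'.pair (hjet.perp _) (hjet.perp _) (hjet'.perp _) (hjet'.perp _)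
        ((hjet.pair.injective_iff tvecBasis hjet.perp).1 hreg)
  by_contra hne
  have hneg : ∀ᶠ x in 𝓝 p, (x ∈ U ∧ x ∈ U') ∧ IsRegularAt f x ∧ ν' x = -ν x := by
    filter_upwards [hU.mem_nhds hp, hU'.mem_nhds hp', h.eventually_isRegularAt hU hp hreg,
      ((h'.contMDiffAt_normal hU' hp').continuousAt.ne_iff_eventually_ne
        (h.contMDiffAt_normal hU hp).continuousAt).1 hne] with x hx hx' hxreg hxne
    exact ⟨⟨hx, hx'⟩, hxreg, (hcases x hx hx' hxreg).resolve_left hxne⟩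
  obtain ⟨S, hS, hSo, hpS⟩ := mem_nhds_iff.1 hneg
  refine (h.mono fun x hx => (hS hx).1.1).not_forall_isLWAt_neg hSo ⟨p, hpS⟩ hε
    (fun x hx => (hS hx).2.1)
    (fun x hx => (h.weingartenRel_iff hU ε).1 hw x (hS hx).1.1 (hS hx).2.1) fun x hx => ?_
  have hrel := (h'.weingartenRel_iff hU' ε).1 hw' x (hS hx).1.2 (hS hx).2.1
  have heq : ν' =ᶠ[𝓝 x] fun x => -ν x := by
    filter_upwards [hSo.mem_nhds hx] with y hy using (hS hy).2.2
  have hdmap : dmap ν' x = dmap (fun x => -ν x) x := heq.mfderiv_eq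
  rwa [IsLWAt, hdmap, heq.eq_of_nhds] at hrel

theorem normal_eq (hε : 0 < ε) (hdense : Dense {x | IsRegularAt f x}) (h : IsFrontOn f ν U)
    (hU : IsOpen U) (hw : WeingartenRel ε f ν U) (h' : IsFrontOn f ν' U') (hU' : IsOpen U')
    (hw' : WeingartenRel ε f ν' U') {p : M} (hp : p ∈ U) (hp' : p ∈ U') : ν' p = ν p := by
  by_contra hne
  have hev : ∀ᶠ x in 𝓝 p, ν' x ≠ ν x ∧ x ∈ U ∧ x ∈ U' :=
    (((h'.contMDiffAt_normal hU' hp').continuousAt.ne_iff_eventually_ne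
      (h.contMDiffAt_normal hU hp).continuousAt).1 hne).and
        (Filter.eventually_and.2 ⟨hU.mem_nhds hp, hU'.mem_nhds hp'⟩)
  obtain ⟨x, hreg, hx, hxU, hxU'⟩ :=
    ((mem_closure_iff_frequently.1 (hdense p)).and_eventually hev).exists
  exact hx (h.normal_eq_of_isRegularAt hε hU hw h' hU' hw' hxU hxU' hreg)

end IsFrontOn

end Regular

/-! ### Density of the regular points -/

section Density

variable {M : Type*} [TopologicalSpace M] [ChartedSpace (EuclideanSpace ℝ (Fin 2)) M]
  {f ν : M → R41} {U : Set M}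

theorem IsFrontOn.congr_normal {ν' : M → R41} (h : IsFrontOn f ν U) (hU : IsOpen U)
    (hν : Set.EqOn ν' ν U) : IsFrontOn f ν' U := by
  have hd : ∀ p ∈ U, dmap ν' p = dmap ν p := fun p hp =>
    (hν.eventuallyEq_of_mem (hU.mem_nhds hp)).mfderiv_eq
  exact ⟨h.smooth, h.smooth_normal.congr hν, h.mem_H3, fun p hp => by rw [hν hp, h.unit p hp],
    fun p hp => by rw [hν hp, h.orth p hp], fun p hp => by rw [hν hp]; exact h.normal p hp,
    fun p hp => by rw [hd p hp]; exact h.immersion p hp⟩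

variable [IsManifold (𝓡 2) ∞ M] {ε : ℝ}

namespace IsFrontOn

theorem exists_isLWAt (h : IsFrontOn f ν U) (hU : IsOpen U) {δ : ℝ}
    (hi : IsHLWImmersionOn (LWFront.parallel f ν δ) (parallelNormal f ν δ) U) :
    ∃ α β : ℝ, (α ≠ 0 ∨ β ≠ 0) ∧ ∀ p ∈ U, IsLWAt α β f ν p := by
  obtain ⟨hreg, a, b, hab, hr⟩ := hi
  refine ⟨a / 2 + b, (a / 2 + b) * (Real.exp (2 * δ) - 1) + -b * Real.exp (2 * δ), ?_,
    fun p hp => (h.isLWAt_parallel_iff hU hp δ _ _).1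
      (((h.parallel hU δ).curvature_relation_iff hU hp (hreg p hp) a b).1 (hr p hp))⟩
  by_contra! h0
  have hb : b = 0 := by
    rw [h0.1, zero_mul, zero_add, mul_eq_zero_iff_right (Real.exp_ne_zero _)] at h0
    exact neg_eq_zero.1 h0.2
  have ha : a = 0 := by simpa [hb] using h0.1
  exact hab (by simp [ha, hb])

theorem mem_closure_isRegularAt (h : IsFrontOn f ν U) (hU : IsOpen U) (hε : ε ≠ 0) (hε1 : ε ≠ 1)
    (hr : ∀ p ∈ U, IsLWAt 1 (ε - 1) f ν p) {p : M} (hp : p ∈ U) :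
    p ∈ closure {x | IsRegularAt f x} := by
  refine mem_closure_iff.2 fun S hS hpS => ?_
  obtain ⟨x, hx, hreg⟩ := (h.mono Set.inter_subset_right).exists_isRegularAt_of_isLWAt
    (hS.inter hU) ⟨p, hpS, hp⟩ hε hε1 fun x hx => hr x hx.2
  exact ⟨x, hx.1, hreg⟩

theorem eventually_nhdsNE_isRegularAt (h : IsFrontOn f ν U) (hU : IsOpen U)
    (hr : ∀ p ∈ U, IsLWAt 1 0 f ν p) {p : M} (hp : p ∈ U)
    (hd : p ∈ closure {x | IsRegularAt f x}) : ∀ᶠ x in 𝓝[≠] p, IsRegularAt f x := by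
  have hsing : ∀ x ∈ U, ¬ IsRegularAt f x ↔ dmap f x = 0 := fun x hx =>
    h.not_isRegularAt_iff hU hx (hr x hx)
  by_cases hreg : IsRegularAt f p
  · exact (h.eventually_isRegularAt hU hp hreg).filter_mono nhdsWithin_le_nhds
  rcases h.eventually_or_eventually_not hU hr hp with hzero | hzero
  · have hC : (1 : ℝ) • dmap f p + (1 : ℝ) • dmap ν p ≠ 0 := by
      rw [one_smul, one_smul]
      exact mt (h.isRegularAt_of_dmap_add_eq_zero hp) hreg
    refine absurd ?_ (mem_closure_iff_frequently.1 hd)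
    filter_upwards [hzero, h.eventually_dmap_smul_add_smul_ne_zero hU hp hC, hU.mem_nhds hp]
      with x hx hCx hxU
    rw [one_smul, one_smul] at hCx
    exact (hsing x hxU).2 (hx.resolve_right hCx)
  · filter_upwards [hzero, nhdsWithin_le_nhds (hU.mem_nhds hp)] with x hx hxU
    exact not_not.1 fun hxs => hx (.inl ((hsing x hxU).1 hxs))

theorem isRegularAt_of_mem_closure (h : IsFrontOn f ν U) (hU : IsOpen U) {α β α' β' : ℝ}
    (hdet : α * β' - β * α' ≠ 0) (hr : ∀ p ∈ U, IsLWAt α β f ν p)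
    (hr' : ∀ p ∈ U, IsRegularAt f p → IsLWAt α' β' f ν p) {p : M} (hp : p ∈ U)
    (hd : p ∈ closure {x | IsRegularAt f x}) : IsRegularAt f p := by
  refine h.isRegularAt_of_dmap_add_eq_zero hp ?_
  by_contra hC
  rw [← one_smul ℝ (dmap f p), ← one_smul ℝ (dmap ν p)] at hC
  refine mem_closure_iff_frequently.1 hd ?_
  filter_upwards [h.eventually_dmap_smul_add_smul_ne_zero hU hp hC, hU.mem_nhds hp]
    with x hCx hx hreg
  rw [one_smul, one_smul] at hCx
  exact hCx ((h.frontJet hU hx).add_eq_zero_of_isLW tvecBasis hdet (hr x hx) (hr' x hx hreg))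

theorem eventually_mem_closure_isRegularAt (h : IsFrontOn f ν U) (hU : IsOpen U) (hε : ε ≠ 0)
    {δ : ℝ} (hi : IsHLWImmersionOn (LWFront.parallel f ν δ) (parallelNormal f ν δ) U)
    (hw : WeingartenRel ε f ν U) {p : M} (hp : p ∈ U) (hd : p ∈ closure {x | IsRegularAt f x}) :
    ∀ᶠ x in 𝓝 p, x ∈ closure {x | IsRegularAt f x} := by
  obtain ⟨α, β, hne, hr⟩ := h.exists_isLWAt hU hi
  rw [h.weingartenRel_iff hU] at hw
  by_cases hdet : α * (ε - 1) - β * 1 = 0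
  · obtain rfl : α * (ε - 1) = β := by linarith
    have hα : α ≠ 0 := by
      rintro rfl
      simp at hne
    have hr₁ : ∀ p ∈ U, IsLWAt 1 (ε - 1) f ν p := fun p hp =>
      (isLW_mul_iff hα _ _).1 (by rw [mul_one]; exact hr p hp)
    by_cases hε1 : ε = 1
    · rw [hε1, sub_self] at hr₁
      have hreg := h.eventually_nhdsNE_isRegularAt hU hr₁ hp hd
      filter_upwards [eventually_nhdsWithin_iff.1 hreg] with x hx
      by_cases hxp : x = p
      · rwa [hxp]
      · exact subset_closure (hx hxp)
    · filter_upwards [hU.mem_nhds hp] with x hx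
        using h.mem_closure_isRegularAt hU hε hε1 hr₁ hx
  · exact (h.eventually_isRegularAt hU hp (h.isRegularAt_of_mem_closure hU hdet hr hw hp hd)).mono
      fun _ hx => subset_closure hx

end IsFrontOn

theorem dense_isRegularAt [PreconnectedSpace M] (hε : ε ≠ 0) (hf : f ∈ W (M := M) ε) :
    Dense {x | IsRegularAt f x} := by
  obtain ⟨⟨p₀, hp₀⟩, hloc⟩ := hf
  have hclopen : IsClopen (closure {x | IsRegularAt f x}) := by
    refine ⟨isClosed_closure, isOpen_iff_eventually.2 fun p hp => ?_⟩
    obtain ⟨U, hU, hpU, ν, h, ⟨δ, hi⟩, hw⟩ := hloc p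
    exact h.eventually_mem_closure_isRegularAt hU hε hi hw hpU hp
  exact dense_iff_closure_eq.2 (hclopen.eq_univ ⟨p₀, subset_closure hp₀⟩)

/-! ### The global unit normal field -/

theorem exists_isWeingartenNormal (hε : 0 < ε) (hf : f ∈ W (M := M) ε)
    (hdense : Dense {x | IsRegularAt f x}) : ∃ ν, IsWeingartenNormal ε f ν := by
  have hloc : ∀ p, ∃ (U : Set M) (ν : M → R41), IsOpen U ∧ p ∈ U ∧ IsFrontOn f ν U ∧
      WeingartenRel ε f ν U := fun p => by
    obtain ⟨U, hU, hpU, ν, h, -, hw⟩ := hf.2 p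
    exact ⟨U, ν, hU, hpU, h, hw⟩
  choose U ν hU hpU h hw using hloc
  have heq : ∀ p, Set.EqOn (fun x => ν x x) (ν p) (U p) := fun p x hx =>
    (h p).normal_eq hε hdense (hU p) (hw p) (h x) (hU x) (hw x) hx (hpU x)
  have hglue : ∀ p, IsFrontOn f (fun x => ν x x) (U p) := fun p =>
    (h p).congr_normal (hU p) (heq p)
  have hfront : IsFrontOn f (fun x => ν x x) Set.univ :=
    ⟨fun p _ => ((hglue p).contMDiffAt (hU p) (hpU p)).contMDiffWithinAt,
      fun p _ => ((hglue p).contMDiffAt_normal (hU p) (hpU p)).contMDiffWithinAt,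
      fun p _ => (hglue p).mem_H3 p (hpU p), fun p _ => (hglue p).unit p (hpU p),
      fun p _ => (hglue p).orth p (hpU p), fun p _ => (hglue p).normal p (hpU p),
      fun p _ => (hglue p).immersion p (hpU p)⟩
  refine ⟨_, hfront, fun p _ hreg => ?_⟩
  have hd : dmap (fun x => ν x x) p = dmap (ν p) p :=
    ((heq p).eventuallyEq_of_mem ((hU p).mem_nhds (hpU p))).mfderiv_eq
  have hrel := hw p p (hpU p) hreg
  rw [meanCurv, gaussCurv, secondFF] at hrel ⊢
  rwa [hd]

namespace IsWeingartenNormal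

theorem unique (hε : 0 < ε) (hdense : Dense {x | IsRegularAt f x}) {ν' : M → R41}
    (h : IsWeingartenNormal ε f ν) (h' : IsWeingartenNormal ε f ν') : ν' = ν :=
  funext fun p => h.1.normal_eq hε hdense isOpen_univ h.2 h'.1 isOpen_univ h'.2
    (Set.mem_univ p) (Set.mem_univ p)

theorem isLWAt (hdense : Dense {x | IsRegularAt f x}) (h : IsWeingartenNormal ε f ν) (p : M) :
    IsLWAt 1 (ε - 1) f ν p := by
  by_contra h0
  obtain ⟨x, hreg, hx⟩ := ((mem_closure_iff_frequently.1 (hdense p)).and_eventually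
    (h.1.eventually_not_isLWAt isOpen_univ (Set.mem_univ p) h0)).exists
  exact hx ((h.1.weingartenRel_iff isOpen_univ ε).1 h.2 x (Set.mem_univ x) hreg)

end IsWeingartenNormal

end Density

/-! ### Fronts of constant mean curvature one -/

section CMC1

theorem eq_univ_or_eq_univ_or_forall_isolated {X : Type*} [TopologicalSpace X]
    [PreconnectedSpace X] {s t : Set X} (hs : IsClosed s) (ht : IsClosed t) (hst : Disjoint s t)
    (h : ∀ p, s ∪ t ∈ 𝓝 p ∨ (s ∪ t)ᶜ ∈ 𝓝[≠] p) :
    s = Set.univ ∨ t = Set.univ ∨ ∀ p, s ∪ t ∉ 𝓝 p ∧ (s ∪ t)ᶜ ∈ 𝓝[≠] p := by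
  have hclopen : IsClopen (interior (s ∪ t)) := by
    refine ⟨isOpen_compl_iff.1 (isOpen_iff_eventually.2 fun p hp => ?_), isOpen_interior⟩
    have hp' : s ∪ t ∉ 𝓝 p := mt mem_interior_iff_mem_nhds.2 hp
    filter_upwards [mem_nhdsWithin_iff_eventually.1 ((h p).resolve_left hp')] with x hx hxi
    by_cases hxp : x = p
    · exact hp (hxp ▸ hxi)
    · exact hx hxp (interior_subset hxi)
  rcases isClopen_iff.1 hclopen with hempty | huniv
  · have hp : ∀ p, s ∪ t ∉ 𝓝 p := fun p hp => by
      rw [← mem_interior_iff_mem_nhds, hempty] at hp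
      exact hp
    exact .inr (.inr fun p => ⟨hp p, (h p).resolve_left (hp p)⟩)
  · have hcompl : sᶜ = t :=
      (IsCompl.of_eq hst.eq_bot (Set.eq_univ_of_univ_subset (huniv ▸ interior_subset))).compl_eq
    rcases isClopen_iff.1 (⟨hs, isClosed_compl_iff.1 (hcompl.symm ▸ ht)⟩ : IsClopen s) with h0 | h0
    · exact .inr (.inl (by rw [← hcompl, h0, Set.compl_empty]))
    · exact .inl h0

variable {M : Type*} [TopologicalSpace M] [ChartedSpace (EuclideanSpace ℝ (Fin 2)) M]
  [IsManifold (𝓡 2) ∞ M] {f ν : M → R41} {U : Set M} {δ : ℝ}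

theorem eq_of_dmap_eq_zero [PreconnectedSpace M] {g : M → R41}
    (hg : ContMDiffOn (𝓡 2) 𝓘(ℝ, R41) ∞ g Set.univ) (h0 : ∀ p, dmap g p = 0) (p q : M) :
    g p = g q := by
  refine IsLocallyConstant.apply_eq_of_preconnectedSpace
    ((IsLocallyConstant.iff_eventually_eq g).2 fun p => ?_) p q
  obtain ⟨z, hpz, ⟨hzp, -⟩, hz⟩ := exists_isSmoothCoord (Set.mem_univ p)
  have hfderiv : ∀ w ∈ z.target, fderiv ℝ (g ∘ z.symm) w = 0 := fun w hw => by
    obtain ⟨T, hT⟩ := hz.exists_dmap_eq_comp hw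
    have hgT := hT g (hg.contMDiffAt Filter.univ_mem)
    rw [h0] at hgT
    ext1 v
    simpa using (DFunLike.congr_fun hgT (T.symm v)).symm
  have hdiff : DifferentiableOn ℝ (g ∘ z.symm) z.target := by
    simpa using (hz.contDiffOn_comp_symm hg).differentiableOn (by simp)
  have hconst : ∀ᶠ w in 𝓝 (z p), (g ∘ z.symm) w = (g ∘ z.symm) (z p) := by
    obtain ⟨r, hr, hball⟩ := Metric.isOpen_iff.1 z.open_target (z p) hzp
    filter_upwards [Metric.ball_mem_nhds (z p) hr] with w hw
    refine (convex_ball (z p) r).is_const_of_fderivWithin_eq_zero (𝕜 := ℝ) (hdiff.mono hball)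
      (fun x hx => ?_) hw (Metric.mem_ball_self hr)
    rw [fderivWithin_of_isOpen Metric.isOpen_ball hx, hfderiv x (hball hx)]
  filter_upwards [z.open_source.mem_nhds hpz, (z.continuousAt hpz).eventually hconst] with x hx hgx
  simpa [z.left_inv hx, z.left_inv hpz] using hgx

namespace IsFrontOn

omit [IsManifold (𝓡 2) ∞ M] in
theorem dmap_add (h : IsFrontOn f ν U) (hU : IsOpen U) {p : M} (hp : p ∈ U) :
    dmap (fun x => f x + ν x) p = dmap f p + dmap ν p := by
  simpa using dmap_smul_add_smul (h.contMDiffAt hU hp) (h.contMDiffAt_normal hU hp) 1 1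

theorem inGeodesicSphere_of_dmap_parallel_eq_zero [ConnectedSpace M]
    (h : IsFrontOn f ν Set.univ) (h0 : ∀ p, dmap (LWFront.parallel f ν δ) p = 0) :
    InGeodesicSphere f := by
  have hP := h.parallel isOpen_univ δ
  obtain ⟨p₀⟩ : Nonempty M := inferInstance
  refine ⟨LWFront.parallel f ν δ p₀, hP.mem_H3 p₀ (Set.mem_univ _), δ, fun p => ?_⟩
  rw [eq_of_dmap_eq_zero hP.smooth h0 p₀ p, LWFront.parallel, lor_add_right, lor_smul_right,
    lor_smul_right, (h.mem_H3 p (Set.mem_univ _)).1, h.orth p (Set.mem_univ _)]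
  ring

theorem inHorosphere_of_dmap_add_eq_zero [ConnectedSpace M] (h : IsFrontOn f ν Set.univ)
    (h0 : ∀ p, dmap f p + dmap ν p = 0) : InHorosphere f := by
  obtain ⟨p₀⟩ : Nonempty M := inferInstance
  have hconst : ∀ p, f p₀ + ν p₀ = f p + ν p := fun p =>
    eq_of_dmap_eq_zero (g := fun x => f x + ν x) (h.smooth.add h.smooth_normal)
      (fun q => (h.dmap_add isOpen_univ (Set.mem_univ q)).trans (h0 q)) p₀ p
  have hlor : ∀ p, lor (f p) (f p + ν p) = -1 := fun p => by
    rw [lor_add_right, (h.mem_H3 p (Set.mem_univ _)).1, h.orth p (Set.mem_univ _), add_zero]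
  refine ⟨f p₀ + ν p₀, fun hz => ?_, ?_, fun p => by rw [hconst p, hlor p]⟩
  · have hlor₀ := hlor p₀
    rw [hz, lor_zero_right] at hlor₀
    norm_num at hlor₀
  · rw [lor_add_left, hlor, lor_add_right, h.unit p₀ (Set.mem_univ _), lor_comm,
      h.orth p₀ (Set.mem_univ _)]
    norm_num

theorem mem_singularSet_iff_hopf (h : IsFrontOn f ν U) (hU : IsOpen U)
    (hr : ∀ p ∈ U, IsLWAt 1 0 f ν p) {z : OpenPartialHomeomorph M ℂ} (hz : IsConformalCoord z f)
    (hzU : z.source ⊆ U) {p : M} (hp : p ∈ z.source) :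
    p ∈ singularSet f ↔ hopf z f ν (z p) = 0 ∧ dmap f p + dmap ν p ≠ 0 := by
  have hsing := h.not_isRegularAt_iff hU (hzU hp) (hr p (hzU hp))
  rw [h.hopf_eq_zero_iff hU hr hz hzU hp, singularSet, Set.mem_ofPred_eq]
  refine ⟨fun hps => ⟨.inl (hsing.1 hps),
    mt (h.isRegularAt_of_dmap_add_eq_zero (hzU hp)) hps⟩, fun hq => ?_⟩
  exact hsing.2 (hq.1.resolve_right hq.2)

theorem isCMC1Front_iff (h : IsFrontOn f ν Set.univ) : IsCMC1Front f ν ↔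
    (∃ p, IsRegularAt f p) ∧ ∀ p, IsRegularAt f p → IsLWAt 1 0 f ν p := by
  rw [IsCMC1Front, and_iff_right h]
  exact and_congr_right' (forall₂_congr fun p hreg =>
    h.meanCurv_eq_one_iff isOpen_univ (Set.mem_univ p) hreg)

theorem isClosed_setOf_dmap_smul_add_smul_eq_zero (h : IsFrontOn f ν Set.univ) (a b : ℝ) :
    IsClosed {p | a • dmap f p + b • dmap ν p = 0} :=
  isOpen_compl_iff.1 <| isOpen_iff_eventually.2 fun _ hp =>
    h.eventually_dmap_smul_add_smul_ne_zero isOpen_univ (Set.mem_univ _) hp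

theorem forall_or_forall_or_forall_isolated [PreconnectedSpace M] (h : IsFrontOn f ν Set.univ)
    (hr : ∀ p, IsLWAt 1 0 f ν p) :
    (∀ p, dmap f p = 0) ∨ (∀ p, dmap f p + dmap ν p = 0) ∨
      ∀ p, (¬ ∀ᶠ x in 𝓝 p, dmap f x = 0 ∨ dmap f x + dmap ν x = 0) ∧
        ∀ᶠ x in 𝓝[≠] p, ¬ (dmap f x = 0 ∨ dmap f x + dmap ν x = 0) := by
  have hf := h.isClosed_setOf_dmap_smul_add_smul_eq_zero 1 0
  have hν := h.isClosed_setOf_dmap_smul_add_smul_eq_zero 1 1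
  simp only [one_smul, zero_smul, add_zero] at hf hν
  have hdisj : Disjoint {p | dmap f p = 0} {p | dmap f p + dmap ν p = 0} :=
    Set.disjoint_left.2 fun p hp hp' =>
      (h.not_isRegularAt_iff isOpen_univ (Set.mem_univ p) (hr p)).2 hp
        (h.isRegularAt_of_dmap_add_eq_zero (Set.mem_univ p) hp')
  have hiso := eq_univ_or_eq_univ_or_forall_isolated hf hν hdisj fun p =>
    h.eventually_or_eventually_not isOpen_univ (fun p _ => hr p) (Set.mem_univ p)
  rwa [Set.eq_univ_iff_forall, Set.eq_univ_iff_forall] at hiso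

theorem eventually_notMem_singularSet [PreconnectedSpace M] (h : IsFrontOn f ν Set.univ)
    (hr : ∀ p, IsLWAt 1 0 f ν p) (hf : ¬ ∀ p, dmap f p = 0) {p : M} (hp : p ∈ singularSet f) :
    ∀ᶠ x in 𝓝[≠] p, x ∉ singularSet f := by
  rcases h.forall_or_forall_or_forall_isolated hr with h0 | h0 | h0
  · exact absurd h0 hf
  · exact absurd (h.isRegularAt_of_dmap_add_eq_zero (Set.mem_univ p) (h0 p)) hp
  · filter_upwards [(h0 p).2] with x hx hxs
    exact hx (.inl ((h.not_isRegularAt_iff isOpen_univ (Set.mem_univ x) (hr x)).1 hxs))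

theorem not_eventually_dmap_add_eq_zero [PreconnectedSpace M] (h : IsFrontOn f ν Set.univ)
    (hr : ∀ p, IsLWAt 1 0 f ν p) (hf : ¬ ∀ p, dmap f p = 0)
    (hν : ¬ ∀ p, dmap f p + dmap ν p = 0) (p : M) : ¬ ∀ᶠ x in 𝓝 p, dmap f x + dmap ν x = 0 := by
  rcases h.forall_or_forall_or_forall_isolated hr with h0 | h0 | h0
  · exact absurd h0 hf
  · exact absurd h0 hν
  · exact fun hev => (h0 p).1 (hev.mono fun _ => .inr)

theorem eq_of_isCMC1Front_parallel [ConnectedSpace M] (h : IsFrontOn f ν Set.univ)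
    (hr : ∀ p, IsLWAt 1 0 (LWFront.parallel f ν δ) (parallelNormal f ν δ) p)
    (hsphere : ¬ InGeodesicSphere f) (hhoro : ¬ InHorosphere f) {δ' : ℝ}
    (hδ' : IsCMC1Front (LWFront.parallel f ν δ') (parallelNormal f ν δ')) : δ' = δ := by
  by_contra hne
  have hP := h.parallel isOpen_univ δ
  have hP' := h.parallel isOpen_univ δ'
  have hadd : ∀ p, dmap (LWFront.parallel f ν δ) p + dmap (parallelNormal f ν δ) p = 0 ↔
      dmap f p + dmap ν p = 0 := fun p => by
    rw [h.dmap_parallel_add isOpen_univ (Set.mem_univ p),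
      smul_eq_zero_iff_right (Real.exp_ne_zero δ)]
  obtain ⟨⟨p, hp⟩, hr'⟩ := hP'.isCMC1Front_iff.1 hδ'
  refine hP.not_eventually_dmap_add_eq_zero hr
    (mt h.inGeodesicSphere_of_dmap_parallel_eq_zero hsphere)
    (fun h0 => hhoro (h.inHorosphere_of_dmap_add_eq_zero fun q => (hadd q).1 (h0 q))) p ?_
  filter_upwards [hP'.eventually_isRegularAt isOpen_univ (Set.mem_univ p) hp] with x hx
  refine (hadd x).2 ((h.frontJet isOpen_univ (Set.mem_univ x)).add_eq_zero_of_isLW tvecBasis ?_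
    ((h.isLWAt_parallel_iff isOpen_univ (Set.mem_univ x) δ 1 0).1 (hr x))
    ((h.isLWAt_parallel_iff isOpen_univ (Set.mem_univ x) δ' 1 0).1 (hr' x hx)))
  intro hexp
  have hδ : Real.exp (2 * δ') = Real.exp (2 * δ) := by linarith
  exact hne (mul_left_cancel₀ two_ne_zero (Real.exp_injective hδ))

end IsFrontOn

theorem IsWeingartenNormal.isLWAt_parallel {ε : ℝ} (hε : 0 < ε)
    (hdense : Dense {x | IsRegularAt f x}) (hν : IsWeingartenNormal ε f ν) (p : M) :
    IsLWAt 1 0 (parallel f ν (Real.log ε / 2)) (parallelNormal f ν (Real.log ε / 2)) p := by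
  rw [hν.1.isLWAt_parallel_iff isOpen_univ (Set.mem_univ p), mul_div_cancel₀ _ two_ne_zero,
    Real.exp_log hε]
  simpa using hν.isLWAt hdense p

end CMC1

end LWFront

end

open LWFront in
theorem corollary3p1_general {M : Type*} [TopologicalSpace M] [ConnectedSpace M]
    [ChartedSpace (EuclideanSpace ℝ (Fin 2)) M] [IsManifold (𝓡 2) ∞ M]
    (ε : ℝ) (hε : 0 < ε) (f : M → R41) (hf : f ∈ W (M := M) ε) (hsphere : ¬ InGeodesicSphere f) :
    ∃ ν : M → R41,
      IsWeingartenNormal ε f ν ∧ (∀ ν' : M → R41, IsWeingartenNormal ε f ν' → ν' = ν) ∧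
      ∃ δ : ℝ,
        IsCMC1Front (parallel f ν δ) (parallelNormal f ν δ) ∧
        (¬ InHorosphere f → ∀ δ' : ℝ,
          IsCMC1Front (parallel f ν δ') (parallelNormal f ν δ') → δ' = δ) ∧
        (∀ p ∈ singularSet (parallel f ν δ), ∀ᶠ x in 𝓝[≠] p, x ∉ singularSet (parallel f ν δ)) ∧
        (∀ p ∈ singularSet (parallel f ν δ), ∃ z : OpenPartialHomeomorph M ℂ,
          p ∈ z.source ∧ IsConformalCoord z (parallel f ν δ)) ∧
        (∀ z : OpenPartialHomeomorph M ℂ, IsConformalCoord z (parallel f ν δ) →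
          DifferentiableOn ℂ (hopf z (parallel f ν δ) (parallelNormal f ν δ)) z.target ∧
          ∀ p ∈ z.source,
            (p ∈ singularSet (parallel f ν δ) ↔
              hopf z (parallel f ν δ) (parallelNormal f ν δ) (z p) = 0 ∧
              dmap (fun x => f x + ν x) p ≠ 0)) := by
  have hdense := dense_isRegularAt hε.ne' hf
  obtain ⟨ν, hν⟩ := exists_isWeingartenNormal hε hf hdense
  have hr := hν.isLWAt_parallel hε hdense
  refine ⟨ν, hν, fun _ => hν.unique hε hdense, Real.log ε / 2, ?_⟩
  generalize Real.log ε / 2 = δ at hr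
  have hP := hν.1.parallel isOpen_univ δ
  have hr_univ : ∀ p ∈ Set.univ, IsLWAt 1 0 (parallel f ν δ) (parallelNormal f ν δ) p :=
    fun p _ => hr p
  have hP0 : ¬ ∀ p, dmap (parallel f ν δ) p = 0 :=
    mt hν.1.inGeodesicSphere_of_dmap_parallel_eq_zero hsphere
  refine ⟨hP.isCMC1Front_iff.2 ⟨?_, fun p _ => hr p⟩,
    fun hhoro _ => hν.1.eq_of_isCMC1Front_parallel hr hsphere hhoro,
    fun p => hP.eventually_notMem_singularSet hr hP0, fun p _ => ?_,
    fun z hz => ⟨hP.differentiableOn_hopf isOpen_univ hr_univ hz z.source.subset_univ,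
      fun p hp => ?_⟩⟩
  · obtain ⟨p, hp⟩ := not_forall.1 hP0
    exact ⟨p, not_not.1 (mt (hP.not_isRegularAt_iff isOpen_univ (Set.mem_univ p) (hr p)).1 hp)⟩
  · obtain ⟨z, hpz, -, hz⟩ := hP.exists_isConformalCoord isOpen_univ hr_univ (Set.mem_univ p)
    exact ⟨z, hpz, hz⟩
  · rw [hP.mem_singularSet_iff_hopf isOpen_univ hr_univ hz z.source.subset_univ hp,
      hν.1.dmap_parallel_add isOpen_univ (Set.mem_univ p),
      hν.1.dmap_add isOpen_univ (Set.mem_univ p), smul_ne_zero_iff_right (Real.exp_ne_zero δ)]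

theorem corollary3p1 {M : Type*} [TopologicalSpace M] [T2Space M] [SecondCountableTopology M]
    [ConnectedSpace M] [ChartedSpace (EuclideanSpace ℝ (Fin 2)) M] [IsManifold (𝓡 2) ∞ M]
    (ε : ℝ) (hε : 0 < ε) (f : M → LWFront.R41) (hf : f ∈ LWFront.W (M := M) ε)
    (hsphere : ¬ LWFront.InGeodesicSphere f) :
    ∃ ν : M → LWFront.R41,
      LWFront.IsWeingartenNormal ε f ν ∧
      (∀ ν' : M → LWFront.R41, LWFront.IsWeingartenNormal ε f ν' → ν' = ν) ∧
      ∃ δ : ℝ,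
        LWFront.IsCMC1Front (LWFront.parallel f ν δ) (LWFront.parallelNormal f ν δ) ∧
        (¬ LWFront.InHorosphere f → ∀ δ' : ℝ,
          LWFront.IsCMC1Front (LWFront.parallel f ν δ') (LWFront.parallelNormal f ν δ') →
            δ' = δ) ∧
        (∀ p ∈ LWFront.singularSet (LWFront.parallel f ν δ),
          ∀ᶠ x in 𝓝[≠] p, x ∉ LWFront.singularSet (LWFront.parallel f ν δ)) ∧
        (∀ p ∈ LWFront.singularSet (LWFront.parallel f ν δ),
          ∃ z : OpenPartialHomeomorph M ℂ,
            p ∈ z.source ∧ LWFront.IsConformalCoord z (LWFront.parallel f ν δ)) ∧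
        (∀ z : OpenPartialHomeomorph M ℂ,
          LWFront.IsConformalCoord z (LWFront.parallel f ν δ) →
            DifferentiableOn ℂ
              (LWFront.hopf z (LWFront.parallel f ν δ) (LWFront.parallelNormal f ν δ))
              z.target ∧
            ∀ p ∈ z.source,
              (p ∈ LWFront.singularSet (LWFront.parallel f ν δ) ↔
                LWFront.hopf z (LWFront.parallel f ν δ) (LWFront.parallelNormal f ν δ) (z p) = 0 ∧
                LWFront.dmap (fun x => f x + ν x) p ≠ 0)) :=
  corollary3p1_general ε hε f hf hsphere
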